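/- Theorem. All $n$-categories below are small strict $n$-categories. The notions of equivalence, $h$-surjectivity and $n$-groupoid are defined by induction on $n$. For $n=0$, $n$-categories are sets, an equivalence is a bijection, an $h$-surjective functor is a surjection, and every set is a $0$-groupoid. For $n>0$, a $1$-cell $f:c\to c'$ of an $n$-category $\mathbb C$ is weakly invertible if for every object $z$ the $(n-1)$-functors $f\circ-:\mathbb C(c',z)\to\mathbb C(c,z)$ and $-\circ f:\mathbb C(z,c)\to\mathbb C(z,c')$ (composition written in diagrammatic order) are equivalences; an $n$-functor $L:\mathbb C\to\mathbb D$ is an equivalence (respectively $h$-surjective) if for every object $d$ of $\mathbb D$ there are an object $c$ of $\mathbb C$ and a weakly invertible $1$-cell $Lc\to d$, and all $L:\mathbb C(c,c')\to\mathbb D(Lc,Lc')$ are equivalences (respectively $h$-surjective); and $\mathbb C$ is an $n$-groupoid if all its $1$-cells are weakly invertible and all its homs $\mathbb C(c,c')$ are $(n-1)$-groupoids. A lax $n$-transformation $\alpha:F\Rightarrow G:\mathbb C\to\mathbb D$ consists, for $n>0$, of $1$-cells $\alpha_c:Fc\to Gc$ and lax $(n-1)$-transformations $\alpha_1^{c,c'}:\alpha_c\circ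 G(-)\Rightarrow F(-)\circ\alpha_{c'}$ on the homs $\mathbb C(c,c')$, compatible with units and with composition (the value at $x\circ y$ being the vertical composite of $\alpha_1(x)\circ G(y)$ and $F(x)\circ\alpha_1(y)$, as transformations in $(x,y)$); for $n=0$ it is an equality $F=G$. A pointed $n$-groupoid is an $n$-groupoid with a chosen object $*$; pointed $n$-functors preserve $*$, and pointed lax transformations have component $\mathrm{id}_*$ at $*$. We write $0$ for the functor constant at $*$. The $h$-kernel of $G:\mathbb B\to\mathbb C$ is the universal triple $(\mathbb K,K,\kappa)$ with $K:\mathbb K\to\mathbb B$ and $\kappa:0\Rightarrow GK$: for all $S:\mathbb X\to\mathbb B$ and lax transformations $\lambda:0\Rightarrow GS$ there is a unique $L:\mathbb X\to\mathbb K$ with $KL=S$ and $\kappa L=\lambda$. (It is the $h$-pullback, in $n$-categories, of $*:\mathbb I\to\mathbb C$, where $\mathbb I$ is the terminal $n$-category, and $G$.) A triple $(F,\varepsilon,G)$ of pointed $n$-functors $F:\mathbb A\to\mathbb B$ and $G:\mathbb B\to\mathbb C$ between pointed $n$-groupoids and a pointed lax $n$-transformation $\varepsilon:0\Rightarrow GF$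 is called exact if the comparison $L:\mathbb A\to\mathbb K$ with the $h$-kernel of $G$, determined by $KL=F$ and $\kappa L=\varepsilon$, is $h$-surjective. For $n\ge1$ and an $n$-groupoid $\mathbb C$, the $(n-1)$-groupoid $\pi_0^{(n)}\mathbb C$ has the same $k$-cells as $\mathbb C$ for $k<n-1$, and its $(n-1)$-cells are the isomorphism classes of $(n-1)$-cells of $\mathbb C$ (so $\pi_0^{(1)}\mathbb C$ is the set of isomorphism classes of objects, and for $n>1$ it has the objects of $\mathbb C$ and homs $\pi_0^{(n-1)}(\mathbb C(c,c'))$). This extends to pointed groupoids, functors and lax transformations. Let $n\ge 1$, and let $(F,\varepsilon,G)$ be an exact triple of pointed $n$-groupoids. Then $(\pi_0^{(n)}F,\pi_0^{(n)}\varepsilon,\pi_0^{(n)}G)$ is an exact triple of pointed $(n-1)$-groupoids. -/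

import Mathlib

universe u

namespace HigherGpd

/-- A (small, strict) `n`-category, presented by the set of all its cells: a `k`-cell is a cell `x`
with `src k x = x`, and it is identified with its iterated identities. `src k` and `tgt k` are the
`k`-source and the `k`-target, and `comp k x y` is the composite (in algebraic order) of `x` and `y`
along their common boundary `tgt k x = src k y`. Composition is a total function; it returns its
first argument when the cells are not composable. -/
structure NCat (n : ℕ) where
  Cell : Type u
  src : ℕ → Cell → Cell
  tgt : ℕ → Cell → Cell
  comp : ℕ → Cell → Cell → Cell
  src_src : ∀ {j k : ℕ} (x : Cell), j < k → src j (src k x) = src j x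
  src_tgt : ∀ {j k : ℕ} (x : Cell), j < k → src j (tgt k x) = src j x
  tgt_src : ∀ {j k : ℕ} (x : Cell), j < k → tgt j (src k x) = tgt j x
  tgt_tgt : ∀ {j k : ℕ} (x : Cell), j < k → tgt j (tgt k x) = tgt j x
  src_src_of_le : ∀ {j k : ℕ} (x : Cell), k ≤ j → src j (src k x) = src k x
  src_tgt_of_le : ∀ {j k : ℕ} (x : Cell), k ≤ j → src j (tgt k x) = tgt k x
  tgt_src_of_le : ∀ {j k : ℕ} (x : Cell), k ≤ j → tgt j (src k x) = src k x
  tgt_tgt_of_le : ∀ {j k : ℕ} (x : Cell), k ≤ j → tgt j (tgt k x) = tgt k x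
  src_dim : ∀ x : Cell, src n x = x
  src_comp_self : ∀ {k : ℕ} {x y : Cell}, tgt k x = src k y → src k (comp k x y) = src k x
  tgt_comp_self : ∀ {k : ℕ} {x y : Cell}, tgt k x = src k y → tgt k (comp k x y) = tgt k y
  src_comp : ∀ {j k : ℕ} {x y : Cell}, k < j → tgt k x = src k y →
    src j (comp k x y) = comp k (src j x) (src j y)
  tgt_comp : ∀ {j k : ℕ} {x y : Cell}, k < j → tgt k x = src k y →
    tgt j (comp k x y) = comp k (tgt j x) (tgt j y)
  id_comp : ∀ (k : ℕ) (x : Cell), comp k (src k x) x = x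
  comp_id : ∀ (k : ℕ) (x : Cell), comp k x (tgt k x) = x
  assoc : ∀ {k : ℕ} {x y z : Cell}, tgt k x = src k y → tgt k y = src k z →
    comp k (comp k x y) z = comp k x (comp k y z)
  interchange : ∀ {p q : ℕ} {c c' d d' : Cell}, p < q → tgt q c = src q c' → tgt q d = src q d' →
    tgt p c = src p d → comp p (comp q c c') (comp q d d') = comp q (comp p c d) (comp p c' d')
  comp_of_ne : ∀ {k : ℕ} {x y : Cell}, tgt k x ≠ src k y → comp k x y = x

namespace NCat

variable {n : ℕ} (C : NCat.{u} n)

theorem tgt_dim (x : C.Cell) : C.tgt n x = x := by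
  have h := C.tgt_src_of_le (j := n) x (le_refl n)
  rwa [C.src_dim] at h

theorem src_of_le {j : ℕ} (h : n ≤ j) (x : C.Cell) : C.src j x = x := by
  have := C.src_src_of_le x h
  rwa [C.src_dim] at this

theorem tgt_of_le {j : ℕ} (h : n ≤ j) (x : C.Cell) : C.tgt j x = x := by
  have := C.tgt_src_of_le x h
  rwa [C.src_dim] at this

theorem src_eq_of_le {j k : ℕ} {x : C.Cell} (hx : C.src k x = x) (h : k ≤ j) : C.src j x = x := by
  rw [← hx, C.src_src_of_le x h]

theorem tgt_eq_of_le {j k : ℕ} {x : C.Cell} (hx : C.src k x = x) (h : k ≤ j) : C.tgt j x = x := by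
  rw [← hx, C.tgt_src_of_le x h]

theorem comp_self_of_le {j k : ℕ} {x : C.Cell} (hx : C.src k x = x) (h : k ≤ j) :
    C.comp j x x = x := by
  have := C.id_comp j x
  rwa [C.src_eq_of_le hx h] at this

theorem comp_of_le {j : ℕ} (h : n ≤ j) (x y : C.Cell) : C.comp j x y = x := by
  by_cases hxy : C.tgt j x = C.src j y
  · rw [C.tgt_of_le h, C.src_of_le h] at hxy
    subst hxy
    exact C.comp_self_of_le (C.src_dim x) h
  · exact C.comp_of_ne hxy

theorem src_self_comp (k : ℕ) (x y : C.Cell) : C.src k (C.comp k x y) = C.src k x := by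
  by_cases hxy : C.tgt k x = C.src k y
  · exact C.src_comp_self hxy
  · rw [C.comp_of_ne hxy]

theorem composable_src {j k : ℕ} (h : k < j) (x y : C.Cell) :
    C.tgt k (C.src j x) = C.src k (C.src j y) ↔ C.tgt k x = C.src k y := by
  rw [C.tgt_src x h, C.src_src y h]

theorem composable_tgt {j k : ℕ} (h : k < j) (x y : C.Cell) :
    C.tgt k (C.tgt j x) = C.src k (C.tgt j y) ↔ C.tgt k x = C.src k y := by
  rw [C.tgt_tgt x h, C.src_tgt y h]

theorem src_comp' {j k : ℕ} (h : k < j) (x y : C.Cell) :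
    C.src j (C.comp k x y) = C.comp k (C.src j x) (C.src j y) := by
  by_cases hxy : C.tgt k x = C.src k y
  · exact C.src_comp h hxy
  · rw [C.comp_of_ne hxy, C.comp_of_ne (mt (C.composable_src h x y).1 hxy)]

theorem tgt_comp' {j k : ℕ} (h : k < j) (x y : C.Cell) :
    C.tgt j (C.comp k x y) = C.comp k (C.tgt j x) (C.tgt j y) := by
  by_cases hxy : C.tgt k x = C.src k y
  · exact C.tgt_comp h hxy
  · rw [C.comp_of_ne hxy, C.comp_of_ne (mt (C.composable_tgt h x y).1 hxy)]

/-- The hom-`n`-category of an `(n+1)`-category: the cells with given `0`-source and `0`-target,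
with all dimensions lowered by one. -/
def Hom {n : ℕ} (C : NCat.{u} (n + 1)) (x y : C.Cell) : NCat.{u} n where
  Cell := {c : C.Cell // C.src 0 c = x ∧ C.tgt 0 c = y}
  src k c := ⟨C.src (k + 1) c.1, by
    rw [C.src_src _ (Nat.succ_pos k), C.tgt_src _ (Nat.succ_pos k)]; exact c.2⟩
  tgt k c := ⟨C.tgt (k + 1) c.1, by
    rw [C.src_tgt _ (Nat.succ_pos k), C.tgt_tgt _ (Nat.succ_pos k)]; exact c.2⟩
  comp k c d := ⟨C.comp (k + 1) c.1 d.1, by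
    rw [← C.src_src _ (Nat.succ_pos k), ← C.tgt_src _ (Nat.succ_pos k), C.src_self_comp,
      C.src_src _ (Nat.succ_pos k), C.tgt_src _ (Nat.succ_pos k)]; exact c.2⟩
  src_src x h := Subtype.ext (C.src_src _ (Nat.succ_lt_succ h))
  src_tgt x h := Subtype.ext (C.src_tgt _ (Nat.succ_lt_succ h))
  tgt_src x h := Subtype.ext (C.tgt_src _ (Nat.succ_lt_succ h))
  tgt_tgt x h := Subtype.ext (C.tgt_tgt _ (Nat.succ_lt_succ h))
  src_src_of_le x h := Subtype.ext (C.src_src_of_le _ (Nat.succ_le_succ h))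
  src_tgt_of_le x h := Subtype.ext (C.src_tgt_of_le _ (Nat.succ_le_succ h))
  tgt_src_of_le x h := Subtype.ext (C.tgt_src_of_le _ (Nat.succ_le_succ h))
  tgt_tgt_of_le x h := Subtype.ext (C.tgt_tgt_of_le _ (Nat.succ_le_succ h))
  src_dim x := Subtype.ext (C.src_dim _)
  src_comp_self h := Subtype.ext (C.src_comp_self (congrArg Subtype.val h))
  tgt_comp_self h := Subtype.ext (C.tgt_comp_self (congrArg Subtype.val h))
  src_comp h h' := Subtype.ext (C.src_comp (Nat.succ_lt_succ h) (congrArg Subtype.val h'))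
  tgt_comp h h' := Subtype.ext (C.tgt_comp (Nat.succ_lt_succ h) (congrArg Subtype.val h'))
  id_comp k x := Subtype.ext (C.id_comp _ _)
  comp_id k x := Subtype.ext (C.comp_id _ _)
  assoc h h' := Subtype.ext (C.assoc (congrArg Subtype.val h) (congrArg Subtype.val h'))
  interchange h h₁ h₂ h₃ := Subtype.ext (C.interchange (Nat.succ_lt_succ h)
    (congrArg Subtype.val h₁) (congrArg Subtype.val h₂) (congrArg Subtype.val h₃))
  comp_of_ne h := Subtype.ext (C.comp_of_ne fun e => h (Subtype.ext e))

/-- `f` is a `1`-cell from `x` to `y`. -/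
structure IsArrow (f x y : C.Cell) : Prop where
  src_one : C.src 1 f = f
  src_zero : C.src 0 f = x
  tgt_zero : C.tgt 0 f = y

/-- The terminal `n`-category. -/
def terminal (n : ℕ) : NCat.{u} n where
  Cell := PUnit
  src _ x := x
  tgt _ x := x
  comp _ x _ := x
  src_src _ _ := rfl
  src_tgt _ _ := rfl
  tgt_src _ _ := rfl
  tgt_tgt _ _ := rfl
  src_src_of_le _ _ := rfl
  src_tgt_of_le _ _ := rfl
  tgt_src_of_le _ _ := rfl
  tgt_tgt_of_le _ _ := rfl
  src_dim _ := rfl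
  src_comp_self _ := rfl
  tgt_comp_self _ := rfl
  src_comp _ _ := rfl
  tgt_comp _ _ := rfl
  id_comp _ _ := rfl
  comp_id _ _ := rfl
  assoc _ _ := rfl
  interchange _ _ _ _ := rfl
  comp_of_ne _ := rfl

end NCat

/-- A (strict) `n`-functor. -/
@[ext] structure NFunctor {n : ℕ} (C D : NCat.{u} n) where
  map : C.Cell → D.Cell
  map_src : ∀ (k : ℕ) (x : C.Cell), map (C.src k x) = D.src k (map x)
  map_tgt : ∀ (k : ℕ) (x : C.Cell), map (C.tgt k x) = D.tgt k (map x)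
  map_comp : ∀ (k : ℕ) (x y : C.Cell), C.tgt k x = C.src k y →
    map (C.comp k x y) = D.comp k (map x) (map y)

namespace NFunctor

variable {n : ℕ}

/-- Composition of `n`-functors, in algebraic order. -/
def comp {C D E : NCat.{u} n} (F : NFunctor C D) (G : NFunctor D E) : NFunctor C E where
  map x := G.map (F.map x)
  map_src k x := by rw [F.map_src, G.map_src]
  map_tgt k x := by rw [F.map_tgt, G.map_tgt]
  map_comp k x y h := by
    rw [F.map_comp k x y h, G.map_comp]
    rw [← F.map_tgt, ← F.map_src, h]

/-- The functor induced on hom-categories, with the endpoints of the target prescribed up to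
equality. -/
def homTo {C D : NCat.{u} (n + 1)} (F : NFunctor C D) {x y : C.Cell} {x' y' : D.Cell}
    (hx : F.map x = x') (hy : F.map y = y') : NFunctor (C.Hom x y) (D.Hom x' y') where
  map c := ⟨F.map c.1, by rw [← F.map_src, c.2.1, hx], by rw [← F.map_tgt, c.2.2, hy]⟩
  map_src k c := Subtype.ext (F.map_src _ _)
  map_tgt k c := Subtype.ext (F.map_tgt _ _)
  map_comp k c d h := Subtype.ext (F.map_comp _ _ _ (congrArg Subtype.val h))

/-- The functor induced on hom-categories. -/
def hom {C D : NCat.{u} (n + 1)} (F : NFunctor C D) (x y : C.Cell) :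
    NFunctor (C.Hom x y) (D.Hom (F.map x) (F.map y)) :=
  F.homTo rfl rfl

/-- The unique functor to the terminal `n`-category. -/
def toTerminal (C : NCat.{u} n) : NFunctor C (NCat.terminal n) where
  map _ := PUnit.unit
  map_src _ _ := rfl
  map_tgt _ _ := rfl
  map_comp _ _ _ _ := rfl

/-- The functor from the terminal `n`-category that picks out an object. -/
def point (C : NCat.{u} n) (c : C.Cell) (hc : C.src 0 c = c) : NFunctor (NCat.terminal n) C where
  map _ := c
  map_src k _ := (C.src_eq_of_le hc (Nat.zero_le k)).symm
  map_tgt k _ := (C.tgt_eq_of_le hc (Nat.zero_le k)).symm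
  map_comp k _ _ _ := (C.comp_self_of_le hc (Nat.zero_le k)).symm

end NFunctor

namespace NCat

variable {n : ℕ} (C : NCat.{u} (n + 1)) {f x y : C.Cell}

/-- Composition `f ∘ -` with a `1`-cell `f : x ⟶ y`, as a functor of hom-categories. -/
def precomp (hf : C.IsArrow f x y) (z : C.Cell) : NFunctor (C.Hom y z) (C.Hom x z) where
  map c := ⟨C.comp 0 f c.1, by
      rw [C.src_comp_self (by rw [hf.tgt_zero, c.2.1]), hf.src_zero],
    by rw [C.tgt_comp_self (by rw [hf.tgt_zero, c.2.1]), c.2.2]⟩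
  map_src k c := Subtype.ext <| by
    change C.comp 0 f (C.src (k + 1) c.1) = C.src (k + 1) (C.comp 0 f c.1)
    rw [C.src_comp' (Nat.succ_pos k), C.src_eq_of_le hf.src_one (Nat.succ_le_succ (Nat.zero_le k))]
  map_tgt k c := Subtype.ext <| by
    change C.comp 0 f (C.tgt (k + 1) c.1) = C.tgt (k + 1) (C.comp 0 f c.1)
    rw [C.tgt_comp' (Nat.succ_pos k), C.tgt_eq_of_le hf.src_one (Nat.succ_le_succ (Nat.zero_le k))]
  map_comp k c d h := Subtype.ext <| by
    have h' : C.tgt (k + 1) c.1 = C.src (k + 1) d.1 := congrArg Subtype.val h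
    have h1 : 1 ≤ k + 1 := Nat.succ_le_succ (Nat.zero_le k)
    change C.comp 0 f (C.comp (k + 1) c.1 d.1) =
      C.comp (k + 1) (C.comp 0 f c.1) (C.comp 0 f d.1)
    rw [← C.interchange (Nat.succ_pos k) (by
      rw [C.src_eq_of_le hf.src_one h1, C.tgt_eq_of_le hf.src_one h1]) h'
      (by rw [hf.tgt_zero, c.2.1]), C.comp_self_of_le hf.src_one h1]

/-- Composition `- ∘ f` with a `1`-cell `f : x ⟶ y`, as a functor of hom-categories. -/
def postcomp (hf : C.IsArrow f x y) (z : C.Cell) : NFunctor (C.Hom z x) (C.Hom z y) where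
  map c := ⟨C.comp 0 c.1 f, by
      rw [C.src_comp_self (by rw [hf.src_zero, c.2.2]), c.2.1],
    by rw [C.tgt_comp_self (by rw [hf.src_zero, c.2.2]), hf.tgt_zero]⟩
  map_src k c := Subtype.ext <| by
    change C.comp 0 (C.src (k + 1) c.1) f = C.src (k + 1) (C.comp 0 c.1 f)
    rw [C.src_comp' (Nat.succ_pos k), C.src_eq_of_le hf.src_one (Nat.succ_le_succ (Nat.zero_le k))]
  map_tgt k c := Subtype.ext <| by
    change C.comp 0 (C.tgt (k + 1) c.1) f = C.tgt (k + 1) (C.comp 0 c.1 f)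
    rw [C.tgt_comp' (Nat.succ_pos k), C.tgt_eq_of_le hf.src_one (Nat.succ_le_succ (Nat.zero_le k))]
  map_comp k c d h := Subtype.ext <| by
    have h' : C.tgt (k + 1) c.1 = C.src (k + 1) d.1 := congrArg Subtype.val h
    have h1 : 1 ≤ k + 1 := Nat.succ_le_succ (Nat.zero_le k)
    change C.comp 0 (C.comp (k + 1) c.1 d.1) f =
      C.comp (k + 1) (C.comp 0 c.1 f) (C.comp 0 d.1 f)
    rw [← C.interchange (Nat.succ_pos k) h' (by
      rw [C.src_eq_of_le hf.src_one h1, C.tgt_eq_of_le hf.src_one h1])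
      (by rw [hf.src_zero, c.2.2]), C.comp_self_of_le hf.src_one h1]

end NCat

/-- Equivalences of `n`-categories: bijections for `n = 0`; for `n > 0`, functors that are
essentially surjective on objects (every object `d` of the target receives a weakly invertible
`1`-cell `F c ⟶ d`) and induce equivalences on all hom-categories. -/
def IsEquivalence : (n : ℕ) → {C D : NCat.{u} n} → NFunctor C D → Prop
  | 0, _, _, F => Function.Bijective F.map
  | n + 1, C, D, F =>
    (∀ d : D.Cell, D.src 0 d = d → ∃ c : C.Cell, C.src 0 c = c ∧
      ∃ (f : D.Cell) (hf : D.IsArrow f (F.map c) d), ∀ z : D.Cell, D.src 0 z = z →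
        IsEquivalence n (D.precomp hf z) ∧ IsEquivalence n (D.postcomp hf z)) ∧
    ∀ x y : C.Cell, C.src 0 x = x → C.src 0 y = y → IsEquivalence n (F.hom x y)

/-- A `1`-cell is weakly invertible (an equivalence) if composing with it, on either side, gives
equivalences of hom-categories. -/
def NCat.IsWeaklyInvertible {n : ℕ} (C : NCat.{u} (n + 1)) {f x y : C.Cell}
    (hf : C.IsArrow f x y) : Prop :=
  ∀ z : C.Cell, C.src 0 z = z →
    IsEquivalence n (C.precomp hf z) ∧ IsEquivalence n (C.postcomp hf z)

/-- The `h`-surjective functors: surjections for `n = 0`; for `n > 0`, functors that are essentially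
surjective on objects and `h`-surjective on all hom-categories. -/
def IsHSurjective : (n : ℕ) → {C D : NCat.{u} n} → NFunctor C D → Prop
  | 0, _, _, F => Function.Surjective F.map
  | n + 1, C, D, F =>
    (∀ d : D.Cell, D.src 0 d = d → ∃ c : C.Cell, C.src 0 c = c ∧
      ∃ (f : D.Cell) (hf : D.IsArrow f (F.map c) d), D.IsWeaklyInvertible hf) ∧
    ∀ x y : C.Cell, C.src 0 x = x → C.src 0 y = y → IsHSurjective n (F.hom x y)

/-- An `n`-groupoid: for `n > 0`, all `1`-cells are weakly invertible and all hom-categories are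
groupoids. -/
def IsGroupoid : (n : ℕ) → NCat.{u} n → Prop
  | 0, _ => True
  | n + 1, C =>
    (∀ (f x y : C.Cell) (hf : C.IsArrow f x y), C.IsWeaklyInvertible hf) ∧
    ∀ x y : C.Cell, C.src 0 x = x → C.src 0 y = y → IsGroupoid n (C.Hom x y)

/-- Vertical composition of transformations, on the level of maps on cells, for transformations
between functors on the iterated homs in dimension `k` (which are `m`-categories):
on objects `(ω α)(c) = ω(c) ∘ α(c)`, and on the homs from `c₀` to `c₀'` the transformation `ω α` is
the vertical composite of `ω(c₀) ∘ α(-)` and `ω(-) ∘ α(c₀')`. The domain is a set of cells `P` with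
`k`-sources `s k` and `k`-targets `t k`. -/
def vcomp {n : ℕ} {P : Type u} (s t : ℕ → P → P) (D : NCat.{u} n) :
    (m k : ℕ) → (ω α : P → D.Cell) → P → D.Cell
  | 0, _, ω, _ => ω
  | m + 1, k, ω, α => vcomp s t D m (k + 1) (fun c => D.comp k (ω (s k c)) (α c))
      (fun c => D.comp k (ω c) (α (t k c)))

/-- `α` is a lax transformation from `F` to `G`, on the iterated homs in dimension `k` of two
categories (these homs are `m`-categories), where `F`, `G` and `α` are given by maps on cells. All
pairs of parallel `(k-1)`-cells are treated at once.

* `m = 0`: `F`, `G` and `α` are the same map.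
* `m > 0`: `α` assigns to each object `c` of the homs an arrow `F c ⟶ G c`; on the homs from `c₀`
  to `c₀'` it is a lax transformation from `α(c₀) ∘ G(-)` to `F(-) ∘ α(c₀')`; and on
  `c ∘ c'` it is the vertical composite of `α(-) ∘ G(-)` and `F(-) ∘ α(-)`, evaluated at `(c, c')`.

Compatibility with units is automatic, because cells are identified with their identities. -/
def IsLaxTrans {n : ℕ} (C D : NCat.{u} n) (α : C.Cell → D.Cell) :
    (m k : ℕ) → (F G : C.Cell → D.Cell) → Prop
  | 0, _, F, G => ∀ c, α c = F c ∧ α c = G c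
  | m + 1, k, F, G =>
    (∀ c, D.src k (α c) = F (C.src k c) ∧ D.tgt k (α c) = G (C.tgt k c)) ∧
    IsLaxTrans C D α m (k + 1) (fun c => D.comp k (α (C.src k c)) (G c))
      (fun c => D.comp k (F c) (α (C.tgt k c))) ∧
    ∀ c c' : C.Cell, C.tgt k c = C.src k c' →
      α (C.comp k c c') =
        vcomp (fun j p => (C.src j p.1, C.src j p.2)) (fun j p => (C.tgt j p.1, C.tgt j p.2)) D
          m (k + 1) (fun p : C.Cell × C.Cell => D.comp k (α p.1) (G p.2))
          (fun p => D.comp k (F p.1) (α p.2)) (c, c')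

/-- A lax `n`-transformation between `n`-functors. It sends a `k`-cell to a `(k+1)`-cell. -/
structure LaxTrans {n : ℕ} {C D : NCat.{u} n} (F G : NFunctor C D) where
  app : C.Cell → D.Cell
  isLaxTrans : IsLaxTrans C D app n 0 F.map G.map

/-- The same transformation between equal functors. -/
def LaxTrans.cast {n : ℕ} {C D : NCat.{u} n} {F G F' G' : NFunctor C D} (α : LaxTrans F G)
    (hF : F = F') (hG : G = G') : LaxTrans F' G' where
  app := α.app
  isLaxTrans := hF ▸ hG ▸ α.isLaxTrans

/-- `(P, p, q, ε)` is an `h`-pullback of `F` and `G` in `n`-categories. -/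
def IsHPullback {n : ℕ} {A B C P : NCat.{u} n} (F : NFunctor A B) (G : NFunctor C B)
    (p : NFunctor P A) (q : NFunctor P C) (ε : LaxTrans (p.comp F) (q.comp G)) : Prop :=
  ∀ (X : NCat.{u} n) (r : NFunctor X A) (s : NFunctor X C) (lam : LaxTrans (r.comp F) (s.comp G)),
    ∃! L : NFunctor X P, L.comp p = r ∧ L.comp q = s ∧ ∀ x, ε.app (L.map x) = lam.app x

/-! ### The functor `π₀` -/

namespace NCat

variable {n : ℕ} (C : NCat.{u} (n + 1))

/-- Isomorphism of `n`-cells in an `(n+1)`-category. -/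
def IsoCell (x y : C.Cell) : Prop :=
  ∃ w w' : C.Cell, C.src n w = x ∧ C.tgt n w = y ∧ C.src n w' = y ∧ C.tgt n w' = x ∧
    C.comp n w w' = x ∧ C.comp n w' w = y

variable {C}

theorem IsoCell.refl {x : C.Cell} (hx : C.src n x = x) : C.IsoCell x x :=
  ⟨x, x, hx, C.tgt_eq_of_le hx le_rfl, hx, C.tgt_eq_of_le hx le_rfl, C.comp_self_of_le hx le_rfl,
    C.comp_self_of_le hx le_rfl⟩

theorem IsoCell.symm {x y : C.Cell} : C.IsoCell x y → C.IsoCell y x := by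
  rintro ⟨w, w', h1, h2, h3, h4, h5, h6⟩
  exact ⟨w', w, h3, h4, h1, h2, h6, h5⟩

theorem IsoCell.trans {x y z : C.Cell} : C.IsoCell x y → C.IsoCell y z → C.IsoCell x z := by
  rintro ⟨w, w', h1, h2, h3, h4, h5, h6⟩ ⟨v, v', k1, k2, k3, k4, k5, k6⟩
  refine ⟨C.comp n w v, C.comp n v' w', ?_, ?_, ?_, ?_, ?_, ?_⟩
  · rw [C.src_self_comp, h1]
  · rw [C.tgt_comp_self (by rw [h2, k1]), k2]
  · rw [C.src_self_comp, k3]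
  · rw [C.tgt_comp_self (by rw [k4, h3]), h4]
  · rw [C.assoc (by rw [h2, k1]) (by rw [C.src_self_comp, k2, k3]),
      ← C.assoc (x := v) (by rw [k2, k3]) (by rw [k4, h3]), k5, ← h3, C.id_comp, h5]
  · rw [C.assoc (by rw [k4, h3]) (by rw [C.src_self_comp, h4, h1]),
      ← C.assoc (x := w') (by rw [h4, h1]) (by rw [h2, k1]), h6, ← k1, C.id_comp, k6]

theorem IsoCell.src_eq {x y : C.Cell} {k : ℕ} (hk : k < n) (h : C.IsoCell x y) :
    C.src k x = C.src k y := by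
  obtain ⟨w, w', h1, h2, -⟩ := h
  rw [← h1, ← h2, C.src_src _ hk, C.src_tgt _ hk]

theorem IsoCell.tgt_eq {x y : C.Cell} {k : ℕ} (hk : k < n) (h : C.IsoCell x y) :
    C.tgt k x = C.tgt k y := by
  obtain ⟨w, w', h1, h2, -⟩ := h
  rw [← h1, ← h2, C.tgt_src _ hk, C.tgt_tgt _ hk]

theorem IsoCell.comp {x x' y y' : C.Cell} {k : ℕ} (hk : k < n) (h : C.IsoCell x x')
    (h' : C.IsoCell y y') : C.IsoCell (C.comp k x y) (C.comp k x' y') := by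
  by_cases hc : C.tgt k x = C.src k y
  · obtain ⟨w, w', h1, h2, h3, h4, h5, h6⟩ := h
    obtain ⟨v, v', k1, k2, k3, k4, k5, k6⟩ := h'
    have e1 : C.tgt k w = C.src k v := by
      rw [← C.tgt_src w hk, ← C.src_src v hk, h1, k1, hc]
    have e2 : C.tgt k w' = C.src k v' := by
      rw [← C.tgt_tgt w' hk, ← C.src_tgt v' hk, h4, k4, hc]
    refine ⟨C.comp k w v, C.comp k w' v', ?_, ?_, ?_, ?_, ?_, ?_⟩
    · rw [C.src_comp' hk, h1, k1]
    · rw [C.tgt_comp' hk, h2, k2]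
    · rw [C.src_comp' hk, h3, k3]
    · rw [C.tgt_comp' hk, h4, k4]
    · rw [← C.interchange hk (by rw [h2, h3]) (by rw [k2, k3]) e1, h5, k5]
    · rw [← C.interchange hk (by rw [h4, h1]) (by rw [k4, k1]) e2, h6, k6]
  · rw [C.comp_of_ne hc, C.comp_of_ne (by rwa [← h.tgt_eq hk, ← h'.src_eq hk])]
    exact h

variable (C)

/-- The `n`-cells of an `(n+1)`-category up to isomorphism. -/
def isoSetoid : Setoid {x : C.Cell // C.src n x = x} where
  r x y := C.IsoCell x.1 y.1
  iseqv := ⟨fun x => IsoCell.refl x.2, fun h => h.symm, fun h h' => h.trans h'⟩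

/-- The class of (the `n`-source of) a cell. -/
def cls (x : C.Cell) : Quotient C.isoSetoid :=
  Quotient.mk _ ⟨C.src n x, C.src_src_of_le x le_rfl⟩

variable {C}

theorem cls_eq_iff {x y : C.Cell} : C.cls x = C.cls y ↔ C.IsoCell (C.src n x) (C.src n y) :=
  Quotient.eq

theorem cls_eq_of_iso {x y : C.Cell} (h : C.IsoCell x y) (hx : C.src n x = x)
    (hy : C.src n y = y) : C.cls x = C.cls y := by
  rw [cls_eq_iff, hx, hy]
  exact h

theorem cls_src (x : C.Cell) : C.cls (C.src n x) = C.cls x := by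
  rw [cls_eq_iff, C.src_src_of_le x le_rfl]
  exact IsoCell.refl (C.src_src_of_le x le_rfl)

theorem exists_cls (X : Quotient C.isoSetoid) : ∃ x, C.src n x = x ∧ X = C.cls x := by
  induction X using Quotient.inductionOn with
  | h a => exact ⟨a.1, a.2, by unfold cls; congr 1; exact Subtype.ext a.2.symm⟩

theorem cls_src_congr {x y : C.Cell} {k : ℕ} (hk : k < n) (h : C.cls x = C.cls y) :
    C.src k x = C.src k y := by
  have := IsoCell.src_eq hk (cls_eq_iff.1 h)
  rwa [C.src_src _ hk, C.src_src _ hk] at this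

variable (C)

/-- The `k`-source on classes of `n`-cells. -/
def piSrc (k : ℕ) (X : Quotient C.isoSetoid) : Quotient C.isoSetoid :=
  if hk : k < n then Quotient.liftOn X (fun x => C.cls (C.src k x.1))
    (fun _ _ h => congrArg C.cls (IsoCell.src_eq hk h)) else X

/-- The `k`-target on classes of `n`-cells. -/
def piTgt (k : ℕ) (X : Quotient C.isoSetoid) : Quotient C.isoSetoid :=
  if hk : k < n then Quotient.liftOn X (fun x => C.cls (C.tgt k x.1))
    (fun _ _ h => congrArg C.cls (IsoCell.tgt_eq hk h)) else X

/-- The `k`-composition on classes of `n`-cells. -/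
def piComp (k : ℕ) (X Y : Quotient C.isoSetoid) : Quotient C.isoSetoid :=
  if hk : k < n then Quotient.liftOn₂ X Y (fun x y => C.cls (C.comp k x.1 y.1))
    (fun x y x' y' h h' => cls_eq_of_iso (IsoCell.comp hk h h')
      (by rw [C.src_comp' hk, x.2, y.2]) (by rw [C.src_comp' hk, x'.2, y'.2])) else X

theorem piSrc_lt {k : ℕ} (x : C.Cell) (hk : k < n) : C.piSrc k (C.cls x) = C.cls (C.src k x) := by
  simp only [piSrc, dif_pos hk, cls, Quotient.liftOn_mk, C.src_src x hk]

theorem piTgt_lt {k : ℕ} (x : C.Cell) (hk : k < n) : C.piTgt k (C.cls x) = C.cls (C.tgt k x) := by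
  simp only [piTgt, dif_pos hk, cls, Quotient.liftOn_mk, C.tgt_src x hk]

theorem piComp_lt {k : ℕ} (x y : C.Cell) (hk : k < n) :
    C.piComp k (C.cls x) (C.cls y) = C.cls (C.comp k x y) := by
  rw [← cls_src (C.comp k x y), C.src_comp' hk]
  simp only [piComp, dif_pos hk, cls, Quotient.liftOn₂_mk]

theorem piSrc_ge {k : ℕ} (X : Quotient C.isoSetoid) (hk : n ≤ k) : C.piSrc k X = X :=
  dif_neg (not_lt.2 hk)

theorem piTgt_ge {k : ℕ} (X : Quotient C.isoSetoid) (hk : n ≤ k) : C.piTgt k X = X :=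
  dif_neg (not_lt.2 hk)

theorem piComp_ge {k : ℕ} (X Y : Quotient C.isoSetoid) (hk : n ≤ k) : C.piComp k X Y = X :=
  dif_neg (not_lt.2 hk)

theorem composable_of_pi {k : ℕ} {x y : C.Cell} (hk : k < n)
    (h : C.piTgt k (C.cls x) = C.piSrc k (C.cls y)) : C.tgt k x = C.src k y := by
  rw [C.piSrc_lt _ hk, C.piTgt_lt _ hk] at h
  have := cls_src_congr hk h
  rwa [C.src_tgt_of_le _ le_rfl, C.src_src_of_le _ le_rfl] at this

/-- `π₀` of an `(n+1)`-category. Its `k`-cells for `k < n` are those of `C`, and its `n`-cells are the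
isomorphism classes of `n`-cells of `C`; so its objects are those of `C` and its homs are `π₀` of
the homs of `C` if `n > 0`, and it is the set of isomorphism classes of objects if `n = 0`. -/
def piZero : NCat.{u} n :=
  { Cell := Quotient C.isoSetoid
    src := C.piSrc
    tgt := C.piTgt
    comp := C.piComp
    src_src := by
      intro j k X h
      obtain ⟨x, -, rfl⟩ := exists_cls X
      by_cases hk : k < n
      · rw [C.piSrc_lt _ hk, C.piSrc_lt _ (h.trans hk), C.piSrc_lt _ (h.trans hk), C.src_src _ h]
      · rw [C.piSrc_ge (k := k) _ (not_lt.1 hk)]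
    src_tgt := by
      intro j k X h
      obtain ⟨x, -, rfl⟩ := exists_cls X
      by_cases hk : k < n
      · rw [C.piTgt_lt _ hk, C.piSrc_lt _ (h.trans hk), C.piSrc_lt _ (h.trans hk), C.src_tgt _ h]
      · rw [C.piTgt_ge (k := k) _ (not_lt.1 hk)]
    tgt_src := by
      intro j k X h
      obtain ⟨x, -, rfl⟩ := exists_cls X
      by_cases hk : k < n
      · rw [C.piSrc_lt _ hk, C.piTgt_lt _ (h.trans hk), C.piTgt_lt _ (h.trans hk), C.tgt_src _ h]
      · rw [C.piSrc_ge (k := k) _ (not_lt.1 hk)]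
    tgt_tgt := by
      intro j k X h
      obtain ⟨x, -, rfl⟩ := exists_cls X
      by_cases hk : k < n
      · rw [C.piTgt_lt _ hk, C.piTgt_lt _ (h.trans hk), C.piTgt_lt _ (h.trans hk), C.tgt_tgt _ h]
      · rw [C.piTgt_ge (k := k) _ (not_lt.1 hk)]
    src_src_of_le := by
      intro j k X h
      obtain ⟨x, -, rfl⟩ := exists_cls X
      by_cases hj : j < n
      · rw [C.piSrc_lt _ (h.trans_lt hj), C.piSrc_lt _ hj, C.src_src_of_le _ h]
      · rw [C.piSrc_ge (k := j) _ (not_lt.1 hj)]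
    src_tgt_of_le := by
      intro j k X h
      obtain ⟨x, -, rfl⟩ := exists_cls X
      by_cases hj : j < n
      · rw [C.piTgt_lt _ (h.trans_lt hj), C.piSrc_lt _ hj, C.src_tgt_of_le _ h]
      · rw [C.piSrc_ge (k := j) _ (not_lt.1 hj)]
    tgt_src_of_le := by
      intro j k X h
      obtain ⟨x, -, rfl⟩ := exists_cls X
      by_cases hj : j < n
      · rw [C.piSrc_lt _ (h.trans_lt hj), C.piTgt_lt _ hj, C.tgt_src_of_le _ h]
      · rw [C.piTgt_ge (k := j) _ (not_lt.1 hj)]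
    tgt_tgt_of_le := by
      intro j k X h
      obtain ⟨x, -, rfl⟩ := exists_cls X
      by_cases hj : j < n
      · rw [C.piTgt_lt _ (h.trans_lt hj), C.piTgt_lt _ hj, C.tgt_tgt_of_le _ h]
      · rw [C.piTgt_ge (k := j) _ (not_lt.1 hj)]
    src_dim := fun X => C.piSrc_ge X le_rfl
    src_comp_self := by
      intro k X Y h
      obtain ⟨x, -, rfl⟩ := exists_cls X
      obtain ⟨y, -, rfl⟩ := exists_cls Y
      by_cases hk : k < n
      · rw [C.piComp_lt _ _ hk, C.piSrc_lt _ hk, C.piSrc_lt _ hk, C.src_self_comp]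
      · rw [C.piComp_ge _ _ (not_lt.1 hk)]
    tgt_comp_self := by
      intro k X Y h
      obtain ⟨x, -, rfl⟩ := exists_cls X
      obtain ⟨y, -, rfl⟩ := exists_cls Y
      by_cases hk : k < n
      · rw [C.piComp_lt _ _ hk, C.piTgt_lt _ hk, C.piTgt_lt _ hk, C.tgt_comp_self (C.composable_of_pi hk h)]
      · rw [C.piComp_ge _ _ (not_lt.1 hk), h, C.piSrc_ge _ (not_lt.1 hk), C.piTgt_ge _ (not_lt.1 hk)]
    src_comp := by
      intro j k X Y hjk h
      obtain ⟨x, -, rfl⟩ := exists_cls X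
      obtain ⟨y, -, rfl⟩ := exists_cls Y
      by_cases hj : j < n
      · have hk := hjk.trans hj
        rw [C.piComp_lt _ _ hk, C.piSrc_lt _ hj, C.piSrc_lt _ hj, C.piSrc_lt _ hj, C.piComp_lt _ _ hk, C.src_comp' hjk]
      · rw [C.piSrc_ge _ (not_lt.1 hj), C.piSrc_ge _ (not_lt.1 hj), C.piSrc_ge _ (not_lt.1 hj)]
    tgt_comp := by
      intro j k X Y hjk h
      obtain ⟨x, -, rfl⟩ := exists_cls X
      obtain ⟨y, -, rfl⟩ := exists_cls Y
      by_cases hj : j < n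
      · have hk := hjk.trans hj
        rw [C.piComp_lt _ _ hk, C.piTgt_lt _ hj, C.piTgt_lt _ hj, C.piTgt_lt _ hj, C.piComp_lt _ _ hk, C.tgt_comp' hjk]
      · rw [C.piTgt_ge _ (not_lt.1 hj), C.piTgt_ge _ (not_lt.1 hj), C.piTgt_ge _ (not_lt.1 hj)]
    id_comp := by
      intro k X
      obtain ⟨x, -, rfl⟩ := exists_cls X
      by_cases hk : k < n
      · rw [C.piSrc_lt _ hk, C.piComp_lt _ _ hk, C.id_comp]
      · rw [C.piComp_ge _ _ (not_lt.1 hk), C.piSrc_ge _ (not_lt.1 hk)]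
    comp_id := by
      intro k X
      obtain ⟨x, -, rfl⟩ := exists_cls X
      by_cases hk : k < n
      · rw [C.piTgt_lt _ hk, C.piComp_lt _ _ hk, C.comp_id]
      · rw [C.piComp_ge _ _ (not_lt.1 hk)]
    assoc := by
      intro k X Y Z h h'
      obtain ⟨x, -, rfl⟩ := exists_cls X
      obtain ⟨y, -, rfl⟩ := exists_cls Y
      obtain ⟨z, -, rfl⟩ := exists_cls Z
      by_cases hk : k < n
      · rw [C.piComp_lt _ _ hk, C.piComp_lt _ _ hk, C.piComp_lt _ _ hk, C.piComp_lt _ _ hk, C.assoc (C.composable_of_pi hk h) (C.composable_of_pi hk h')]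
      · rw [C.piComp_ge _ _ (not_lt.1 hk), C.piComp_ge _ _ (not_lt.1 hk), C.piComp_ge _ _ (not_lt.1 hk)]
    interchange := by
      intro p q X X' Y Y' hpq h1 h2 h3
      obtain ⟨x, -, rfl⟩ := exists_cls X
      obtain ⟨x', -, rfl⟩ := exists_cls X'
      obtain ⟨y, -, rfl⟩ := exists_cls Y
      obtain ⟨y', -, rfl⟩ := exists_cls Y'
      by_cases hq : q < n
      · have hp := hpq.trans hq
        rw [C.piComp_lt _ _ hq, C.piComp_lt _ _ hq, C.piComp_lt _ _ hp, C.piComp_lt _ _ hp, C.piComp_lt _ _ hp, C.piComp_lt _ _ hq,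
          C.interchange hpq (C.composable_of_pi hq h1) (C.composable_of_pi hq h2) (C.composable_of_pi hp h3)]
      · rw [C.piComp_ge (k := q) _ _ (not_lt.1 hq), C.piComp_ge (k := q) _ _ (not_lt.1 hq),
          C.piComp_ge (k := q) _ _ (not_lt.1 hq)]
    comp_of_ne := by
      intro k X Y h
      obtain ⟨x, -, rfl⟩ := exists_cls X
      obtain ⟨y, -, rfl⟩ := exists_cls Y
      by_cases hk : k < n
      · rw [C.piComp_lt _ _ hk, C.comp_of_ne]
        intro e
        exact h (by rw [C.piTgt_lt _ hk, C.piSrc_lt _ hk, e])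
      · exact C.piComp_ge _ _ (not_lt.1 hk) }

/-- The cell of `π₀` represented by (the `n`-source of) a cell. -/
def toPi (x : C.Cell) : C.piZero.Cell := C.cls x

variable {C}

theorem exists_toPi (X : C.piZero.Cell) : ∃ x, C.src n x = x ∧ X = C.toPi x := exists_cls X

theorem toPi_src_dim (x : C.Cell) : C.toPi (C.src n x) = C.toPi x := cls_src x

theorem toPi_src {k : ℕ} (hk : k < n) (x : C.Cell) :
    C.piZero.src k (C.toPi x) = C.toPi (C.src k x) := C.piSrc_lt x hk

theorem toPi_tgt {k : ℕ} (hk : k < n) (x : C.Cell) :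
    C.piZero.tgt k (C.toPi x) = C.toPi (C.tgt k x) := C.piTgt_lt x hk

theorem toPi_comp {k : ℕ} (hk : k < n) (x y : C.Cell) :
    C.piZero.comp k (C.toPi x) (C.toPi y) = C.toPi (C.comp k x y) := C.piComp_lt x y hk

theorem toPi_eq_of_iso {x y : C.Cell} (h : C.IsoCell x y) (hx : C.src n x = x)
    (hy : C.src n y = y) : C.toPi x = C.toPi y := cls_eq_of_iso h hx hy

theorem iso_of_toPi_eq {x y : C.Cell} (h : C.toPi x = C.toPi y) (hx : C.src n x = x)
    (hy : C.src n y = y) : C.IsoCell x y := by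
  have := cls_eq_iff.1 h
  rwa [hx, hy] at this

theorem eq_of_toPi_eq {x y : C.Cell} {k : ℕ} (hk : k < n) (h : C.toPi x = C.toPi y)
    (hx : C.src k x = x) (hy : C.src k y = y) : x = y := by
  have := cls_src_congr hk h
  rwa [hx, hy] at this

theorem composable_of_toPi {k : ℕ} {x y : C.Cell} (hk : k < n)
    (h : C.piZero.tgt k (C.toPi x) = C.piZero.src k (C.toPi y)) : C.tgt k x = C.src k y :=
  C.composable_of_pi hk h

end NCat

theorem NFunctor.map_isoCell {n : ℕ} {C D : NCat.{u} (n + 1)} (F : NFunctor C D) {x y : C.Cell}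
    (h : C.IsoCell x y) : D.IsoCell (F.map x) (F.map y) := by
  obtain ⟨w, w', h1, h2, h3, h4, h5, h6⟩ := h
  refine ⟨F.map w, F.map w', ?_, ?_, ?_, ?_, ?_, ?_⟩
  · rw [← F.map_src, h1]
  · rw [← F.map_tgt, h2]
  · rw [← F.map_src, h3]
  · rw [← F.map_tgt, h4]
  · rw [← F.map_comp _ _ _ (by rw [h2, h3]), h5]
  · rw [← F.map_comp _ _ _ (by rw [h4, h1]), h6]

/-- The map on cells underlying `π₀` of a functor. -/
def NFunctor.piZeroMap {n : ℕ} {C D : NCat.{u} (n + 1)} (F : NFunctor C D) :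
    C.piZero.Cell → D.piZero.Cell :=
  Quotient.lift (fun x : {x : C.Cell // C.src n x = x} => D.toPi (F.map x.1)) fun x y h =>
    NCat.toPi_eq_of_iso (F.map_isoCell h) (by rw [← F.map_src, x.2]) (by rw [← F.map_src, y.2])

theorem NFunctor.piZeroMap_toPi {n : ℕ} {C D : NCat.{u} (n + 1)} (F : NFunctor C D) (x : C.Cell) :
    F.piZeroMap (C.toPi x) = D.toPi (F.map x) := by
  change D.toPi (F.map (C.src n x)) = _
  rw [F.map_src, NCat.toPi_src_dim]

/-- `π₀` of a functor. -/
def NFunctor.piZero {n : ℕ} {C D : NCat.{u} (n + 1)} (F : NFunctor C D) :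
    NFunctor C.piZero D.piZero where
  map := F.piZeroMap
  map_src k X := by
    obtain ⟨x, -, rfl⟩ := NCat.exists_toPi X
    by_cases hk : k < n
    · rw [NCat.toPi_src hk, F.piZeroMap_toPi, F.piZeroMap_toPi, NCat.toPi_src hk, F.map_src]
    · rw [NCat.src_of_le _ (not_lt.1 hk), NCat.src_of_le _ (not_lt.1 hk)]
  map_tgt k X := by
    obtain ⟨x, -, rfl⟩ := NCat.exists_toPi X
    by_cases hk : k < n
    · rw [NCat.toPi_tgt hk, F.piZeroMap_toPi, F.piZeroMap_toPi, NCat.toPi_tgt hk, F.map_tgt]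
    · rw [NCat.tgt_of_le _ (not_lt.1 hk), NCat.tgt_of_le _ (not_lt.1 hk)]
  map_comp k X Y h := by
    obtain ⟨x, -, rfl⟩ := NCat.exists_toPi X
    obtain ⟨y, -, rfl⟩ := NCat.exists_toPi Y
    by_cases hk : k < n
    · rw [NCat.toPi_comp hk, F.piZeroMap_toPi, F.piZeroMap_toPi, F.piZeroMap_toPi,
        NCat.toPi_comp hk, F.map_comp _ _ _ (NCat.composable_of_toPi hk h)]
    · rw [NCat.comp_of_le _ (not_lt.1 hk), NCat.comp_of_le _ (not_lt.1 hk)]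

theorem NFunctor.piZero_toPi {n : ℕ} {C D : NCat.{u} (n + 1)} (F : NFunctor C D) (x : C.Cell) :
    F.piZero.map (C.toPi x) = D.toPi (F.map x) :=
  F.piZeroMap_toPi x

theorem NFunctor.piZero_comp {n : ℕ} {C D E : NCat.{u} (n + 1)} (F : NFunctor C D)
    (G : NFunctor D E) : (F.comp G).piZero = F.piZero.comp G.piZero := by
  ext X
  obtain ⟨x, -, rfl⟩ := NCat.exists_toPi X
  have h : G.piZero.map (F.piZero.map (C.toPi x)) = E.toPi (G.map (F.map x)) := by
    rw [NFunctor.piZero_toPi, NFunctor.piZero_toPi]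
  exact ((F.comp G).piZero_toPi x).trans h.symm

/-! `π₀` of an `(n+1)`-groupoid is an `n`-groupoid. -/

theorem NFunctor.homTo_bijective {n : ℕ} {C D : NCat.{u} (n + 1)} (F : NFunctor C D)
    (hF : Function.Bijective F.map) {x y : C.Cell} {x' y' : D.Cell} (hx : F.map x = x')
    (hy : F.map y = y') : Function.Bijective (F.homTo hx hy).map := by
  constructor
  · intro a b h
    exact Subtype.ext (hF.1 (congrArg Subtype.val h))
  · rintro ⟨z, h1, h2⟩
    obtain ⟨w, rfl⟩ := hF.2 z
    exact ⟨⟨w, hF.1 (by rw [F.map_src, h1, hx]), hF.1 (by rw [F.map_tgt, h2, hy])⟩, rfl⟩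

theorem NFunctor.map_isArrow {n : ℕ} {C D : NCat.{u} n} (F : NFunctor C D) {f x y : C.Cell}
    (hf : C.IsArrow f x y) : D.IsArrow (F.map f) (F.map x) (F.map y) :=
  ⟨by rw [← F.map_src, hf.src_one], by rw [← F.map_src, hf.src_zero],
    by rw [← F.map_tgt, hf.tgt_zero]⟩

theorem exists_obj {n : ℕ} {C D : NCat.{u} n} (v : NFunctor C D) (hv : Function.Bijective v.map)
    (d : D.Cell) (hd : D.src 0 d = d) : ∃ c, C.src 0 c = c ∧ v.map c = d := by
  obtain ⟨c, rfl⟩ := hv.2 d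
  exact ⟨c, hv.1 (by rw [v.map_src, hd]), rfl⟩

theorem isEquivalence_congr : ∀ (n : ℕ) {C D C' D' : NCat.{u} n} (F : NFunctor C D)
    (F' : NFunctor C' D') (u : NFunctor C C') (v : NFunctor D D'), Function.Bijective u.map →
    Function.Bijective v.map → (∀ c, F'.map (u.map c) = v.map (F.map c)) →
    IsEquivalence n F → IsEquivalence n F'
  | 0, C, D, C', D', F, F', u, v, hu, hv, h, hF => by
    have e : F'.map ∘ u.map = v.map ∘ F.map := funext h
    have : Function.Bijective (F'.map ∘ u.map) := by rw [e]; exact hv.comp hF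
    exact (Function.Bijective.of_comp_iff _ hu).1 this
  | n + 1, C, D, C', D', F, F', u, v, hu, hv, h, hF => by
    refine ⟨fun d' hd' => ?_, fun x' y' hx' hy' => ?_⟩
    · obtain ⟨d, hd, rfl⟩ := exists_obj v hv d' hd'
      obtain ⟨c, hc, f, hf, H⟩ := hF.1 d hd
      have hf' : D'.IsArrow (v.map f) (F'.map (u.map c)) (v.map d) := by
        rw [h]; exact v.map_isArrow hf
      refine ⟨u.map c, by rw [← u.map_src, hc], v.map f, hf', fun z' hz' => ?_⟩
      obtain ⟨z, hz, rfl⟩ := exists_obj v hv z' hz'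
      refine ⟨isEquivalence_congr n (D.precomp hf z) (D'.precomp hf' (v.map z)) (v.homTo rfl rfl)
          (v.homTo (h c).symm rfl) (v.homTo_bijective hv _ _) (v.homTo_bijective hv _ _)
          (fun a => Subtype.ext ?_) (H z hz).1,
        isEquivalence_congr n (D.postcomp hf z) (D'.postcomp hf' (v.map z))
          (v.homTo rfl (h c).symm) (v.homTo rfl rfl) (v.homTo_bijective hv _ _)
          (v.homTo_bijective hv _ _) (fun a => Subtype.ext ?_) (H z hz).2⟩
      · exact (v.map_comp 0 f a.1 (by rw [hf.tgt_zero, a.2.1])).symm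
      · exact (v.map_comp 0 a.1 f (by rw [hf.src_zero, a.2.2])).symm
    · obtain ⟨x, hx, rfl⟩ := exists_obj u hu x' hx'
      obtain ⟨y, hy, rfl⟩ := exists_obj u hu y' hy'
      exact isEquivalence_congr n (F.hom x y) (F'.hom _ _) (u.homTo rfl rfl)
        (v.homTo (h x).symm (h y).symm) (u.homTo_bijective hu _ _) (v.homTo_bijective hv _ _)
        (fun a => Subtype.ext (h a.1)) (hF.2 x y hx hy)

theorem isGroupoid_congr : ∀ (n : ℕ) {C C' : NCat.{u} n} (u : NFunctor C C'),
    Function.Bijective u.map → IsGroupoid n C → IsGroupoid n C'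
  | 0, _, _, _, _, _ => trivial
  | n + 1, C, C', u, hu, hC => by
    refine ⟨fun f' x' y' hf' => ?_, fun x' y' hx' hy' => ?_⟩
    · obtain ⟨f, rfl⟩ := hu.2 f'
      have hf : C.IsArrow f (C.src 0 f) (C.tgt 0 f) :=
        ⟨hu.1 (by rw [u.map_src, hf'.src_one]), rfl, rfl⟩
      have ex : u.map (C.src 0 f) = x' := by rw [u.map_src, hf'.src_zero]
      have ey : u.map (C.tgt 0 f) = y' := by rw [u.map_tgt, hf'.tgt_zero]
      intro z' hz'
      obtain ⟨z, hz, rfl⟩ := exists_obj u hu z' hz'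
      have H := hC.1 f _ _ hf z hz
      refine ⟨isEquivalence_congr n (C.precomp hf z) (C'.precomp hf' (u.map z)) (u.homTo ey rfl)
          (u.homTo ex rfl) (u.homTo_bijective hu _ _) (u.homTo_bijective hu _ _)
          (fun a => Subtype.ext ?_) H.1,
        isEquivalence_congr n (C.postcomp hf z) (C'.postcomp hf' (u.map z)) (u.homTo rfl ex)
          (u.homTo rfl ey) (u.homTo_bijective hu _ _) (u.homTo_bijective hu _ _)
          (fun a => Subtype.ext ?_) H.2⟩
      · exact (u.map_comp 0 f a.1 (by rw [a.2.1])).symm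
      · exact (u.map_comp 0 a.1 f (by rw [a.2.2])).symm
    · obtain ⟨x, hx, rfl⟩ := exists_obj u hu x' hx'
      obtain ⟨y, hy, rfl⟩ := exists_obj u hu y' hy'
      exact isGroupoid_congr n (u.homTo rfl rfl) (u.homTo_bijective hu _ _) (hC.2 x y hx hy)

/-- The comparison from `π₀` of a hom-category of `C` to the hom-category of `π₀ C`. -/
def piHom {n : ℕ} (C : NCat.{u} (n + 2)) {x y : C.Cell} {X Y : C.piZero.Cell}
    (hX : X = C.toPi x) (hY : Y = C.toPi y) : NFunctor (C.Hom x y).piZero (C.piZero.Hom X Y) where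
  map := Quotient.lift
    (fun c : {c : (C.Hom x y).Cell // (C.Hom x y).src n c = c} =>
      (⟨C.toPi c.1.1, by rw [NCat.toPi_src (Nat.succ_pos n), c.1.2.1, hX],
        by rw [NCat.toPi_tgt (Nat.succ_pos n), c.1.2.2, hY]⟩ : (C.piZero.Hom X Y).Cell))
    (by
      rintro c d ⟨w, w', h1, h2, h3, h4, h5, h6⟩
      refine Subtype.ext (NCat.toPi_eq_of_iso ⟨w.1, w'.1, ?_⟩ (congrArg Subtype.val c.2)
        (congrArg Subtype.val d.2))
      exact ⟨congrArg Subtype.val h1, congrArg Subtype.val h2, congrArg Subtype.val h3,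
        congrArg Subtype.val h4, congrArg Subtype.val h5, congrArg Subtype.val h6⟩)
  map_src k A := by
    by_cases hk : k < n
    · obtain ⟨a, -, rfl⟩ := NCat.exists_toPi A
      rw [NCat.toPi_src hk]
      refine Subtype.ext ?_
      change C.toPi (C.src (n + 1) (C.src (k + 1) a.1)) =
        C.piZero.src (k + 1) (C.toPi (C.src (n + 1) a.1))
      rw [NCat.toPi_src_dim, NCat.toPi_src_dim, NCat.toPi_src (Nat.succ_lt_succ hk)]
    · rw [NCat.src_of_le _ (not_lt.1 hk), NCat.src_of_le _ (not_lt.1 hk)]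
  map_tgt k A := by
    by_cases hk : k < n
    · obtain ⟨a, -, rfl⟩ := NCat.exists_toPi A
      rw [NCat.toPi_tgt hk]
      refine Subtype.ext ?_
      change C.toPi (C.src (n + 1) (C.tgt (k + 1) a.1)) =
        C.piZero.tgt (k + 1) (C.toPi (C.src (n + 1) a.1))
      rw [NCat.toPi_src_dim, NCat.toPi_src_dim, NCat.toPi_tgt (Nat.succ_lt_succ hk)]
    · rw [NCat.tgt_of_le _ (not_lt.1 hk), NCat.tgt_of_le _ (not_lt.1 hk)]
  map_comp k A B h := by
    by_cases hk : k < n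
    · obtain ⟨a, -, rfl⟩ := NCat.exists_toPi A
      obtain ⟨b, -, rfl⟩ := NCat.exists_toPi B
      rw [NCat.toPi_comp hk]
      refine Subtype.ext ?_
      change C.toPi (C.src (n + 1) (C.comp (k + 1) a.1 b.1)) =
        C.piZero.comp (k + 1) (C.toPi (C.src (n + 1) a.1)) (C.toPi (C.src (n + 1) b.1))
      rw [NCat.toPi_src_dim, NCat.toPi_src_dim, NCat.toPi_src_dim,
        NCat.toPi_comp (Nat.succ_lt_succ hk)]
    · rw [NCat.comp_of_le _ (not_lt.1 hk), NCat.comp_of_le _ (not_lt.1 hk)]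

theorem piHom_toPi {n : ℕ} (C : NCat.{u} (n + 2)) {x y : C.Cell} {X Y : C.piZero.Cell}
    (hX : X = C.toPi x) (hY : Y = C.toPi y) (a : (C.Hom x y).Cell) :
    ((piHom C hX hY).map ((C.Hom x y).toPi a)).1 = C.toPi a.1 := by
  change C.toPi (C.src (n + 1) a.1) = _
  rw [NCat.toPi_src_dim]

theorem piHom_bijective {n : ℕ} (C : NCat.{u} (n + 2)) {x y : C.Cell} {X Y : C.piZero.Cell}
    (hX : X = C.toPi x) (hY : Y = C.toPi y) (hx : C.src 0 x = x) (hy : C.src 0 y = y) :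
    Function.Bijective (piHom C hX hY).map := by
  constructor
  · intro A B h
    obtain ⟨a, ha, rfl⟩ := NCat.exists_toPi A
    obtain ⟨b, hb, rfl⟩ := NCat.exists_toPi B
    have h' := congrArg Subtype.val h
    rw [piHom_toPi, piHom_toPi] at h'
    obtain ⟨w, w', h1, h2, h3, h4, h5, h6⟩ :=
      NCat.iso_of_toPi_eq h' (congrArg Subtype.val ha) (congrArg Subtype.val hb)
    refine NCat.toPi_eq_of_iso ⟨⟨w, ?_, ?_⟩, ⟨w', ?_, ?_⟩, Subtype.ext h1, Subtype.ext h2,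
      Subtype.ext h3, Subtype.ext h4, Subtype.ext h5, Subtype.ext h6⟩ ha hb
    · rw [← C.src_src w (Nat.succ_pos n), h1, a.2.1]
    · rw [← C.tgt_src w (Nat.succ_pos n), h1, a.2.2]
    · rw [← C.src_src w' (Nat.succ_pos n), h3, b.2.1]
    · rw [← C.tgt_src w' (Nat.succ_pos n), h3, b.2.2]
  · rintro ⟨Z, h1, h2⟩
    obtain ⟨z, hz, rfl⟩ := NCat.exists_toPi Z
    rw [NCat.toPi_src (Nat.succ_pos n), hX] at h1
    rw [NCat.toPi_tgt (Nat.succ_pos n), hY] at h2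
    have e1 := NCat.eq_of_toPi_eq (Nat.succ_pos n) h1 (C.src_src_of_le _ le_rfl) hx
    have e2 := NCat.eq_of_toPi_eq (Nat.succ_pos n) h2 (C.src_tgt_of_le _ le_rfl) hy
    exact ⟨(C.Hom x y).toPi ⟨z, e1, e2⟩, Subtype.ext (piHom_toPi C hX hY _)⟩

theorem exists_obj_toPi {n : ℕ} {C : NCat.{u} (n + 2)} {X : C.piZero.Cell}
    (hX : C.piZero.src 0 X = X) : ∃ x, C.src 0 x = x ∧ X = C.toPi x := by
  obtain ⟨e, -, rfl⟩ := NCat.exists_toPi X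
  rw [NCat.toPi_src (Nat.succ_pos n)] at hX
  exact ⟨C.src 0 e, C.src_src_of_le _ le_rfl, hX.symm⟩

theorem toPi_isArrow {n : ℕ} {C : NCat.{u} (n + 2)} {f x y : C.Cell} (hf : C.IsArrow f x y) :
    C.piZero.IsArrow (C.toPi f) (C.toPi x) (C.toPi y) := by
  refine ⟨?_, ?_, ?_⟩
  · by_cases h : 1 < n + 1
    · rw [NCat.toPi_src h, hf.src_one]
    · rw [NCat.src_of_le _ (not_lt.1 h)]
  · rw [NCat.toPi_src (Nat.succ_pos n), hf.src_zero]
  · rw [NCat.toPi_tgt (Nat.succ_pos n), hf.tgt_zero]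

theorem exists_inverse {C : NCat.{u} 1} {f x y : C.Cell} (hf : C.IsArrow f x y)
    (h : ∀ z, C.src 0 z = z → IsEquivalence 0 (C.precomp hf z) ∧ IsEquivalence 0 (C.postcomp hf z)) :
    C.IsoCell x y := by
  have hx : C.src 0 x = x := by rw [← hf.src_zero, C.src_src_of_le _ le_rfl]
  have hy : C.src 0 y = y := by rw [← hf.tgt_zero, C.src_tgt_of_le _ le_rfl]
  obtain ⟨g, hg⟩ := (h x hx).1.2 ⟨x, hx, C.tgt_eq_of_le hx le_rfl⟩
  obtain ⟨g', hg'⟩ := (h y hy).2.2 ⟨y, hy, C.tgt_eq_of_le hy le_rfl⟩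
  have e : C.comp 0 f g.1 = x := congrArg Subtype.val hg
  have e' : C.comp 0 g'.1 f = y := congrArg Subtype.val hg'
  have : g'.1 = g.1 := by
    calc g'.1 = C.comp 0 g'.1 x := by
          have := C.comp_id 0 g'.1
          rw [g'.2.2] at this
          exact this.symm
      _ = C.comp 0 (C.comp 0 g'.1 f) g.1 := by
          rw [C.assoc (by rw [g'.2.2, hf.src_zero]) (by rw [hf.tgt_zero, g.2.1]), e]
      _ = g.1 := by
          have := C.id_comp 0 g.1
          rw [g.2.1] at this
          rw [e', this]
  rw [this] at e'
  exact ⟨f, g.1, hf.src_zero, hf.tgt_zero, g.2.1, g.2.2, e, e'⟩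

theorem isEquivalence_piZero : ∀ (n : ℕ) {C D : NCat.{u} (n + 1)} (F : NFunctor C D),
    IsEquivalence (n + 1) F → IsEquivalence n F.piZero
  | 0, C, D, F, hF => by
    constructor
    · intro A B h
      obtain ⟨a, ha, rfl⟩ := NCat.exists_toPi A
      obtain ⟨b, hb, rfl⟩ := NCat.exists_toPi B
      rw [F.piZero_toPi, F.piZero_toPi] at h
      obtain ⟨w, w', h1, h2, h3, h4, h5, h6⟩ :=
        NCat.iso_of_toPi_eq h (by rw [← F.map_src, ha]) (by rw [← F.map_src, hb])
      obtain ⟨v, hv⟩ := (hF.2 a b ha hb).2 ⟨w, h1, h2⟩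
      obtain ⟨v', hv'⟩ := (hF.2 b a hb ha).2 ⟨w', h3, h4⟩
      have ev : F.map v.1 = w := congrArg Subtype.val hv
      have ev' : F.map v'.1 = w' := congrArg Subtype.val hv'
      have c1 : C.tgt 0 v.1 = C.src 0 v'.1 := by rw [v.2.2, v'.2.1]
      have c2 : C.tgt 0 v'.1 = C.src 0 v.1 := by rw [v'.2.2, v.2.1]
      refine NCat.toPi_eq_of_iso ⟨v.1, v'.1, v.2.1, v.2.2, v'.2.1, v'.2.2, ?_, ?_⟩ ha hb
      · have := @(hF.2 a a ha ha).1 ⟨C.comp 0 v.1 v'.1, by rw [C.src_comp_self c1, v.2.1],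
          by rw [C.tgt_comp_self c1, v'.2.2]⟩ ⟨a, ha, C.tgt_eq_of_le ha le_rfl⟩
          (Subtype.ext (by
            change F.map (C.comp 0 v.1 v'.1) = F.map a
            rw [F.map_comp _ _ _ c1, ev, ev', h5]))
        exact congrArg Subtype.val this
      · have := @(hF.2 b b hb hb).1 ⟨C.comp 0 v'.1 v.1, by rw [C.src_comp_self c2, v'.2.1],
          by rw [C.tgt_comp_self c2, v.2.2]⟩ ⟨b, hb, C.tgt_eq_of_le hb le_rfl⟩
          (Subtype.ext (by
            change F.map (C.comp 0 v'.1 v.1) = F.map b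
            rw [F.map_comp _ _ _ c2, ev, ev', h6]))
        exact congrArg Subtype.val this
    · intro B
      obtain ⟨b, hb, rfl⟩ := NCat.exists_toPi B
      obtain ⟨c, hc, f, hf, H⟩ := hF.1 b hb
      exact ⟨C.toPi c, by
        rw [F.piZero_toPi]
        exact NCat.toPi_eq_of_iso (exists_inverse hf H) (by rw [← F.map_src, hc]) hb⟩
  | n + 1, C, D, F, hF => by
    refine ⟨fun Y hY => ?_, fun X X' hX hX' => ?_⟩
    · obtain ⟨y, hy, rfl⟩ := exists_obj_toPi hY
      obtain ⟨c, hc, f, hf, H⟩ := hF.1 y hy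
      have hc' : D.src 0 (F.map c) = F.map c := by rw [← F.map_src, hc]
      have hf' : D.piZero.IsArrow (D.toPi f) (F.piZero.map (C.toPi c)) (D.toPi y) := by
        rw [F.piZero_toPi]; exact toPi_isArrow hf
      refine ⟨C.toPi c, by rw [NCat.toPi_src (Nat.succ_pos n), hc], D.toPi f, hf', fun Z hZ => ?_⟩
      obtain ⟨z, hz, rfl⟩ := exists_obj_toPi hZ
      refine ⟨isEquivalence_congr n (D.precomp hf z).piZero (D.piZero.precomp hf' (D.toPi z))
          (piHom D rfl rfl) (piHom D (F.piZero_toPi c) rfl) (piHom_bijective D _ _ hy hz)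
          (piHom_bijective D _ _ hc' hz) (fun A => Subtype.ext ?_)
          (isEquivalence_piZero n _ (H z hz).1),
        isEquivalence_congr n (D.postcomp hf z).piZero (D.piZero.postcomp hf' (D.toPi z))
          (piHom D rfl (F.piZero_toPi c)) (piHom D rfl rfl) (piHom_bijective D _ _ hz hc')
          (piHom_bijective D _ _ hz hy) (fun A => Subtype.ext ?_)
          (isEquivalence_piZero n _ (H z hz).2)⟩
      · obtain ⟨a, -, rfl⟩ := NCat.exists_toPi A
        rw [NFunctor.piZero_toPi (D.precomp hf z), piHom_toPi]
        exact (congrArg (D.piZero.comp 0 (D.toPi f)) (piHom_toPi D rfl rfl a)).trans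
          (NCat.toPi_comp (Nat.succ_pos n) f a.1)
      · obtain ⟨a, -, rfl⟩ := NCat.exists_toPi A
        rw [NFunctor.piZero_toPi (D.postcomp hf z), piHom_toPi]
        exact (congrArg (fun t => D.piZero.comp 0 t (D.toPi f))
          (piHom_toPi D rfl (F.piZero_toPi c) a)).trans (NCat.toPi_comp (Nat.succ_pos n) a.1 f)
    · obtain ⟨x, hx, rfl⟩ := exists_obj_toPi hX
      obtain ⟨x', hx', rfl⟩ := exists_obj_toPi hX'
      refine isEquivalence_congr n (F.hom x x').piZero (F.piZero.hom _ _) (piHom C rfl rfl)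
        (piHom D (F.piZero_toPi x) (F.piZero_toPi x')) (piHom_bijective C _ _ hx hx')
        (piHom_bijective D _ _ (by rw [← F.map_src, hx]) (by rw [← F.map_src, hx']))
        (fun A => Subtype.ext ?_) (isEquivalence_piZero n _ (hF.2 x x' hx hx'))
      obtain ⟨a, -, rfl⟩ := NCat.exists_toPi A
      rw [NFunctor.piZero_toPi (F.hom x x'), piHom_toPi]
      exact (congrArg F.piZero.map (piHom_toPi C rfl rfl a)).trans (F.piZero_toPi a.1)

theorem isGroupoid_piZero : ∀ (n : ℕ) {C : NCat.{u} (n + 1)}, IsGroupoid (n + 1) C →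
    IsGroupoid n C.piZero
  | 0, _, _ => trivial
  | n + 1, C, hC => by
    refine ⟨fun f' X Y hf' => ?_, fun X Y hX hY => ?_⟩
    · obtain ⟨e, he, rfl⟩ := NCat.exists_toPi f'
      have hX : X = C.toPi (C.src 0 e) := by
        rw [← hf'.src_zero, NCat.toPi_src (Nat.succ_pos n)]
      have hY : Y = C.toPi (C.tgt 0 e) := by
        rw [← hf'.tgt_zero, NCat.toPi_tgt (Nat.succ_pos n)]
      have hf : C.IsArrow (C.src 1 e) (C.src 0 e) (C.tgt 0 e) :=
        ⟨C.src_src_of_le _ le_rfl, C.src_src _ Nat.one_pos, C.tgt_src _ Nat.one_pos⟩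
      have ee : C.toPi e = C.toPi (C.src 1 e) := by
        by_cases h : 1 < n + 1
        · rw [← NCat.toPi_src h, hf'.src_one]
        · obtain rfl : n = 0 := by omega
          rw [NCat.toPi_src_dim]
      intro Z hZ
      obtain ⟨z, hz, rfl⟩ := exists_obj_toPi hZ
      have H := hC.1 _ _ _ hf z hz
      have o1 := C.src_src_of_le (j := 0) e le_rfl
      have o2 := C.src_tgt_of_le (j := 0) e le_rfl
      refine ⟨isEquivalence_congr n (C.precomp hf z).piZero (C.piZero.precomp hf' (C.toPi z))
          (piHom C hY rfl) (piHom C hX rfl) (piHom_bijective C _ _ o2 hz)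
          (piHom_bijective C _ _ o1 hz) (fun A => Subtype.ext ?_)
          (isEquivalence_piZero n _ H.1),
        isEquivalence_congr n (C.postcomp hf z).piZero (C.piZero.postcomp hf' (C.toPi z))
          (piHom C rfl hX) (piHom C rfl hY) (piHom_bijective C _ _ hz o1)
          (piHom_bijective C _ _ hz o2) (fun A => Subtype.ext ?_)
          (isEquivalence_piZero n _ H.2)⟩
      · obtain ⟨a, -, rfl⟩ := NCat.exists_toPi A
        rw [NFunctor.piZero_toPi (C.precomp hf z), piHom_toPi]
        exact (congrArg₂ (C.piZero.comp 0) ee (piHom_toPi C hY rfl a)).trans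
          (NCat.toPi_comp (Nat.succ_pos n) _ a.1)
      · obtain ⟨a, -, rfl⟩ := NCat.exists_toPi A
        rw [NFunctor.piZero_toPi (C.postcomp hf z), piHom_toPi]
        exact (congrArg₂ (C.piZero.comp 0) (piHom_toPi C rfl hX a) ee).trans
          (NCat.toPi_comp (Nat.succ_pos n) a.1 _)
    · obtain ⟨x, hx, rfl⟩ := exists_obj_toPi hX
      obtain ⟨y, hy, rfl⟩ := exists_obj_toPi hY
      exact isGroupoid_congr n (piHom C rfl rfl) (piHom_bijective C _ _ hx hy)
        (isGroupoid_piZero n (hC.2 x y hx hy))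

/-! `π₀` of a lax transformation. -/

theorem isoCell_of_isGroupoid : ∀ (n : ℕ) {C : NCat.{u} (n + 1)}, IsGroupoid (n + 1) C →
    ∀ w : C.Cell, C.IsoCell (C.src n w) (C.tgt n w)
  | 0, C, hC, w => exists_inverse ⟨C.src_dim w, rfl, rfl⟩ (hC.1 w _ _ ⟨C.src_dim w, rfl, rfl⟩)
  | n + 1, C, hC, w => by
    obtain ⟨v, v', h1, h2, h3, h4, h5, h6⟩ := isoCell_of_isGroupoid n
      (hC.2 (C.src 0 w) (C.tgt 0 w) (C.src_src_of_le _ le_rfl) (C.src_tgt_of_le _ le_rfl))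
      ⟨w, rfl, rfl⟩
    exact ⟨v.1, v'.1, congrArg Subtype.val h1, congrArg Subtype.val h2, congrArg Subtype.val h3,
      congrArg Subtype.val h4, congrArg Subtype.val h5, congrArg Subtype.val h6⟩

theorem toPi_src_eq_toPi_tgt {n : ℕ} {C : NCat.{u} (n + 1)} (hC : IsGroupoid (n + 1) C)
    (w : C.Cell) : C.toPi w = C.toPi (C.tgt n w) := by
  rw [← NCat.toPi_src_dim]
  exact NCat.toPi_eq_of_iso (isoCell_of_isGroupoid n hC w) (C.src_src_of_le _ le_rfl)
    (C.src_tgt_of_le _ le_rfl)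

theorem IsLaxTrans.exists_boundary {n : ℕ} {C D : NCat.{u} (n + 1)} {α : C.Cell → D.Cell} :
    ∀ (m k : ℕ) (F G : C.Cell → D.Cell), k + m = n → IsLaxTrans C D α (m + 1) k F G →
      ∃ U V : C.Cell → D.Cell, ∀ c, D.src n (α c) = U (C.src n c) ∧ D.tgt n (α c) = V (C.tgt n c)
  | 0, _, F, G, hk, h => by
    obtain rfl : _ = n := hk
    exact ⟨F, G, h.1⟩
  | m + 1, k, _, _, hk, h => exists_boundary m (k + 1) _ _ (by omega) h.2.1

/-- The map on cells of `π₀` of a lax transformation between groupoids. -/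
def LaxTrans.piZeroApp {n : ℕ} {C D : NCat.{u} (n + 1)} {F G : NFunctor C D} (α : LaxTrans F G)
    (hD : IsGroupoid (n + 1) D) : C.piZero.Cell → D.piZero.Cell :=
  Quotient.lift (fun x : {x : C.Cell // C.src n x = x} => D.toPi (α.app x.1)) (by
    rintro ⟨x, hx⟩ ⟨y, hy⟩ ⟨w, w', h1, h2, -⟩
    obtain ⟨U, V, h⟩ := IsLaxTrans.exists_boundary n 0 _ _ (Nat.zero_add n) α.isLaxTrans
    change C.src n w = x at h1
    change C.tgt n w = y at h2
    have e1 : D.toPi (α.app x) = D.toPi (α.app w) := by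
      rw [← NCat.toPi_src_dim, (h x).1, ← NCat.toPi_src_dim (α.app w), (h w).1, h1, hx]
    have e2 : D.toPi (α.app y) = D.toPi (α.app w) := by
      rw [toPi_src_eq_toPi_tgt hD, (h y).2, toPi_src_eq_toPi_tgt hD (α.app w), (h w).2, h2,
        C.tgt_eq_of_le hy le_rfl]
    exact e1.trans e2.symm)

theorem LaxTrans.piZeroApp_toPi {n : ℕ} {C D : NCat.{u} (n + 1)} {F G : NFunctor C D}
    (α : LaxTrans F G) (hD : IsGroupoid (n + 1) D) {x : C.Cell} (hx : C.src n x = x) :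
    α.piZeroApp hD (C.toPi x) = D.toPi (α.app x) := by
  change D.toPi (α.app (C.src n x)) = _
  rw [hx]

theorem vcomp_piZero {n : ℕ} {C D : NCat.{u} (n + 1)} : ∀ (m k : ℕ), k + m = n →
    ∀ (β γ : C.Cell × C.Cell → D.Cell) (β' γ' : C.piZero.Cell × C.piZero.Cell → D.piZero.Cell),
    (∀ x y, C.src n x = x → C.src n y = y → β' (C.toPi x, C.toPi y) = D.toPi (β (x, y))) →
    (∀ x y, C.src n x = x → C.src n y = y → γ' (C.toPi x, C.toPi y) = D.toPi (γ (x, y))) →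
    ∀ x y, C.src n x = x → C.src n y = y →
      vcomp (fun j p => (C.piZero.src j p.1, C.piZero.src j p.2))
        (fun j p => (C.piZero.tgt j p.1, C.piZero.tgt j p.2)) D.piZero m k β' γ'
          (C.toPi x, C.toPi y) =
      D.toPi (vcomp (fun j p => (C.src j p.1, C.src j p.2)) (fun j p => (C.tgt j p.1, C.tgt j p.2)) D
        (m + 1) k β γ (x, y))
  | 0, k, hk, β, γ, β', γ', hβ, hγ, x, y, hx, hy => by
    obtain rfl : k = n := hk
    change β' _ = D.toPi (D.comp k (β (C.src k x, C.src k y)) (γ (x, y)))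
    rw [hβ x y hx hy, hx, hy, ← NCat.toPi_src_dim (D.comp k _ _), D.src_self_comp,
      NCat.toPi_src_dim]
  | m + 1, k, hk, β, γ, β', γ', hβ, hγ, x, y, hx, hy => by
    have hkn : k < n := by omega
    refine vcomp_piZero (D := D) m (k + 1) (by omega)
      (fun p => D.comp k (β (C.src k p.1, C.src k p.2)) (γ p))
      (fun p => D.comp k (β p) (γ (C.tgt k p.1, C.tgt k p.2))) _ _
      (fun a b ha hb => ?_) (fun a b ha hb => ?_) x y hx hy
    · dsimp only
      rw [NCat.toPi_src hkn, NCat.toPi_src hkn,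
        hβ _ _ (C.src_eq_of_le (C.src_src_of_le a le_rfl) hkn.le)
          (C.src_eq_of_le (C.src_src_of_le b le_rfl) hkn.le), hγ a b ha hb, NCat.toPi_comp hkn]
    · dsimp only
      rw [NCat.toPi_tgt hkn, NCat.toPi_tgt hkn,
        hγ _ _ (C.src_eq_of_le (C.src_tgt_of_le a le_rfl) hkn.le)
          (C.src_eq_of_le (C.src_tgt_of_le b le_rfl) hkn.le), hβ a b ha hb, NCat.toPi_comp hkn]

theorem isLaxTrans_piZero {n : ℕ} {C D : NCat.{u} (n + 1)} (hD : IsGroupoid (n + 1) D)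
    {α : C.Cell → D.Cell} {α' : C.piZero.Cell → D.piZero.Cell}
    (hα : ∀ x, C.src n x = x → α' (C.toPi x) = D.toPi (α x)) :
    ∀ (m k : ℕ), k + m = n → ∀ (F G : C.Cell → D.Cell) (F' G' : C.piZero.Cell → D.piZero.Cell),
    (∀ x, C.src n x = x → F' (C.toPi x) = D.toPi (F x)) →
    (∀ x, C.src n x = x → G' (C.toPi x) = D.toPi (G x)) →
    IsLaxTrans C D α (m + 1) k F G → IsLaxTrans C.piZero D.piZero α' m k F' G'
  | 0, k, hk, F, G, F', G', hF, hG, h => by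
    obtain rfl : k = n := hk
    intro X
    obtain ⟨x, hx, rfl⟩ := NCat.exists_toPi X
    constructor
    · rw [hα x hx, hF x hx, ← NCat.toPi_src_dim, (h.1 x).1, hx]
    · rw [hα x hx, hG x hx, toPi_src_eq_toPi_tgt hD, (h.1 x).2, C.tgt_eq_of_le hx le_rfl]
  | m + 1, k, hk, F, G, F', G', hF, hG, h => by
    have hkn : k < n := by omega
    have hs : ∀ x, C.src n (C.src k x) = C.src k x := fun x =>
      C.src_eq_of_le (C.src_src_of_le x le_rfl) hkn.le
    have ht : ∀ x, C.src n (C.tgt k x) = C.tgt k x := fun x =>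
      C.src_eq_of_le (C.src_tgt_of_le x le_rfl) hkn.le
    refine ⟨fun X => ?_, ?_, fun X Y hXY => ?_⟩
    · obtain ⟨x, hx, rfl⟩ := NCat.exists_toPi X
      rw [hα x hx, NCat.toPi_src hkn, NCat.toPi_src hkn, NCat.toPi_tgt hkn, NCat.toPi_tgt hkn,
        hF _ (hs x), hG _ (ht x), (h.1 x).1, (h.1 x).2]
      exact ⟨rfl, rfl⟩
    · refine isLaxTrans_piZero hD hα m (k + 1) (by omega) _ _ _ _ (fun x hx => ?_)
        (fun x hx => ?_) h.2.1
      · rw [NCat.toPi_src hkn, hα _ (hs x), hG x hx, NCat.toPi_comp hkn]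
      · rw [NCat.toPi_tgt hkn, hα _ (ht x), hF x hx, NCat.toPi_comp hkn]
    · obtain ⟨x, hx, rfl⟩ := NCat.exists_toPi X
      obtain ⟨y, hy, rfl⟩ := NCat.exists_toPi Y
      rw [NCat.toPi_comp hkn, hα _ (by rw [C.src_comp' hkn, hx, hy]),
        h.2.2 x y (NCat.composable_of_toPi hkn hXY)]
      refine (vcomp_piZero m (k + 1) (by omega) _ _ _ _ (fun a b ha hb => ?_)
        (fun a b ha hb => ?_) x y hx hy).symm
      · dsimp only
        rw [hα a ha, hG b hb, NCat.toPi_comp hkn]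
      · dsimp only
        rw [hF a ha, hα b hb, NCat.toPi_comp hkn]

/-- `π₀` of a lax transformation between functors to a groupoid. -/
def LaxTrans.piZero {n : ℕ} {C D : NCat.{u} (n + 1)} {F G : NFunctor C D} (α : LaxTrans F G)
    (hD : IsGroupoid (n + 1) D) : LaxTrans F.piZero G.piZero where
  app := α.piZeroApp hD
  isLaxTrans := isLaxTrans_piZero hD (fun _ hx => α.piZeroApp_toPi hD hx) n 0 (Nat.zero_add n)
    F.map G.map _ _ (fun x _ => F.piZero_toPi x) (fun x _ => G.piZero_toPi x) α.isLaxTrans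

/-! ### Pointed groupoids and exactness -/

/-- A pointed `n`-groupoid. -/
structure PtGpd (n : ℕ) extends NCat.{u} n where
  isGroupoid : IsGroupoid n toNCat
  pt : Cell
  src_pt : src 0 pt = pt

/-- A pointed `n`-functor. -/
structure PtFunctor {n : ℕ} (A B : PtGpd.{u} n) extends NFunctor A.toNCat B.toNCat where
  map_pt : map A.pt = B.pt

/-- The zero functor, through the terminal `n`-category. -/
def zero {n : ℕ} (A : NCat.{u} n) (C : PtGpd.{u} n) : NFunctor A C.toNCat :=
  (NFunctor.toTerminal A).comp (NFunctor.point C.toNCat C.pt C.src_pt)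

/-- A triple `(F, ε, G)` in pointed `n`-groupoids: pointed functors `F : A ⟶ B` and `G : B ⟶ C`,
with a pointed lax transformation `ε` from the zero functor to their composite. -/
structure Triple {n : ℕ} (A B C : PtGpd.{u} n) where
  F : PtFunctor A B
  G : PtFunctor B C
  ε : LaxTrans (zero A.toNCat C) (F.toNFunctor.comp G.toNFunctor)
  ε_pt : ε.app A.pt = C.pt

/-- `(K, k, κ)` is an `h`-kernel of `G : B ⟶ C`: an `h`-pullback, in `n`-categories, of the base
point of `C` and `G`. -/
def IsHKernel {n : ℕ} {B C : PtGpd.{u} n} (G : PtFunctor B C) (K : NCat.{u} n)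
    (k : NFunctor K B.toNCat) (κ : LaxTrans (zero K C) (k.comp G.toNFunctor)) : Prop :=
  IsHPullback (NFunctor.point C.toNCat C.pt C.src_pt) G.toNFunctor (NFunctor.toTerminal K) k κ

/-- A triple is exact (in `B`) if its comparison `L` with the `h`-kernel of `G` is `h`-surjective. -/
def Triple.IsExact {n : ℕ} {A B C : PtGpd.{u} n} (T : Triple A B C) : Prop :=
  ∃ (K : NCat.{u} n) (k : NFunctor K B.toNCat) (κ : LaxTrans (zero K C) (k.comp T.G.toNFunctor)),
    IsHKernel T.G K k κ ∧ ∃ L : NFunctor A.toNCat K,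
      L.comp k = T.F.toNFunctor ∧ (∀ a, κ.app (L.map a) = T.ε.app a) ∧ IsHSurjective n L

/-- `π₀` of a pointed `(n+1)`-groupoid. -/
def PtGpd.piZero {n : ℕ} (A : PtGpd.{u} (n + 1)) : PtGpd.{u} n where
  toNCat := A.toNCat.piZero
  isGroupoid := isGroupoid_piZero n A.isGroupoid
  pt := A.toNCat.toPi A.pt
  src_pt := by
    by_cases h : 0 < n
    · rw [NCat.toPi_src h, A.src_pt]
    · exact NCat.src_of_le _ (not_lt.1 h) _

/-- `π₀` of a pointed functor. -/
def PtFunctor.piZero {n : ℕ} {A B : PtGpd.{u} (n + 1)} (F : PtFunctor A B) :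
    PtFunctor A.piZero B.piZero where
  toNFunctor := F.toNFunctor.piZero
  map_pt := (F.toNFunctor.piZero_toPi A.pt).trans (congrArg B.toNCat.toPi F.map_pt)

theorem zero_piZero {n : ℕ} (A C : PtGpd.{u} (n + 1)) :
    (zero A.toNCat C).piZero = zero A.piZero.toNCat C.piZero := by
  refine NFunctor.ext (funext fun X => ?_)
  obtain ⟨x, -, rfl⟩ := NCat.exists_toPi (C := A.toNCat) X
  exact NFunctor.piZero_toPi _ x

/-- `π₀` of a triple. -/
def Triple.piZero {n : ℕ} {A B C : PtGpd.{u} (n + 1)} (T : Triple A B C) :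
    Triple A.piZero B.piZero C.piZero where
  F := T.F.piZero
  G := T.G.piZero
  ε := (T.ε.piZero C.isGroupoid).cast (zero_piZero A C)
    (NFunctor.piZero_comp T.F.toNFunctor T.G.toNFunctor)
  ε_pt := (T.ε.piZeroApp_toPi C.isGroupoid (A.toNCat.src_eq_of_le A.src_pt (Nat.zero_le n))).trans
    (congrArg C.toNCat.toPi T.ε_pt)

end HigherGpd

/-!
# `π₀` preserves exact triples of pointed groupoids

Let `K` be the `h`-kernel of `G` and `L : A ⟶ K` the `h`-surjective comparison. The comparison of
the `π₀` triple goes from `π₀ A` to the `h`-kernel `H` of `π₀ G`, and it factors as `π₀ L` followed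
by the canonical `J : π₀ K ⟶ H`. In general `J` is not an equivalence, but it is surjective on
cells, and more: a cell of `H` whose boundary comes from cells of `K` lifts to a cell of `K` with
that boundary (`IsHKernel.exists_lift`). So a cell of `H` between images of cells of `A` is lifted
to `K`, connected there to a cell in the image of `A` by `h`-surjectivity, and the connecting cell is
projected to `H` (`IsHSurjective.comparison_piZero`).

The definition of a lax transformation is recursive over iterated homs. `isLaxTrans_iff` unrolls it:
the boundary of the component at a `k`-cell is given by a tower of whiskerings with the components
of lower dimension, and there is one composition law in each dimension. Testing the universal
property of `K` on spheres then describes the `k`-cells of `K` as `k`-cells of `B` together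
with compatible components (`IsHKernel.cell_ext`, `IsHKernel.exists_cell`).

A definition of exactness through a kernel requires the kernel `H` to exist. It is the quotient of
`π₀ K` that identifies cells with the same data in `π₀ B` and `π₀ C` (`exists_isHKernel`); this uses
that below dimension `n` nothing is identified by `π₀`, and that cells lift.

Finally `h`-surjectivity asks for weakly invertible `1`-cells, not only for connecting cells, so `H`
must be a groupoid. An `n`-category is a groupoid if and only if all cells have inverses up to cells
of the next dimension (`NCat.HasInverses.isGroupoid`, `hasInverses_of_isGroupoid`); for the first,
composition with a `1`-cell is an equivalence by the two-out-of-six property (`TwoOfSix`). In this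
form the groupoid property passes to `h`-kernels (`IsHKernel.hasInverses`), because the component
needed for an inverse can be solved for in `C`.
-/

namespace HigherGpd

/-! ### Lax transformations, one dimension at a time -/

/-- The pair `(F_k, G_k)` of iterated whiskerings of a pair of cells `(p, d)` with the lower
components `s j`, `t j` (at the `j`-source and the `j`-target) of a lax transformation. A component
of the transformation in dimension `k` is a cell from `F_k` to `G_k`. -/
def tower {n : ℕ} (D : NCat.{u} n) (s t : ℕ → D.Cell) (p d : D.Cell) : ℕ → D.Cell × D.Cell
  | 0 => (p, d)
  | k + 1 => (D.comp k (s k) (tower D s t p d k).2, D.comp k (tower D s t p d k).1 (t k))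

theorem tower_congr {n : ℕ} {D : NCat.{u} n} {s t s' t' : ℕ → D.Cell} {p d : D.Cell} :
    ∀ k : ℕ, (∀ j < k, s j = s' j) → (∀ j < k, t j = t' j) →
      tower D s t p d k = tower D s' t' p d k
  | 0, _, _ => rfl
  | k + 1, hs, ht => by
    have ih := tower_congr (p := p) (d := d) k (fun j hj => hs j (hj.trans (Nat.lt_succ_self k)))
      (fun j hj => ht j (hj.trans (Nat.lt_succ_self k)))
    simp only [tower, ih, hs k (Nat.lt_succ_self k), ht k (Nat.lt_succ_self k)]

/-- The components `s j`, `t j` for `j < k` are those of a lax transformation from `p` to `d` on the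
boundary of a cell of dimension `k`. -/
structure Frame {n : ℕ} (D : NCat.{u} n) (s t : ℕ → D.Cell) (p d : D.Cell) (k : ℕ) : Prop where
  dim_s : ∀ j < k, D.src (j + 1) (s j) = s j
  dim_t : ∀ j < k, D.src (j + 1) (t j) = t j
  tgt_s : ∀ j < k, D.tgt j (s j) = (tower D s t (D.src j p) (D.src j d) j).2
  src_t : ∀ j < k, D.src j (t j) = (tower D s t (D.tgt j p) (D.tgt j d) j).1

section Tower

variable {n : ℕ} {D : NCat.{u} n} {s t : ℕ → D.Cell} {p d : D.Cell}

theorem Frame.mono {k l : ℕ} (h : Frame D s t p d k) (hl : l ≤ k) : Frame D s t p d l :=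
  ⟨fun j hj => h.dim_s j (hj.trans_le hl), fun j hj => h.dim_t j (hj.trans_le hl),
    fun j hj => h.tgt_s j (hj.trans_le hl), fun j hj => h.src_t j (hj.trans_le hl)⟩

theorem tower_src : ∀ {k : ℕ}, Frame D s t p d k → ∀ {i : ℕ}, k ≤ i →
    tower D s t (D.src i p) (D.src i d) k =
      (D.src i (tower D s t p d k).1, D.src i (tower D s t p d k).2)
  | 0, _, _, _ => rfl
  | k + 1, h, i, hi => by
    have ih := tower_src (h.mono (Nat.le_succ k)) (Nat.le_of_succ_le hi)
    simp only [tower, ih]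
    rw [D.src_comp' hi, D.src_comp' hi, D.src_eq_of_le (h.dim_s k (Nat.lt_succ_self k)) hi,
      D.src_eq_of_le (h.dim_t k (Nat.lt_succ_self k)) hi]

theorem tower_tgt : ∀ {k : ℕ}, Frame D s t p d k → ∀ {i : ℕ}, k ≤ i →
    tower D s t (D.tgt i p) (D.tgt i d) k =
      (D.tgt i (tower D s t p d k).1, D.tgt i (tower D s t p d k).2)
  | 0, _, _, _ => rfl
  | k + 1, h, i, hi => by
    have ih := tower_tgt (h.mono (Nat.le_succ k)) (Nat.le_of_succ_le hi)
    simp only [tower, ih]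
    rw [D.tgt_comp' hi, D.tgt_comp' hi, D.tgt_eq_of_le (h.dim_s k (Nat.lt_succ_self k)) hi,
      D.tgt_eq_of_le (h.dim_t k (Nat.lt_succ_self k)) hi]

/-- The left factor of `F_{k+1}` is composable with the right one. -/
theorem Frame.composable_s {k : ℕ} (h : Frame D s t p d (k + 1)) :
    D.tgt k (s k) = D.src k (tower D s t p d k).2 := by
  rw [h.tgt_s k (Nat.lt_succ_self k), tower_src (h.mono (Nat.le_succ k)) le_rfl]

/-- The left factor of `G_{k+1}` is composable with the right one. -/
theorem Frame.composable_t {k : ℕ} (h : Frame D s t p d (k + 1)) :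
    D.tgt k (tower D s t p d k).1 = D.src k (t k) := by
  rw [h.src_t k (Nat.lt_succ_self k), tower_tgt (h.mono (Nat.le_succ k)) le_rfl]

/-- `F_k` and `G_k` are functors on the homs in dimension `k`. -/
theorem tower_comp {p' d' : D.Cell} : ∀ {k : ℕ}, Frame D s t p d k → Frame D s t p' d' k →
    ∀ {i : ℕ}, k ≤ i → D.tgt i p = D.src i p' → D.tgt i d = D.src i d' →
    tower D s t (D.comp i p p') (D.comp i d d') k =
      (D.comp i (tower D s t p d k).1 (tower D s t p' d' k).1,
        D.comp i (tower D s t p d k).2 (tower D s t p' d' k).2)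
  | 0, _, _, _, _, _, _ => rfl
  | k + 1, h, h', i, hi, hp, hd => by
    have hki : k < i := hi
    have lt := Nat.lt_succ_self k
    have hk := h.mono (Nat.le_succ k)
    have hk' := h'.mono (Nat.le_succ k)
    have ih := tower_comp hk hk' hki.le hp hd
    have e := tower_tgt hk hki.le
    rw [hp, hd, tower_src hk' hki.le] at e
    have e1 := (congrArg Prod.fst e).symm
    have e2 := (congrArg Prod.snd e).symm
    dsimp only at e1 e2
    simp only [tower, ih]
    have ds := D.src_eq_of_le (h.dim_s k lt) hi
    have dt := D.src_eq_of_le (h.dim_t k lt) hi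
    have ds' := D.tgt_eq_of_le (h.dim_s k lt) hi
    have dt' := D.tgt_eq_of_le (h.dim_t k lt) hi
    refine Prod.ext ?_ ?_
    · dsimp only
      rw [← D.interchange hki (ds'.trans ds.symm) e2 h.composable_s,
        D.comp_self_of_le (h.dim_s k lt) hi]
    · dsimp only
      rw [← D.interchange hki e1 (dt'.trans dt.symm) h.composable_t,
        D.comp_self_of_le (h.dim_t k lt) hi]

end Tower

/-- The tower of a map `α` on cells at a cell `c`. -/
abbrev towerAt {n : ℕ} {C D : NCat.{u} n} (α F G : C.Cell → D.Cell) (c : C.Cell) (k : ℕ) :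
    D.Cell × D.Cell :=
  tower D (fun j => α (C.src j c)) (fun j => α (C.tgt j c)) (F c) (G c) k

/-- The boundary conditions of a lax transformation. -/
structure IsBdry {n : ℕ} {C D : NCat.{u} n} (α F G : C.Cell → D.Cell) : Prop where
  src : ∀ k c, D.src k (α c) = (towerAt α F G (C.src k c) k).1
  tgt : ∀ k c, D.tgt k (α c) = (towerAt α F G (C.tgt k c) k).2

/-- The composition condition of a lax transformation for the `k`-composition of two cells. -/
def IsLaxComp {n : ℕ} {C D : NCat.{u} n} (α F G : C.Cell → D.Cell) (m k : ℕ) : Prop :=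
  ∀ c c' : C.Cell, C.tgt k c = C.src k c' →
    α (C.comp k c c') =
      vcomp (fun j p => (C.src j p.1, C.src j p.2)) (fun j p => (C.tgt j p.1, C.tgt j p.2)) D
        m (k + 1) (fun p : C.Cell × C.Cell => D.comp k (α p.1) (towerAt α F G p.2 k).2)
        (fun p => D.comp k (towerAt α F G p.1 k).1 (α p.2)) (c, c')

theorem isLaxTrans_towerAt_iff {n : ℕ} {C D : NCat.{u} n} (α F G : C.Cell → D.Cell) :
    ∀ m k : ℕ, k + m = n →
    (IsLaxTrans C D α m k (fun c => (towerAt α F G c k).1) (fun c => (towerAt α F G c k).2) ↔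
      (∀ i, k ≤ i → i < n → ∀ c, D.src i (α c) = (towerAt α F G (C.src i c) i).1 ∧
        D.tgt i (α c) = (towerAt α F G (C.tgt i c) i).2) ∧
      (∀ c, α c = (towerAt α F G c n).1 ∧ α c = (towerAt α F G c n).2) ∧
      ∀ i l, k ≤ i → i + l + 1 = n → IsLaxComp α F G l i)
  | 0, k, hk => by
    obtain rfl : k = n := hk
    exact ⟨fun h => ⟨fun i h1 h2 => absurd h1 (not_le.2 h2), h, fun i l h1 h2 => by omega⟩,
      fun h => h.2.1⟩
  | m + 1, k, hk => by
    have ih := isLaxTrans_towerAt_iff α F G m (k + 1) (by omega)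
    constructor
    · rintro ⟨h1, h2, h3⟩
      obtain ⟨i1, i2, i3⟩ := ih.1 h2
      refine ⟨fun i hi hin => ?_, i2, fun i l hi hl => ?_⟩
      · rcases hi.eq_or_lt with rfl | hi
        · exact h1
        · exact i1 i hi hin
      · rcases hi.eq_or_lt with rfl | hi
        · obtain rfl : l = m := by omega
          exact h3
        · exact i3 i l hi hl
    · rintro ⟨h1, h2, h3⟩
      exact ⟨h1 k le_rfl (by omega), ih.2 ⟨fun i hi => h1 i (Nat.le_of_succ_le hi), h2,
        fun i l hi => h3 i l (Nat.le_of_succ_le hi)⟩, h3 k m le_rfl (by omega)⟩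

theorem isLaxTrans_iff {n : ℕ} {C D : NCat.{u} n} (α F G : C.Cell → D.Cell) :
    IsLaxTrans C D α n 0 F G ↔ IsBdry α F G ∧ ∀ k m, k + m + 1 = n → IsLaxComp α F G m k := by
  refine (isLaxTrans_towerAt_iff α F G n 0 (Nat.zero_add n)).trans ⟨?_, ?_⟩
  · rintro ⟨h1, h2, h3⟩
    have key : ∀ c l, α c = (towerAt α F G c (n + l)).1 ∧ α c = (towerAt α F G c (n + l)).2 := by
      intro c l
      induction l with
      | zero => exact h2 c
      | succ l ih =>
        have hl : n ≤ n + l := Nat.le_add_right n l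
        refine ⟨?_, ?_⟩
        · change _ = D.comp (n + l) (α (C.src (n + l) c)) _
          rw [D.comp_of_le hl, C.src_of_le hl]
        · change _ = D.comp (n + l) _ (α (C.tgt (n + l) c))
          rw [D.comp_of_le hl]
          exact ih.1
    refine ⟨⟨fun k c => ?_, fun k c => ?_⟩, fun k m => h3 k m (Nat.zero_le k)⟩
    · rcases lt_or_ge k n with hk | hk
      · exact (h1 k (Nat.zero_le k) hk c).1
      · obtain ⟨l, rfl⟩ := Nat.exists_eq_add_of_le hk
        rw [C.src_of_le hk, D.src_of_le hk]
        exact (key c l).1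
    · rcases lt_or_ge k n with hk | hk
      · exact (h1 k (Nat.zero_le k) hk c).2
      · obtain ⟨l, rfl⟩ := Nat.exists_eq_add_of_le hk
        rw [C.tgt_of_le hk, D.tgt_of_le hk]
        exact (key c l).2
  · rintro ⟨h1, h2⟩
    refine ⟨fun i _ _ c => ⟨h1.src i c, h1.tgt i c⟩, fun c => ⟨?_, ?_⟩,
      fun k m _ => h2 k m⟩
    · have := h1.src n c
      rwa [C.src_dim, D.src_dim] at this
    · have := h1.tgt n c
      rwa [C.tgt_dim, D.tgt_dim] at this

section Bdry

variable {n : ℕ} {C D : NCat.{u} n} {α F G : C.Cell → D.Cell}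

theorem towerAt_src {k j : ℕ} (h : k ≤ j) (c : C.Cell) :
    towerAt α F G (C.src j c) k =
      tower D (fun j => α (C.src j c)) (fun j => α (C.tgt j c)) (F (C.src j c)) (G (C.src j c)) k :=
  tower_congr k (fun i hi => by rw [C.src_src c (hi.trans_le h)])
    (fun i hi => by rw [C.tgt_src c (hi.trans_le h)])

theorem towerAt_tgt {k j : ℕ} (h : k ≤ j) (c : C.Cell) :
    towerAt α F G (C.tgt j c) k =
      tower D (fun j => α (C.src j c)) (fun j => α (C.tgt j c)) (F (C.tgt j c)) (G (C.tgt j c)) k :=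
  tower_congr k (fun i hi => by rw [C.src_tgt c (hi.trans_le h)])
    (fun i hi => by rw [C.tgt_tgt c (hi.trans_le h)])

/-- A lax transformation raises dimensions by one. -/
theorem IsBdry.dim (h : IsBdry α F G) {j : ℕ} {c : C.Cell} (hc : C.src j c = c) {i : ℕ}
    (hi : j < i) : D.src i (α c) = α c := by
  refine D.src_eq_of_le (k := j + 1) ?_ hi
  rw [h.src, C.src_eq_of_le hc (Nat.le_succ j)]
  have := h.tgt j c
  rw [C.tgt_eq_of_le hc le_rfl] at this
  change D.comp j (α (C.src j c)) (towerAt α F G c j).2 = α c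
  rw [← this, hc, D.comp_id]

theorem IsBdry.frame {F G : NFunctor C D} (h : IsBdry α F.map G.map) (c : C.Cell) (k : ℕ) :
    Frame D (fun j => α (C.src j c)) (fun j => α (C.tgt j c)) (F.map c) (G.map c) k where
  dim_s j _ := h.dim (C.src_src_of_le c le_rfl) (Nat.lt_succ_self j)
  dim_t j _ := h.dim (C.src_tgt_of_le c le_rfl) (Nat.lt_succ_self j)
  tgt_s j _ := by
    rw [h.tgt, C.tgt_src_of_le c le_rfl, towerAt_src le_rfl, F.map_src, G.map_src]
  src_t j _ := by
    rw [h.src, C.src_tgt_of_le c le_rfl, towerAt_tgt le_rfl, F.map_tgt, G.map_tgt]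

/-- The vertical composite with an identity, on either side. -/
theorem IsBdry.vcomp_unit (h : IsBdry α F G) : ∀ m k : ℕ, k + m = n → ∀ c,
    vcomp C.src C.tgt D m k (fun c => (towerAt α F G c k).1) α c = α c ∧
    vcomp C.src C.tgt D m k α (fun c => (towerAt α F G c k).2) c = α c
  | 0, k, hk, c => by
    obtain rfl : k = n := hk
    have := h.src k c
    rw [C.src_dim, D.src_dim] at this
    exact ⟨this.symm, rfl⟩
  | m + 1, k, hk, c => by
    have ih := h.vcomp_unit m (k + 1) (by omega) c
    constructor
    · refine Eq.trans ?_ ih.2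
      have e : (fun c => D.comp k (towerAt α F G (C.src k c) k).1 (α c)) = α := by
        funext c
        rw [← h.src, D.id_comp]
      change vcomp C.src C.tgt D m (k + 1)
        (fun c => D.comp k (towerAt α F G (C.src k c) k).1 (α c)) _ c = _
      rw [e]
      rfl
    · refine Eq.trans ?_ ih.1
      have e : (fun c => D.comp k (α c) (towerAt α F G (C.tgt k c) k).2) = α := by
        funext c
        rw [← h.tgt, D.comp_id]
      change vcomp C.src C.tgt D m (k + 1) _
        (fun c => D.comp k (α c) (towerAt α F G (C.tgt k c) k).2) c = _
      rw [e]
      rfl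

end Bdry

/-- Vertical composites agree along a relation that is preserved by sources and targets. -/
theorem vcomp_rel {n : ℕ} {P P' : Type u} {s t : ℕ → P → P} {s' t' : ℕ → P' → P'}
    (D : NCat.{u} n) (R : P → P' → Prop) : ∀ m k : ℕ,
    (∀ l, k ≤ l → ∀ p p', R p p' → R (s l p) (s' l p')) →
    (∀ l, k ≤ l → ∀ p p', R p p' → R (t l p) (t' l p')) →
    ∀ {ω α : P → D.Cell} {ω' α' : P' → D.Cell}, (∀ p p', R p p' → ω p = ω' p') →
    (∀ p p', R p p' → α p = α' p') → ∀ p p', R p p' →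
    vcomp s t D m k ω α p = vcomp s' t' D m k ω' α' p'
  | 0, _, _, _, _, _, _, _, hω, _, p, p', h => hω p p' h
  | m + 1, k, hs, ht, _, _, _, _, hω, hα, p, p', h =>
    vcomp_rel D R m (k + 1) (fun l hl => hs l (Nat.le_of_succ_le hl))
      (fun l hl => ht l (Nat.le_of_succ_le hl))
      (fun p p' h => by rw [hω _ _ (hs k le_rfl p p' h), hα p p' h])
      (fun p p' h => by rw [hω p p' h, hα _ _ (ht k le_rfl p p' h)]) p p' h

/-- The vertical composite on objects is the composite of the components. -/
theorem vcomp_obj {n : ℕ} {P : Type u} {s t : ℕ → P → P} {D : NCat.{u} n} : ∀ m k : ℕ, k + m = n →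
    ∀ {ω α : P → D.Cell} {c : P}, (∀ l, k ≤ l → s l c = c) → (∀ l, k ≤ l → t l c = c) →
    D.src (k + 1) (ω c) = ω c → D.src (k + 1) (α c) = α c →
    vcomp s t D m k ω α c = D.comp k (ω c) (α c)
  | 0, k, hk, ω, α, c, _, _, _, _ => by
    rw [D.comp_of_le (by omega)]
    rfl
  | m + 1, k, hk, ω, α, c, hs, ht, hω, hα => by
    have e : D.src (k + 1) (D.comp k (ω c) (α c)) = D.comp k (ω c) (α c) := by
      rw [D.src_comp' (Nat.lt_succ_self k), hω, hα]
    have ih := vcomp_obj (s := s) (t := t) (D := D) m (k + 1) (by omega)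
      (ω := fun c => D.comp k (ω (s k c)) (α c)) (α := fun c => D.comp k (ω c) (α (t k c))) (c := c)
      (fun l hl => hs l (Nat.le_of_succ_le hl)) (fun l hl => ht l (Nat.le_of_succ_le hl))
    simp only [hs k le_rfl, ht k le_rfl] at ih
    refine (ih (D.src_eq_of_le e (Nat.le_succ _)) (D.src_eq_of_le e (Nat.le_succ _))).trans ?_
    exact D.comp_self_of_le e le_rfl

/-- The composition condition is automatic if the first cell is an identity. -/
theorem IsBdry.laxComp_left {n : ℕ} {C D : NCat.{u} n} {α F G : C.Cell → D.Cell}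
    (h : IsBdry α F G) {m k : ℕ} (hk : k + m + 1 = n) (c : C.Cell) :
    α c = vcomp (fun j p => (C.src j p.1, C.src j p.2)) (fun j p => (C.tgt j p.1, C.tgt j p.2)) D
        m (k + 1) (fun p : C.Cell × C.Cell => D.comp k (α p.1) (towerAt α F G p.2 k).2)
        (fun p => D.comp k (towerAt α F G p.1 k).1 (α p.2)) (C.src k c, c) := by
  refine ((vcomp_rel D (fun p x => p = (C.src k x, x)) m (k + 1) ?_ ?_ ?_ ?_ _ c rfl).trans
    (h.vcomp_unit m (k + 1) (by omega) c).1).symm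
  · rintro l hl _ x rfl
    rw [C.src_src _ hl, C.src_src_of_le _ (Nat.le_of_succ_le hl)]
  · rintro l hl _ x rfl
    rw [C.src_tgt _ hl, C.tgt_src_of_le _ (Nat.le_of_succ_le hl)]
  · rintro _ x rfl
    rfl
  · rintro _ x rfl
    dsimp only
    rw [← h.src, D.id_comp]

/-- The composition condition is automatic if the second cell is an identity. -/
theorem IsBdry.laxComp_right {n : ℕ} {C D : NCat.{u} n} {α F G : C.Cell → D.Cell}
    (h : IsBdry α F G) {m k : ℕ} (hk : k + m + 1 = n) (c : C.Cell) :
    α c = vcomp (fun j p => (C.src j p.1, C.src j p.2)) (fun j p => (C.tgt j p.1, C.tgt j p.2)) D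
        m (k + 1) (fun p : C.Cell × C.Cell => D.comp k (α p.1) (towerAt α F G p.2 k).2)
        (fun p => D.comp k (towerAt α F G p.1 k).1 (α p.2)) (c, C.tgt k c) := by
  refine ((vcomp_rel D (fun p x => p = (x, C.tgt k x)) m (k + 1) ?_ ?_ ?_ ?_ _ c rfl).trans
    (h.vcomp_unit m (k + 1) (by omega) c).2).symm
  · rintro l hl _ x rfl
    rw [C.tgt_src _ hl, C.src_tgt_of_le _ (Nat.le_of_succ_le hl)]
  · rintro l hl _ x rfl
    rw [C.tgt_tgt _ hl, C.tgt_tgt_of_le _ (Nat.le_of_succ_le hl)]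
  · rintro _ x rfl
    dsimp only
    rw [← h.tgt, D.comp_id]
  · rintro _ x rfl
    rfl

theorem IsBdry.comp_functor {n : ℕ} {X C D : NCat.{u} n} {α F G : C.Cell → D.Cell}
    (h : IsBdry α F G) (L : NFunctor X C) :
    IsBdry (C := X) (fun x => α (L.map x)) (fun x => F (L.map x)) (fun x => G (L.map x)) where
  src k c := by
    rw [h.src]
    simp only [towerAt, L.map_src, L.map_tgt]
  tgt k c := by
    rw [h.tgt]
    simp only [towerAt, L.map_src, L.map_tgt]

/-! ### Spheres -/

/-- The `n`-category with exactly two cells `(j, false)` and `(j, true)` in each dimension `j ≤ m`,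
which are the source and the target of all cells of higher dimension. -/
def sphere {m n : ℕ} (h : m ≤ n) : NCat.{u} n where
  Cell := ULift {p : ℕ × Bool // p.1 ≤ m}
  src k c := if hk : k < c.1.1.1 then ⟨⟨(k, false), hk.le.trans c.1.2⟩⟩ else c
  tgt k c := if hk : k < c.1.1.1 then ⟨⟨(k, true), hk.le.trans c.1.2⟩⟩ else c
  comp k c d := if c = if hk : k < d.1.1.1 then ⟨⟨(k, false), hk.le.trans d.1.2⟩⟩ else d
    then d else c
  src_src x h := by grind
  src_tgt x h := by grind
  tgt_src x h := by grind
  tgt_tgt x h := by grind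
  src_src_of_le x h := by grind
  src_tgt_of_le x h := by grind
  tgt_src_of_le x h := by grind
  tgt_tgt_of_le x h := by grind
  src_dim x := by
    have := x.1.2
    grind
  src_comp_self h := by grind
  tgt_comp_self h := by grind
  src_comp h h' := by grind
  tgt_comp h h' := by grind
  id_comp k x := by grind
  comp_id k x := by grind
  assoc h h' := by grind
  interchange h h₁ h₂ h₃ := by grind
  comp_of_ne h := by grind

namespace sphere

variable {m n : ℕ} {h : m ≤ n}

theorem comp_cases {k : ℕ} {c d : (sphere.{u} h).Cell}
    (e : (sphere h).tgt k c = (sphere h).src k d) :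
    (c = (sphere h).src k d ∧ (sphere h).comp k c d = d) ∨
      (d = (sphere h).tgt k c ∧ (sphere h).comp k c d = c) := by
  simp only [sphere] at *
  grind

/-- On a sphere, the composition condition follows from the boundary conditions. -/
theorem isLaxTrans {D : NCat.{u} n} {α F G : (sphere.{u} h).Cell → D.Cell} (hα : IsBdry α F G) :
    IsLaxTrans (sphere h) D α n 0 F G := by
  refine (isLaxTrans_iff α F G).2 ⟨hα, fun k m hk c d hcd => ?_⟩
  rcases comp_cases hcd with ⟨h1, h2⟩ | ⟨h1, h2⟩
  · rw [h2]
    subst h1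
    exact hα.laxComp_left hk d
  · rw [h2]
    subst h1
    exact hα.laxComp_right hk c

/-- The cell of a sphere in dimension `j`. -/
def mk (j : ℕ) (e : Bool) (hj : j ≤ m) : (sphere.{u} h).Cell := ⟨⟨(j, e), hj⟩⟩

theorem src_mk {j k : ℕ} {e : Bool} (hj : j ≤ m) (hk : k < j) :
    (sphere.{u} h).src k (mk j e hj) = mk k false (hk.le.trans hj) := dif_pos hk

theorem tgt_mk {j k : ℕ} {e : Bool} (hj : j ≤ m) (hk : k < j) :
    (sphere.{u} h).tgt k (mk j e hj) = mk k true (hk.le.trans hj) := dif_pos hk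

theorem src_mk_of_le {j k : ℕ} {e : Bool} (hj : j ≤ m) (hk : j ≤ k) :
    (sphere.{u} h).src k (mk j e hj) = mk j e hj := dif_neg (not_lt.2 hk)

theorem tgt_mk_of_le {j k : ℕ} {e : Bool} (hj : j ≤ m) (hk : j ≤ k) :
    (sphere.{u} h).tgt k (mk j e hj) = mk j e hj := dif_neg (not_lt.2 hk)

/-- The iterated source or target of `c` that corresponds to a cell of a sphere. -/
def face {C : NCat.{u} n} (c : C.Cell) (x : (sphere.{u} h).Cell) : C.Cell :=
  if x.1.1.2 then C.tgt x.1.1.1 c else C.src x.1.1.1 c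

theorem face_src {C : NCat.{u} n} (c : C.Cell) (k : ℕ) (x : (sphere.{u} h).Cell) :
    face c ((sphere h).src k x) = C.src k (face c x) := by
  obtain ⟨⟨⟨j, e⟩, hj⟩⟩ := x
  change face c ((sphere h).src k (mk j e hj)) = C.src k (face c (mk j e hj))
  rcases lt_or_ge k j with hk | hk
  · rw [src_mk hj hk]
    cases e
    · exact (C.src_src c hk).symm
    · exact (C.src_tgt c hk).symm
  · rw [src_mk_of_le hj hk]
    cases e
    · exact (C.src_src_of_le c hk).symm
    · exact (C.src_tgt_of_le c hk).symm

theorem face_tgt {C : NCat.{u} n} (c : C.Cell) (k : ℕ) (x : (sphere.{u} h).Cell) :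
    face c ((sphere h).tgt k x) = C.tgt k (face c x) := by
  obtain ⟨⟨⟨j, e⟩, hj⟩⟩ := x
  change face c ((sphere h).tgt k (mk j e hj)) = C.tgt k (face c (mk j e hj))
  rcases lt_or_ge k j with hk | hk
  · rw [tgt_mk hj hk]
    cases e
    · exact (C.tgt_src c hk).symm
    · exact (C.tgt_tgt c hk).symm
  · rw [tgt_mk_of_le hj hk]
    cases e
    · exact (C.tgt_src_of_le c hk).symm
    · exact (C.tgt_tgt_of_le c hk).symm

/-- The functor that sends the cells of a sphere to the iterated sources and targets of an
`m`-cell `c`; the two cells of dimension `m` go to `c`. -/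
def toCell (h : m ≤ n) {C : NCat.{u} n} (c : C.Cell) : NFunctor (sphere.{u} h) C where
  map := face c
  map_src := face_src c
  map_tgt := face_tgt c
  map_comp k x y hxy := by
    rcases comp_cases hxy with ⟨h1, h2⟩ | ⟨h1, h2⟩
    · rw [h2, h1, face_src, C.id_comp]
    · rw [h2, h1, face_tgt, C.comp_id]

end sphere

/-! ### Cells of an `h`-kernel -/

section Kernel

variable {n : ℕ} {B C : PtGpd.{u} n} {G : PtFunctor B C} {K : NCat.{u} n}
  {k : NFunctor K B.toNCat} {κ : LaxTrans (zero K C) (k.comp G.toNFunctor)}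

/-- The boundary conditions for a map `α` to be a lax transformation from `0` to `S G`. -/
abbrev IsBdryZero {n : ℕ} {B C : PtGpd.{u} n} (G : PtFunctor B C) {X : NCat.{u} n}
    (S : NFunctor X B.toNCat) (α : X.Cell → C.Cell) : Prop :=
  IsBdry (D := C.toNCat) α (zero X C).map (S.comp G.toNFunctor).map

theorem LaxTrans.isBdry {n : ℕ} {X Y : NCat.{u} n} {F G : NFunctor X Y} (α : LaxTrans F G) :
    IsBdry α.app F.map G.map :=
  ((isLaxTrans_iff _ _ _).1 α.isLaxTrans).1

/-- The tower of cells of `C` that bounds a component, over a cell `b` of `B`, of a lax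
transformation with the given lower components. -/
abbrev ker {n : ℕ} {B C : PtGpd.{u} n} (G : PtFunctor B C) (s t : ℕ → C.Cell) (b : B.Cell) (j : ℕ) :
    C.Cell × C.Cell :=
  tower C.toNCat s t C.pt (G.map b) j

/-- A cell of an `h`-kernel is determined by its image and the components of the transformation. -/
theorem IsHKernel.cell_ext (hK : IsHKernel G K k κ) {z z' : K.Cell} (hk : k.map z = k.map z')
    (hs : ∀ j, κ.app (K.src j z) = κ.app (K.src j z'))
    (ht : ∀ j, κ.app (K.tgt j z) = κ.app (K.tgt j z')) : z = z' := by
  let L := sphere.toCell le_rfl z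
  let L' := sphere.toCell le_rfl z'
  have e : L'.comp k = L.comp k := by
    refine NFunctor.ext (funext ?_)
    rintro ⟨⟨⟨j, e⟩, hj⟩⟩
    cases e
    · change k.map (K.src j z') = k.map (K.src j z)
      rw [k.map_src, k.map_src, hk]
    · change k.map (K.tgt j z') = k.map (K.tgt j z)
      rw [k.map_tgt, k.map_tgt, hk]
  let lam : LaxTrans (zero (sphere.{u} (le_refl n)) C) ((L.comp k).comp G.toNFunctor) :=
    ⟨fun x => κ.app (L.map x), sphere.isLaxTrans (κ.isBdry.comp_functor L)⟩
  have := (hK _ (NFunctor.toTerminal _) (L.comp k) lam).unique (y₁ := L) (y₂ := L')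
    ⟨rfl, rfl, fun x => rfl⟩ ⟨rfl, e, by
      rintro ⟨⟨⟨j, e⟩, hj⟩⟩
      cases e
      · exact (hs j).symm
      · exact (ht j).symm⟩
  have := congrArg (fun M => NFunctor.map M (sphere.mk n false le_rfl)) this
  change K.src n z = K.src n z' at this
  rwa [K.src_dim, K.src_dim] at this

/-- Boundary conditions on a sphere suffice to map it to an `h`-kernel. -/
theorem IsHKernel.exists_sphere (hK : IsHKernel G K k κ) {m : ℕ} (hm : m ≤ n) {b : B.Cell}
    {α : (sphere.{u} hm).Cell → C.Cell}
    (hα : IsBdryZero G (sphere.toCell hm b) α) :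
    ∃ L : NFunctor (sphere hm) K, (∀ x, k.map (L.map x) = (sphere.toCell hm b).map x) ∧
      ∀ x, κ.app (L.map x) = α x := by
  obtain ⟨L, ⟨-, h1, h2⟩, -⟩ := hK (sphere hm) (NFunctor.toTerminal _) (sphere.toCell hm b)
    ⟨α, sphere.isLaxTrans hα⟩
  exact ⟨L, fun x => congrArg (fun M => NFunctor.map M x) h1, h2⟩

/-- Objects of an `h`-kernel: pairs of an object `b` and a `1`-cell from the base point to its
image. -/
theorem IsHKernel.exists_obj (hK : IsHKernel G K k κ) {b : B.Cell} (hb : B.src 0 b = b)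
    {ψ : C.Cell} (h1 : C.src 1 ψ = ψ) (hs : C.src 0 ψ = C.pt) (ht : C.tgt 0 ψ = G.map b) :
    ∃ z, K.src 0 z = z ∧ k.map z = b ∧ κ.app z = ψ := by
  have hm : 0 ≤ n := Nat.zero_le n
  have hc : ∀ (l : ℕ) (c : (sphere.{u} hm).Cell),
      (sphere hm).src l c = c ∧ (sphere hm).tgt l c = c := by
    rintro l ⟨⟨⟨j, e⟩, hj⟩⟩
    exact ⟨sphere.src_mk_of_le hj (hj.trans (Nat.zero_le l)),
      sphere.tgt_mk_of_le hj (hj.trans (Nat.zero_le l))⟩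
  have hbc : ∀ c, (sphere.toCell hm b).map c = b := by
    rintro ⟨⟨⟨j, e⟩, hj⟩⟩
    cases e
    · exact B.src_eq_of_le hb (Nat.zero_le j)
    · exact B.tgt_eq_of_le hb (Nat.zero_le j)
  have ht0 : ∀ l c, towerAt (C := sphere hm) (D := C.toNCat) (fun _ => ψ) (zero _ C).map
      ((sphere.toCell hm b).comp G.toNFunctor).map c l =
      tower C.toNCat (fun _ => ψ) (fun _ => ψ) C.pt (G.map b) l := by
    intro l c
    change tower _ _ _ _ (G.map ((sphere.toCell hm b).map c)) l = _
    rw [hbc]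
    rfl
  have htow : ∀ l, tower C.toNCat (fun _ => ψ) (fun _ => ψ) C.pt (G.map b) (l + 1) = (ψ, ψ) := by
    intro l
    induction l with
    | zero =>
      change (C.comp 0 ψ (G.map b), C.comp 0 C.pt ψ) = _
      rw [← ht, C.comp_id, ← hs, C.id_comp]
    | succ l ih =>
      rw [tower, ih]
      dsimp only
      rw [C.comp_self_of_le h1 (Nat.succ_le_succ (Nat.zero_le l))]
  have hα : IsBdryZero G (sphere.toCell hm b) (fun _ => ψ) := by
    refine ⟨fun l c => ?_, fun l c => ?_⟩
    · rw [ht0]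
      cases l with
      | zero => exact hs
      | succ l => rw [htow]; exact C.src_eq_of_le h1 (Nat.succ_le_succ (Nat.zero_le l))
    · rw [ht0]
      cases l with
      | zero => exact ht
      | succ l => rw [htow]; exact C.tgt_eq_of_le h1 (Nat.succ_le_succ (Nat.zero_le l))
  obtain ⟨L, h1, h2⟩ := hK.exists_sphere hm hα
  refine ⟨L.map (sphere.mk 0 false le_rfl), ?_, ?_, h2 _⟩
  · rw [← L.map_src, (hc 0 _).1]
  · rw [h1, hbc]

theorem frame_congr {D : NCat.{u} n} {s t : ℕ → D.Cell} {p d p' d' : D.Cell} {j : ℕ}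
    (h : Frame D s t p d j) (e1 : ∀ i < j, D.src i p = D.src i p')
    (e2 : ∀ i < j, D.src i d = D.src i d') (e3 : ∀ i < j, D.tgt i p = D.tgt i p')
    (e4 : ∀ i < j, D.tgt i d = D.tgt i d') : Frame D s t p' d' j where
  dim_s := h.dim_s
  dim_t := h.dim_t
  tgt_s i hi := by rw [h.tgt_s i hi, e1 i hi, e2 i hi]
  src_t i hi := by rw [h.src_t i hi, e3 i hi, e4 i hi]

/-- The lower components at a cell `x` of an `h`-kernel frame all cells of `B` with the same
boundary. -/
theorem LaxTrans.frame_ker {X : NCat.{u} n} {S : NFunctor X B.toNCat}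
    (lam : LaxTrans (zero X C) (S.comp G.toNFunctor)) {x y : X.Cell} {j : ℕ} {b : B.Cell}
    (h1 : B.src j b = S.map x) (h2 : B.tgt j b = S.map y)
    (h3 : ∀ i < j, X.tgt i y = X.tgt i x) :
    Frame C.toNCat (fun i => lam.app (X.src i x)) (fun i => lam.app (X.tgt i x)) C.pt (G.map b)
      j := by
  refine frame_congr (lam.isBdry.frame x j) (fun i hi => rfl) (fun i hi => ?_) (fun i hi => rfl)
    (fun i hi => ?_)
  · change C.src i (G.map (S.map x)) = C.src i (G.map b)
    rw [← G.map_src, ← G.map_src, ← h1, B.src_src _ hi]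
  · change C.tgt i (G.map (S.map x)) = C.tgt i (G.map b)
    rw [← G.map_tgt, ← G.map_tgt, ← S.map_tgt, ← h3 i hi, S.map_tgt, ← h2, B.tgt_tgt _ hi]

theorem LaxTrans.ker_src {X : NCat.{u} n} {S : NFunctor X B.toNCat}
    (lam : LaxTrans (zero X C) (S.comp G.toNFunctor)) {x : X.Cell} {j : ℕ}
    (hx : X.src j x = x) :
    C.src j (lam.app x) =
      (ker G (fun i => lam.app (X.src i x)) (fun i => lam.app (X.tgt i x)) (S.map x) j).1 := by
  have := lam.isBdry.src j x
  rwa [hx] at this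

theorem LaxTrans.ker_tgt {X : NCat.{u} n} {S : NFunctor X B.toNCat}
    (lam : LaxTrans (zero X C) (S.comp G.toNFunctor)) {x : X.Cell} {j : ℕ}
    (hx : X.src j x = x) :
    C.tgt j (lam.app x) =
      (ker G (fun i => lam.app (X.src i x)) (fun i => lam.app (X.tgt i x)) (S.map x) j).2 := by
  have := lam.isBdry.tgt j x
  rwa [X.tgt_eq_of_le hx le_rfl] at this

/-- Two parallel cells `x`, `y` of an `h`-kernel, a cell `b` between their images and a cell `ψ`
with the boundary of a component over `b` come from a cell `x ⟶ y`. -/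
theorem IsHKernel.exists_cell (hK : IsHKernel G K k κ) {j : ℕ} {x y : K.Cell}
    (hx : K.src j x = x) (hy : K.src j y = y) (hs : ∀ i < j, K.src i y = K.src i x)
    (ht : ∀ i < j, K.tgt i y = K.tgt i x) {b : B.Cell} (hb : B.src (j + 1) b = b)
    (hbs : B.src j b = k.map x) (hbt : B.tgt j b = k.map y) {ψ : C.Cell}
    (hψ : C.src (j + 2) ψ = ψ)
    (hψs : C.src (j + 1) ψ = C.comp j (κ.app x)
      (ker G (fun i => κ.app (K.src i x)) (fun i => κ.app (K.tgt i x)) b j).2)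
    (hψt : C.tgt (j + 1) ψ = C.comp j
      (ker G (fun i => κ.app (K.src i x)) (fun i => κ.app (K.tgt i x)) b j).1 (κ.app y)) :
    ∃ z, K.src (j + 1) z = z ∧ K.src j z = x ∧ K.tgt j z = y ∧ k.map z = b ∧ κ.app z = ψ := by
  have hfr := κ.frame_ker (G := G) hbs hbt ht
  have e2 := tower_src hfr le_rfl
  have e1 := tower_tgt hfr le_rfl
  rw [← G.map_src, hbs, C.src_eq_of_le C.src_pt (Nat.zero_le j)] at e2
  rw [← G.map_tgt, hbt, C.tgt_eq_of_le C.src_pt (Nat.zero_le j)] at e1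
  have c1 : C.tgt j (κ.app x) = C.src j
      (ker G (fun i => κ.app (K.src i x)) (fun i => κ.app (K.tgt i x)) b j).2 :=
    (κ.ker_tgt hx).trans (congrArg Prod.snd e2)
  have c2 : C.tgt j (ker G (fun i => κ.app (K.src i x)) (fun i => κ.app (K.tgt i x)) b j).1 =
      C.src j (κ.app y) := by
    refine Eq.symm ((κ.ker_src hy).trans (Eq.trans ?_ (congrArg Prod.fst e1)))
    exact congrArg Prod.fst (tower_congr j (fun i hi => by rw [hs i hi])
      (fun i hi => by rw [ht i hi]))
  have ψs : C.src j ψ = C.src j (κ.app x) := by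
    rw [← C.src_src ψ (Nat.lt_succ_self j), hψs, C.src_self_comp]
  have ψt : C.tgt j ψ = C.tgt j (κ.app y) := by
    rw [← C.tgt_tgt ψ (Nat.lt_succ_self j), hψt, C.tgt_comp_self c2]
  have c3 : C.comp (j + 1) ψ (C.comp j
      (ker G (fun i => κ.app (K.src i x)) (fun i => κ.app (K.tgt i x)) b j).1 (κ.app y)) = ψ := by
    rw [← hψt, C.comp_id]
  have c4 : C.comp (j + 1) (C.comp j (κ.app x)
      (ker G (fun i => κ.app (K.src i x)) (fun i => κ.app (K.tgt i x)) b j).2) ψ = ψ := by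
    rw [← hψs, C.id_comp]
  rcases lt_or_ge j n with hjn | hjn
  · have hm : j + 1 ≤ n := hjn
    -- the map on cells from the sphere to `K` and `C` that is prescribed by `x`, `y` and `ψ`
    let τ : (sphere.{u} hm).Cell → K.Cell := fun c =>
      if c.1.1.2 then K.tgt c.1.1.1 y else K.src c.1.1.1 x
    let α : (sphere.{u} hm).Cell → C.Cell := fun c => if c.1.1.1 = j + 1 then ψ else κ.app (τ c)
    let S := sphere.toCell hm b
    have τsrc : ∀ (l i : ℕ) (e : Bool) (hi : i ≤ j), τ ((sphere hm).src l
        (sphere.mk i e (hi.trans (Nat.le_succ j)))) = K.src l (τ (sphere.mk i e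
          (hi.trans (Nat.le_succ j)))) := by
      intro l i e hi
      rcases lt_or_ge l i with hl | hl
      · rw [sphere.src_mk _ hl]
        cases e
        · exact (K.src_src x hl).symm
        · exact ((K.src_tgt y hl).trans (hs l (hl.trans_le hi))).symm
      · rw [sphere.src_mk_of_le _ hl]
        cases e
        · exact (K.src_src_of_le x hl).symm
        · exact (K.src_tgt_of_le y hl).symm
    have τtgt : ∀ (l i : ℕ) (e : Bool) (hi : i ≤ j), τ ((sphere hm).tgt l
        (sphere.mk i e (hi.trans (Nat.le_succ j)))) = K.tgt l (τ (sphere.mk i e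
          (hi.trans (Nat.le_succ j)))) := by
      intro l i e hi
      rcases lt_or_ge l i with hl | hl
      · rw [sphere.tgt_mk _ hl]
        cases e
        · exact ((K.tgt_src x hl).trans (ht l (hl.trans_le hi)).symm).symm
        · exact (K.tgt_tgt y hl).symm
      · rw [sphere.tgt_mk_of_le _ hl]
        cases e
        · exact (K.tgt_src_of_le x hl).symm
        · exact (K.tgt_tgt_of_le y hl).symm
    have ατ : ∀ (i : ℕ) (e : Bool) (hi : i ≤ j), α (sphere.mk i e (hi.trans (Nat.le_succ j))) =
        κ.app (τ (sphere.mk i e (hi.trans (Nat.le_succ j)))) := fun i e hi => if_neg (by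
          change ¬ i = j + 1
          omega)
    have αsrc : ∀ (l i : ℕ) (e : Bool) (hi : i ≤ j), α ((sphere hm).src l
        (sphere.mk i e (hi.trans (Nat.le_succ j)))) = κ.app (K.src l (τ (sphere.mk i e
          (hi.trans (Nat.le_succ j))))) := by
      intro l i e hi
      rw [← τsrc l i e hi]
      rcases lt_or_ge l i with hl | hl
      · rw [sphere.src_mk _ hl, ατ l _ (hl.le.trans hi)]
      · rw [sphere.src_mk_of_le _ hl]
        exact ατ i e hi
    have αtgt : ∀ (l i : ℕ) (e : Bool) (hi : i ≤ j), α ((sphere hm).tgt l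
        (sphere.mk i e (hi.trans (Nat.le_succ j)))) = κ.app (K.tgt l (τ (sphere.mk i e
          (hi.trans (Nat.le_succ j))))) := by
      intro l i e hi
      rw [← τtgt l i e hi]
      rcases lt_or_ge l i with hl | hl
      · rw [sphere.tgt_mk _ hl, ατ l _ (hl.le.trans hi)]
      · rw [sphere.tgt_mk_of_le _ hl]
        exact ατ i e hi
    have Sτ : ∀ (i : ℕ) (e : Bool) (hi : i ≤ j), S.map (sphere.mk i e (hi.trans (Nat.le_succ j))) =
        k.map (τ (sphere.mk i e (hi.trans (Nat.le_succ j)))) := by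
      intro i e hi
      cases e
      · change B.src i b = k.map (K.src i x)
        rw [k.map_src, ← hbs]
        rcases hi.eq_or_lt with rfl | hi
        · rw [B.src_src_of_le _ le_rfl]
        · rw [B.src_src _ hi]
      · change B.tgt i b = k.map (K.tgt i y)
        rw [k.map_tgt, ← hbt]
        rcases hi.eq_or_lt with rfl | hi
        · rw [B.tgt_tgt_of_le _ le_rfl]
        · rw [B.tgt_tgt _ hi]
    have low : ∀ (l i : ℕ) (e : Bool) (hi : i ≤ j),
        towerAt (D := C.toNCat) α (zero _ C).map (S.comp G.toNFunctor).map
          (sphere.mk i e (hi.trans (Nat.le_succ j))) l =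
        towerAt κ.app (zero K C).map (k.comp G.toNFunctor).map
          (τ (sphere.mk i e (hi.trans (Nat.le_succ j)))) l := by
      intro l i e hi
      refine (tower_congr l (fun i' _ => αsrc i' i e hi) (fun i' _ => αtgt i' i e hi)).trans ?_
      change tower _ _ _ _ (G.map (S.map _)) l = tower _ _ _ _ (G.map (k.map _)) l
      rw [Sτ _ _ hi]
      rfl
    have hτx : τ (sphere.mk j false (Nat.le_succ j)) = x := hx
    have hτy : τ (sphere.mk j true (Nat.le_succ j)) = y := K.tgt_eq_of_le hy le_rfl
    have top : ∀ e, α (sphere.mk (j + 1) e le_rfl) = ψ := fun e => if_pos rfl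
    have Stop : ∀ e, S.map (sphere.mk (j + 1) e le_rfl) = b := by
      intro e
      cases e
      · exact hb
      · exact B.tgt_eq_of_le hb le_rfl
    have T0 : ∀ e, towerAt (D := C.toNCat) α (zero _ C).map (S.comp G.toNFunctor).map
        (sphere.mk (j + 1) e le_rfl) j =
        ker G (fun i => κ.app (K.src i x)) (fun i => κ.app (K.tgt i x)) b j := by
      intro e
      change tower _ _ _ C.pt (G.map (S.map _)) j = _
      rw [Stop]
      refine tower_congr j (fun i hi => ?_) (fun i hi => ?_)
      · rw [sphere.src_mk _ (hi.trans (Nat.lt_succ_self j)), ατ i _ hi.le]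
        rfl
      · rw [sphere.tgt_mk _ (hi.trans (Nat.lt_succ_self j)), ατ i _ hi.le, ← ht i hi]
        rfl
    have T1 : ∀ e, towerAt (D := C.toNCat) α (zero _ C).map (S.comp G.toNFunctor).map
        (sphere.mk (j + 1) e le_rfl) (j + 1) = (C.src (j + 1) ψ, C.tgt (j + 1) ψ) := by
      intro e
      have e1 : α ((sphere hm).src j (sphere.mk (j + 1) e le_rfl)) = κ.app x := by
        rw [sphere.src_mk _ (Nat.lt_succ_self j), ατ j _ le_rfl, hτx]
      have e2 : α ((sphere hm).tgt j (sphere.mk (j + 1) e le_rfl)) = κ.app y := by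
        rw [sphere.tgt_mk _ (Nat.lt_succ_self j), ατ j _ le_rfl, hτy]
      rw [hψs, hψt, towerAt, tower, e1, e2]
      have := T0 e
      rw [towerAt] at this
      rw [this]
    have T2 : ∀ e l, towerAt (D := C.toNCat) α (zero _ C).map (S.comp G.toNFunctor).map
        (sphere.mk (j + 1) e le_rfl) (j + 2 + l) = (ψ, ψ) := by
      intro e l
      induction l with
      | zero =>
        have := T1 e
        rw [towerAt] at this
        change (C.comp (j + 1) _ (tower _ _ _ _ _ (j + 1)).2,
          C.comp (j + 1) (tower _ _ _ _ _ (j + 1)).1 _) = _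
        rw [this]
        dsimp only
        rw [sphere.src_mk_of_le _ le_rfl, sphere.tgt_mk_of_le _ le_rfl, top, C.comp_id, C.id_comp]
      | succ l ih =>
        rw [towerAt] at ih
        rw [towerAt, ← Nat.add_assoc, tower, ih]
        dsimp only
        rw [sphere.src_mk_of_le _ (by omega), sphere.tgt_mk_of_le _ (by omega), top,
          C.comp_self_of_le hψ (by omega)]
    have hα : IsBdryZero G S α := by
      refine ⟨?_, ?_⟩
      · rintro l ⟨⟨⟨i, e⟩, hi⟩⟩
        change C.src l (α (sphere.mk i e hi)) =
          (towerAt (D := C.toNCat) α _ _ ((sphere hm).src l (sphere.mk i e hi)) l).1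
        rcases Nat.lt_or_ge j i with hij | hij
        · obtain rfl : i = j + 1 := by
            change i ≤ j + 1 at hi
            omega
          rw [top]
          rcases Nat.lt_or_ge j l with hl | hl
          · rw [sphere.src_mk_of_le _ hl]
            rcases Nat.eq_or_lt_of_le hl with rfl | hl
            · rw [T1]
            · obtain ⟨l, rfl⟩ := Nat.exists_eq_add_of_le hl
              rw [T2, C.src_eq_of_le hψ hl]
          · rw [sphere.src_mk _ (Nat.lt_succ_of_le hl), low _ l _ hl]
            have := κ.isBdry.src l x
            have ex : K.src l x = τ (sphere.mk l false (hl.trans (Nat.le_succ j))) := rfl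
            rw [ex] at this
            rw [← this]
            rcases hl.eq_or_lt with rfl | hl
            · exact ψs
            · rw [← C.src_src ψ hl, ψs, C.src_src _ hl]
        · rw [ατ i e hij, κ.isBdry.src, ← τsrc l i e hij]
          rcases lt_or_ge l i with hl | hl
          · rw [sphere.src_mk _ hl, low _ l _ (hl.le.trans hij)]
          · rw [sphere.src_mk_of_le _ hl, low _ _ _ hij]
      · rintro l ⟨⟨⟨i, e⟩, hi⟩⟩
        change C.tgt l (α (sphere.mk i e hi)) =
          (towerAt (D := C.toNCat) α _ _ ((sphere hm).tgt l (sphere.mk i e hi)) l).2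
        rcases Nat.lt_or_ge j i with hij | hij
        · obtain rfl : i = j + 1 := by
            change i ≤ j + 1 at hi
            omega
          rw [top]
          rcases Nat.lt_or_ge j l with hl | hl
          · rw [sphere.tgt_mk_of_le _ hl]
            rcases Nat.eq_or_lt_of_le hl with rfl | hl
            · rw [T1]
            · obtain ⟨l, rfl⟩ := Nat.exists_eq_add_of_le hl
              rw [T2, C.tgt_eq_of_le hψ hl]
          · rw [sphere.tgt_mk _ (Nat.lt_succ_of_le hl), low _ l _ hl]
            have := κ.isBdry.tgt l y
            have ey : K.tgt l y = τ (sphere.mk l true (hl.trans (Nat.le_succ j))) := rfl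
            rw [ey] at this
            rw [← this]
            rcases hl.eq_or_lt with rfl | hl
            · exact ψt
            · rw [← C.tgt_tgt ψ hl, ψt, C.tgt_tgt _ hl]
        · rw [ατ i e hij, κ.isBdry.tgt, ← τtgt l i e hij]
          rcases lt_or_ge l i with hl | hl
          · rw [sphere.tgt_mk _ hl, low _ l _ (hl.le.trans hij)]
          · rw [sphere.tgt_mk_of_le _ hl, low _ _ _ hij]
    obtain ⟨L, hL1, hL2⟩ := hK.exists_sphere hm hα
    have ext : ∀ (e : Bool) (z : K.Cell), τ (sphere.mk j e (Nat.le_succ j)) = z →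
        L.map (sphere.mk j e (Nat.le_succ j)) = z := by
      rintro e _ rfl
      refine hK.cell_ext ?_ (fun i => ?_) (fun i => ?_)
      · rw [hL1]
        exact Sτ j e le_rfl
      · rw [← L.map_src, hL2, αsrc i j e le_rfl]
      · rw [← L.map_tgt, hL2, αtgt i j e le_rfl]
    refine ⟨L.map (sphere.mk (j + 1) false le_rfl), ?_, ?_, ?_, ?_, ?_⟩
    · rw [← L.map_src, sphere.src_mk_of_le _ le_rfl]
    · rw [← L.map_src, sphere.src_mk _ (Nat.lt_succ_self j)]
      exact ext false x hτx
    · rw [← L.map_tgt, sphere.tgt_mk _ (Nat.lt_succ_self j)]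
      exact ext true y hτy
    · rw [hL1]
      exact Stop false
    · rw [hL2, top]
  · -- in dimensions above `n` all cells are identities, and the hypotheses say that `x = y`
    have hj1 : n ≤ j + 1 := hjn.trans (Nat.le_succ j)
    rw [C.src_of_le hj1, C.comp_of_le hjn] at hψs
    rw [C.tgt_of_le hj1] at hψt
    rw [C.tgt_of_le hjn, C.src_of_le hjn] at c2
    rw [c2, C.comp_of_le hjn] at hψt
    rw [B.src_of_le hjn] at hbs
    rw [B.tgt_of_le hjn] at hbt
    have exy : x = y := by
      refine hK.cell_ext (hbs.symm.trans hbt) (fun i => ?_) (fun i => ?_)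
      · rcases lt_or_ge i j with hi | hi
        · rw [hs i hi]
        · rw [K.src_eq_of_le hx hi, K.src_eq_of_le hy hi, ← hψs, ← hψt]
      · rcases lt_or_ge i j with hi | hi
        · rw [ht i hi]
        · rw [K.tgt_eq_of_le hx hi, K.tgt_eq_of_le hy hi, ← hψs, ← hψt]
    subst exy
    exact ⟨x, K.src_eq_of_le hx (Nat.le_succ j), hx, K.tgt_eq_of_le hx le_rfl, hbs.symm, hψs.symm⟩

end Kernel

/-! ### Quotients of `n`-categories -/

/-- An equivalence relation on the cells of an `n`-category that is compatible with the operations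
and such that cells that are composable up to the relation have composable representatives; below
dimension `n - 1` such cells are composable themselves, so that the interchange law passes to the
quotient. -/
structure IsCongruence {n : ℕ} (P : NCat.{u} n) (r : Setoid P.Cell) : Prop where
  src : ∀ (k : ℕ) {x y : P.Cell}, r x y → r (P.src k x) (P.src k y)
  tgt : ∀ (k : ℕ) {x y : P.Cell}, r x y → r (P.tgt k x) (P.tgt k y)
  comp : ∀ {k : ℕ} {x x' y y' : P.Cell}, P.tgt k x = P.src k y → P.tgt k x' = P.src k y' →
    r x x' → r y y' → r (P.comp k x y) (P.comp k x' y')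
  lift : ∀ {k : ℕ} {x y : P.Cell}, r (P.tgt k x) (P.src k y) → ∃ y', r y' y ∧
    P.tgt k x = P.src k y'
  low : ∀ {k : ℕ} {x y : P.Cell}, k + 1 < n → r (P.tgt k x) (P.src k y) → P.tgt k x = P.src k y

namespace IsCongruence

variable {n : ℕ} {P : NCat.{u} n} {r : Setoid P.Cell} (hr : IsCongruence P r)

/-- The source of a class. -/
def qsrc (k : ℕ) : Quotient r → Quotient r := Quotient.map (P.src k) fun _ _ h => hr.src k h

/-- The target of a class. -/
def qtgt (k : ℕ) : Quotient r → Quotient r := Quotient.map (P.tgt k) fun _ _ h => hr.tgt k h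

open Classical in
/-- The composite of two classes, by means of composable representatives. -/
noncomputable def qcomp (_ : IsCongruence P r) (k : ℕ) (X Y : Quotient r) : Quotient r :=
  if h : ∃ p : P.Cell × P.Cell, Quotient.mk r p.1 = X ∧ Quotient.mk r p.2 = Y ∧
    P.tgt k p.1 = P.src k p.2 then Quotient.mk r (P.comp k h.choose.1 h.choose.2) else X

theorem qcomp_mk {k : ℕ} {x y : P.Cell} (h : P.tgt k x = P.src k y) :
    hr.qcomp k (Quotient.mk r x) (Quotient.mk r y) = Quotient.mk r (P.comp k x y) := by
  have H : ∃ p : P.Cell × P.Cell, Quotient.mk r p.1 = Quotient.mk r x ∧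
    Quotient.mk r p.2 = Quotient.mk r y ∧ P.tgt k p.1 = P.src k p.2 := ⟨(x, y), rfl, rfl, h⟩
  rw [qcomp, dif_pos H]
  exact Quotient.sound (hr.comp H.choose_spec.2.2 h (Quotient.exact H.choose_spec.1)
    (Quotient.exact H.choose_spec.2.1))

/-- The second of two classes that are composable up to the relation has a representative that is
composable with a given one of the first. -/
theorem exists_rep {k : ℕ} {x : P.Cell} {Y : Quotient r}
    (h : hr.qtgt k (Quotient.mk r x) = hr.qsrc k Y) :
    ∃ y, Y = Quotient.mk r y ∧ P.tgt k x = P.src k y := by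
  induction Y using Quotient.inductionOn with
  | h y =>
    obtain ⟨y', h1, h2⟩ := hr.lift (Quotient.exact h)
    exact ⟨y', (Quotient.sound h1).symm, h2⟩

/-- The quotient `n`-category. -/
noncomputable def quotient : NCat.{u} n where
  Cell := Quotient r
  src := hr.qsrc
  tgt := hr.qtgt
  comp := hr.qcomp
  src_src X h := Quotient.inductionOn X fun x => congrArg (Quotient.mk r) (P.src_src x h)
  src_tgt X h := Quotient.inductionOn X fun x => congrArg (Quotient.mk r) (P.src_tgt x h)
  tgt_src X h := Quotient.inductionOn X fun x => congrArg (Quotient.mk r) (P.tgt_src x h)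
  tgt_tgt X h := Quotient.inductionOn X fun x => congrArg (Quotient.mk r) (P.tgt_tgt x h)
  src_src_of_le X h := Quotient.inductionOn X fun x =>
    congrArg (Quotient.mk r) (P.src_src_of_le x h)
  src_tgt_of_le X h := Quotient.inductionOn X fun x =>
    congrArg (Quotient.mk r) (P.src_tgt_of_le x h)
  tgt_src_of_le X h := Quotient.inductionOn X fun x =>
    congrArg (Quotient.mk r) (P.tgt_src_of_le x h)
  tgt_tgt_of_le X h := Quotient.inductionOn X fun x =>
    congrArg (Quotient.mk r) (P.tgt_tgt_of_le x h)
  src_dim X := Quotient.inductionOn X fun x => congrArg (Quotient.mk r) (P.src_dim x)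
  src_comp_self {k X Y} h := by
    obtain ⟨x, rfl⟩ := Quotient.exists_rep X
    obtain ⟨y, rfl, e⟩ := hr.exists_rep h
    rw [hr.qcomp_mk e]
    exact congrArg (Quotient.mk r) (P.src_comp_self e)
  tgt_comp_self {k X Y} h := by
    obtain ⟨x, rfl⟩ := Quotient.exists_rep X
    obtain ⟨y, rfl, e⟩ := hr.exists_rep h
    rw [hr.qcomp_mk e]
    exact congrArg (Quotient.mk r) (P.tgt_comp_self e)
  src_comp {j k X Y} hj h := by
    obtain ⟨x, rfl⟩ := Quotient.exists_rep X
    obtain ⟨y, rfl, e⟩ := hr.exists_rep h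
    rw [hr.qcomp_mk e]
    exact (congrArg (Quotient.mk r) (P.src_comp hj e)).trans
      (hr.qcomp_mk ((P.composable_src hj x y).2 e)).symm
  tgt_comp {j k X Y} hj h := by
    obtain ⟨x, rfl⟩ := Quotient.exists_rep X
    obtain ⟨y, rfl, e⟩ := hr.exists_rep h
    rw [hr.qcomp_mk e]
    exact (congrArg (Quotient.mk r) (P.tgt_comp hj e)).trans
      (hr.qcomp_mk ((P.composable_tgt hj x y).2 e)).symm
  id_comp k X := Quotient.inductionOn X fun x =>
    (hr.qcomp_mk (P.tgt_src_of_le x le_rfl)).trans (congrArg (Quotient.mk r) (P.id_comp k x))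
  comp_id k X := Quotient.inductionOn X fun x =>
    (hr.qcomp_mk (P.src_tgt_of_le x le_rfl).symm).trans (congrArg (Quotient.mk r) (P.comp_id k x))
  assoc {k X Y Z} h h' := by
    obtain ⟨x, rfl⟩ := Quotient.exists_rep X
    obtain ⟨y, rfl, e⟩ := hr.exists_rep h
    obtain ⟨z, rfl, e'⟩ := hr.exists_rep h'
    rw [hr.qcomp_mk e, hr.qcomp_mk e', hr.qcomp_mk (by rw [P.tgt_comp_self e, e']),
      hr.qcomp_mk (by rw [P.src_self_comp, e]), P.assoc e e']
  interchange {p q X X' Y Y'} hpq h1 h2 h3 := by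
    obtain ⟨x, rfl⟩ := Quotient.exists_rep X
    obtain ⟨y, rfl⟩ := Quotient.exists_rep Y
    obtain ⟨x', rfl, e1⟩ := hr.exists_rep h1
    obtain ⟨y', rfl, e2⟩ := hr.exists_rep h2
    rcases lt_or_ge q n with hq | hq
    · have e3 : P.tgt p x = P.src p y := hr.low (by omega) (Quotient.exact h3)
      have e4 : P.tgt p x' = P.src p y' := by
        rw [← P.tgt_src x' hpq, ← e1, P.tgt_tgt x hpq, ← P.src_src y' hpq, ← e2, P.src_tgt y hpq,
          e3]
      rw [hr.qcomp_mk e1, hr.qcomp_mk e2, hr.qcomp_mk e3, hr.qcomp_mk e4,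
        hr.qcomp_mk (by rw [← P.tgt_src _ hpq, P.src_self_comp, ← P.src_src (P.comp q y y') hpq,
          P.src_self_comp, P.tgt_src _ hpq, P.src_src _ hpq, e3]),
        hr.qcomp_mk (by rw [P.tgt_comp' hpq, P.src_comp' hpq, e1, e2]), P.interchange hpq e1 e2 e3]
    · rw [P.tgt_of_le hq, P.src_of_le hq] at e1 e2
      subst e1 e2
      rw [hr.qcomp_mk (P.tgt_of_le hq x |>.trans (P.src_of_le hq x).symm),
        hr.qcomp_mk (P.tgt_of_le hq y |>.trans (P.src_of_le hq y).symm), P.comp_of_le hq,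
        P.comp_of_le hq]
      obtain ⟨z, hz⟩ := Quotient.exists_rep (hr.qcomp p (Quotient.mk r x) (Quotient.mk r y))
      rw [← hz, hr.qcomp_mk (P.tgt_of_le hq z |>.trans (P.src_of_le hq z).symm), P.comp_of_le hq]
  comp_of_ne {k X Y} h := by
    refine dif_neg ?_
    rintro ⟨p, rfl, rfl, e⟩
    exact h (congrArg (Quotient.mk r) e)

theorem comp_mk {k : ℕ} {x y : P.Cell} (h : P.tgt k x = P.src k y) :
    hr.quotient.comp k (Quotient.mk r x) (Quotient.mk r y) = Quotient.mk r (P.comp k x y) :=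
  hr.qcomp_mk h

end IsCongruence

/-! ### The data of a cell over the base point and a functor -/

section ConeData

variable {n : ℕ} {B C : PtGpd.{u} n} {G : PtFunctor B C}
  {X Y : NCat.{u} n} {S : NFunctor X B.toNCat} {S' : NFunctor Y B.toNCat}
  {lam : LaxTrans (zero X C) (S.comp G.toNFunctor)}
  {lam' : LaxTrans (zero Y C) (S'.comp G.toNFunctor)}

/-- The image of a cell `x` in `B` and the components at the sources and targets of `x`. These data
determine the cell of the `h`-kernel of `G` that `x` is sent to. -/
def coneData (lam : LaxTrans (zero X C) (S.comp G.toNFunctor)) (x : X.Cell) :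
    B.Cell × (ℕ → C.Cell) × (ℕ → C.Cell) :=
  (S.map x, fun j => lam.app (X.src j x), fun j => lam.app (X.tgt j x))

theorem coneData_eq_iff {x : X.Cell} {y : Y.Cell} : coneData lam x = coneData lam' y ↔
    S.map x = S'.map y ∧ (∀ j, lam.app (X.src j x) = lam'.app (Y.src j y)) ∧
      ∀ j, lam.app (X.tgt j x) = lam'.app (Y.tgt j y) := by
  simp only [coneData, Prod.mk.injEq, funext_iff]

theorem coneData_src {x : X.Cell} {y : Y.Cell} (h : coneData lam x = coneData lam' y) (k : ℕ) :
    coneData lam (X.src k x) = coneData lam' (Y.src k y) := by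
  obtain ⟨h1, h2, h3⟩ := coneData_eq_iff.1 h
  refine coneData_eq_iff.2 ⟨by rw [S.map_src, S'.map_src, h1], fun j => ?_, fun j => ?_⟩
  · rcases lt_or_ge j k with hj | hj
    · rw [X.src_src _ hj, Y.src_src _ hj, h2]
    · rw [X.src_src_of_le _ hj, Y.src_src_of_le _ hj, h2]
  · rcases lt_or_ge j k with hj | hj
    · rw [X.tgt_src _ hj, Y.tgt_src _ hj, h3]
    · rw [X.tgt_src_of_le _ hj, Y.tgt_src_of_le _ hj, h2]

theorem coneData_tgt {x : X.Cell} {y : Y.Cell} (h : coneData lam x = coneData lam' y) (k : ℕ) :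
    coneData lam (X.tgt k x) = coneData lam' (Y.tgt k y) := by
  obtain ⟨h1, h2, h3⟩ := coneData_eq_iff.1 h
  refine coneData_eq_iff.2 ⟨by rw [S.map_tgt, S'.map_tgt, h1], fun j => ?_, fun j => ?_⟩
  · rcases lt_or_ge j k with hj | hj
    · rw [X.src_tgt _ hj, Y.src_tgt _ hj, h2]
    · rw [X.src_tgt_of_le _ hj, Y.src_tgt_of_le _ hj, h3]
  · rcases lt_or_ge j k with hj | hj
    · rw [X.tgt_tgt _ hj, Y.tgt_tgt _ hj, h3]
    · rw [X.tgt_tgt_of_le _ hj, Y.tgt_tgt_of_le _ hj, h3]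

theorem app_eq_of_coneData {x : X.Cell} {y : Y.Cell} (h : coneData lam x = coneData lam' y) :
    lam.app x = lam'.app y := by
  have := (coneData_eq_iff.1 h).2.1 n
  rwa [X.src_dim, Y.src_dim] at this

theorem towerAt_eq_of_coneData {x : X.Cell} {y : Y.Cell} (h : coneData lam x = coneData lam' y)
    (k : ℕ) : towerAt lam.app (zero X C).map (S.comp G.toNFunctor).map x k =
      towerAt lam'.app (zero Y C).map (S'.comp G.toNFunctor).map y k := by
  obtain ⟨h1, h2, h3⟩ := coneData_eq_iff.1 h
  refine (tower_congr k (fun j _ => h2 j) (fun j _ => h3 j)).trans ?_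
  change tower _ _ _ _ (G.map (S.map x)) k = tower _ _ _ _ (G.map (S'.map y)) k
  rw [h1]
  rfl

theorem app_comp_eq_of_coneData {x x' : X.Cell} {y y' : Y.Cell} {k : ℕ}
    (hx : X.tgt k x = X.src k x') (hy : Y.tgt k y = Y.src k y')
    (h : coneData lam x = coneData lam' y) (h' : coneData lam x' = coneData lam' y') :
    lam.app (X.comp k x x') = lam'.app (Y.comp k y y') := by
  rcases lt_or_ge k n with hk | hk
  · obtain ⟨m, hm⟩ : ∃ m, k + m + 1 = n := ⟨n - k - 1, by omega⟩
    rw [((isLaxTrans_iff _ _ _).1 lam.isLaxTrans).2 k m hm x x' hx,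
      ((isLaxTrans_iff _ _ _).1 lam'.isLaxTrans).2 k m hm y y' hy]
    refine vcomp_rel _ (fun p q => coneData lam p.1 = coneData lam' q.1 ∧
      coneData lam p.2 = coneData lam' q.2) m (k + 1)
      (fun l _ p q h => ⟨coneData_src h.1 l, coneData_src h.2 l⟩)
      (fun l _ p q h => ⟨coneData_tgt h.1 l, coneData_tgt h.2 l⟩)
      (fun p q h => ?_) (fun p q h => ?_) _ _ ⟨h, h'⟩
    · rw [app_eq_of_coneData h.1, towerAt_eq_of_coneData h.2]
    · rw [app_eq_of_coneData h.2, towerAt_eq_of_coneData h.1]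
  · rw [X.comp_of_le hk, Y.comp_of_le hk]
    exact app_eq_of_coneData h

theorem coneData_comp {x x' : X.Cell} {y y' : Y.Cell} {k : ℕ}
    (hx : X.tgt k x = X.src k x') (hy : Y.tgt k y = Y.src k y')
    (h : coneData lam x = coneData lam' y) (h' : coneData lam x' = coneData lam' y') :
    coneData lam (X.comp k x x') = coneData lam' (Y.comp k y y') := by
  refine coneData_eq_iff.2 ⟨?_, fun j => ?_, fun j => ?_⟩
  · rw [S.map_comp _ _ _ hx, S'.map_comp _ _ _ hy, (coneData_eq_iff.1 h).1,
      (coneData_eq_iff.1 h').1]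
  · rcases lt_trichotomy j k with hj | rfl | hj
    · rw [← X.src_src _ hj, X.src_self_comp, ← Y.src_src _ hj, Y.src_self_comp]
      exact app_eq_of_coneData (coneData_src (coneData_src h k) j)
    · rw [X.src_self_comp, Y.src_self_comp]
      exact app_eq_of_coneData (coneData_src h j)
    · rw [X.src_comp' hj, Y.src_comp' hj]
      exact app_comp_eq_of_coneData ((X.composable_src hj _ _).2 hx)
        ((Y.composable_src hj _ _).2 hy)
        (coneData_src h j) (coneData_src h' j)
  · rcases lt_trichotomy j k with hj | rfl | hj
    · rw [← X.tgt_src _ hj, X.src_self_comp, ← Y.tgt_src _ hj, Y.src_self_comp]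
      exact app_eq_of_coneData (coneData_tgt (coneData_src h k) j)
    · rw [X.tgt_comp_self hx, Y.tgt_comp_self hy]
      exact app_eq_of_coneData (coneData_tgt h' j)
    · rw [X.tgt_comp' hj, Y.tgt_comp' hj]
      exact app_comp_eq_of_coneData ((X.composable_tgt hj _ _).2 hx)
        ((Y.composable_tgt hj _ _).2 hy)
        (coneData_tgt h j) (coneData_tgt h' j)

/-- A cone all of whose cells have representatives for composability, and whose data exhaust the
data of all cones, has the `h`-kernel as its quotient by equality of data. -/
theorem exists_isHKernel
    (hlift : ∀ {k : ℕ} {x y : X.Cell}, coneData lam (X.tgt k x) = coneData lam (X.src k y) →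
      ∃ y', coneData lam y' = coneData lam y ∧ X.tgt k x = X.src k y')
    (hlow : ∀ {k : ℕ} {x y : X.Cell}, k + 1 < n →
      coneData lam (X.tgt k x) = coneData lam (X.src k y) → X.tgt k x = X.src k y)
    (hex : ∀ {Y : NCat.{u} n} {S' : NFunctor Y B.toNCat}
      (lam' : LaxTrans (zero Y C) (S'.comp G.toNFunctor)) (y : Y.Cell),
      ∃ x, coneData lam x = coneData lam' y) :
    ∃ (K : NCat.{u} n) (k : NFunctor K B.toNCat) (κ : LaxTrans (zero K C) (k.comp G.toNFunctor)),
      IsHKernel G K k κ := by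
  have hr : IsCongruence X (Setoid.ker (coneData lam)) :=
    { src := fun k _ _ h => coneData_src h k
      tgt := fun k _ _ h => coneData_tgt h k
      comp := fun h1 h2 h3 h4 => coneData_comp h1 h2 h3 h4
      lift := hlift
      low := hlow }
  let r := Setoid.ker (coneData lam)
  let K := hr.quotient
  let k : NFunctor K B.toNCat :=
    { map := Quotient.lift S.map fun _ _ h => (coneData_eq_iff.1 h).1
      map_src := fun j Z => Quotient.inductionOn Z fun z => S.map_src j z
      map_tgt := fun j Z => Quotient.inductionOn Z fun z => S.map_tgt j z
      map_comp := fun j Z W h => by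
        obtain ⟨z, rfl⟩ := Quotient.exists_rep Z
        obtain ⟨w, rfl, e⟩ := hr.exists_rep h
        exact (congrArg (Quotient.lift S.map _) (hr.comp_mk e)).trans (S.map_comp j z w e) }
  let κ : K.Cell → C.Cell := Quotient.lift lam.app fun _ _ h => app_eq_of_coneData h
  have htow : ∀ z l, towerAt (C := K) (D := C.toNCat) κ (zero K C).map
      (k.comp G.toNFunctor).map (Quotient.mk r z) l =
      towerAt lam.app (zero X C).map (S.comp G.toNFunctor).map z l := fun z l => rfl
  have hlax := (isLaxTrans_iff _ _ _).1 lam.isLaxTrans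
  have hκ : IsLaxTrans K C.toNCat κ n 0 (zero K C).map (k.comp G.toNFunctor).map := by
    refine (isLaxTrans_iff _ _ _).2 ⟨⟨fun l Z => ?_, fun l Z => ?_⟩, fun l m hm Z W h => ?_⟩
    · exact Quotient.inductionOn Z fun z => hlax.1.src l z
    · exact Quotient.inductionOn Z fun z => hlax.1.tgt l z
    · obtain ⟨z, rfl⟩ := Quotient.exists_rep Z
      obtain ⟨w, rfl, e⟩ := hr.exists_rep h
      refine ((congrArg κ (hr.comp_mk e)).trans (hlax.2 l m hm z w e)).trans ?_
      refine vcomp_rel _ (fun p q => Quotient.mk r p.1 = q.1 ∧ Quotient.mk r p.2 = q.2) m (l + 1)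
        ?_ ?_ ?_ ?_ _ _ ⟨rfl, rfl⟩
      · rintro i - p ⟨_, _⟩ ⟨rfl, rfl⟩
        exact ⟨rfl, rfl⟩
      · rintro i - p ⟨_, _⟩ ⟨rfl, rfl⟩
        exact ⟨rfl, rfl⟩
      · rintro p ⟨_, _⟩ ⟨rfl, rfl⟩
        rfl
      · rintro p ⟨_, _⟩ ⟨rfl, rfl⟩
        rfl
  refine ⟨K, k, ⟨κ, hκ⟩, fun Y rY S' lam' => ?_⟩
  obtain rfl : rY = NFunctor.toTerminal Y := rfl
  change LaxTrans (zero Y C) _ at lam'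
  choose f hf using hex lam'
  let L : NFunctor Y K :=
    { map := fun y => Quotient.mk r (f y)
      map_src := fun j y => Quotient.sound ((hf _).trans (coneData_src (hf y) j).symm)
      map_tgt := fun j y => Quotient.sound ((hf _).trans (coneData_tgt (hf y) j).symm)
      map_comp := fun j y z h => by
        have h1 : hr.qtgt j (Quotient.mk r (f y)) = hr.qsrc j (Quotient.mk r (f z)) :=
          Quotient.sound ((coneData_tgt (hf y) j).trans
            ((congrArg (coneData lam') h).trans (coneData_src (hf z) j).symm))
        obtain ⟨w, hw, e⟩ := hr.exists_rep h1
        rw [hw]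
        refine Eq.trans (Quotient.sound ?_) (hr.comp_mk e).symm
        have hw' : coneData lam (f z) = coneData lam w := Quotient.exact hw
        exact (hf _).trans (coneData_comp e h (hf y) (hw'.symm.trans (hf z))).symm }
  refine ⟨L, ⟨rfl, NFunctor.ext (funext fun y => (coneData_eq_iff.1 (hf y)).1), fun y =>
    app_eq_of_coneData (hf y)⟩, ?_⟩
  rintro L' ⟨-, h2, h3⟩
  refine NFunctor.ext (funext fun y => ?_)
  obtain ⟨z, hz⟩ := Quotient.exists_rep (L'.map y)
  rw [← hz]
  refine Quotient.sound ?_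
  refine Eq.trans ?_ (hf y).symm
  refine coneData_eq_iff.2 ⟨?_, fun j => ?_, fun j => ?_⟩
  · have := congrArg (fun M => NFunctor.map M y) h2
    change k.map (L'.map y) = S'.map y at this
    rw [← hz] at this
    exact this
  · rw [← h3, L'.map_src, ← hz]
    rfl
  · rw [← h3, L'.map_tgt, ← hz]
    rfl

end ConeData

/-! ### Lifting cells from `π₀` -/

section PiZero

variable {n : ℕ}

theorem src_toPi {C : NCat.{u} (n + 1)} (i : ℕ) (x : C.Cell) :
    C.piZero.src i (C.toPi x) = C.toPi (C.src i x) := by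
  rcases lt_trichotomy i n with hi | rfl | hi
  · exact NCat.toPi_src hi x
  · rw [NCat.toPi_src_dim, NCat.src_dim]
  · rw [C.src_of_le hi, NCat.src_of_le _ hi.le]

/-- A cell of `π₀ C` lifts to a cell of `C` with prescribed boundary. -/
theorem exists_lift_toPi {C : NCat.{u} (n + 1)} {j : ℕ} (hj : j ≤ n) {a a' : C.Cell}
    (ha : C.src j a = a) (ha' : C.src j a' = a') {W : C.piZero.Cell}
    (hW : C.piZero.src (j + 1) W = W) (hs : C.piZero.src j W = C.toPi a)
    (ht : C.piZero.tgt j W = C.toPi a') :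
    ∃ ψ, C.toPi ψ = W ∧ C.src (j + 1) ψ = ψ ∧ C.src j ψ = a ∧ C.tgt j ψ = a' := by
  rcases hj.eq_or_lt with rfl | hj
  · rw [NCat.src_dim] at hs
    rw [NCat.tgt_dim] at ht
    obtain ⟨w, -, h1, h2, -⟩ := NCat.iso_of_toPi_eq (hs.symm.trans ht) ha ha'
    exact ⟨w, by rw [hs, ← h1, NCat.toPi_src_dim], C.src_dim w, h1, h2⟩
  · obtain ⟨w, -, rfl⟩ := NCat.exists_toPi W
    rw [src_toPi] at hW hs
    rw [NCat.toPi_tgt hj] at ht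
    refine ⟨C.src (j + 1) w, hW, C.src_src_of_le _ le_rfl, ?_, ?_⟩
    · rw [C.src_src _ (Nat.lt_succ_self j)]
      exact NCat.eq_of_toPi_eq hj hs (C.src_src_of_le _ le_rfl) ha
    · rw [C.tgt_src _ (Nat.lt_succ_self j)]
      exact NCat.eq_of_toPi_eq hj ht (C.src_tgt_of_le _ le_rfl) ha'

theorem toPi_tower {C : NCat.{u} (n + 1)} {s t : ℕ → C.Cell} {s' t' : ℕ → C.piZero.Cell}
    {p d : C.Cell} : ∀ k ≤ n, (∀ i < k, s' i = C.toPi (s i)) → (∀ i < k, t' i = C.toPi (t i)) →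
    tower C.piZero s' t' (C.toPi p) (C.toPi d) k =
      (C.toPi (tower C s t p d k).1, C.toPi (tower C s t p d k).2)
  | 0, _, _, _ => rfl
  | k + 1, hk, hs, ht => by
    have ih := toPi_tower (p := p) (d := d) k (Nat.le_of_succ_le hk)
      (fun i hi => hs i (hi.trans (Nat.lt_succ_self k)))
      (fun i hi => ht i (hi.trans (Nat.lt_succ_self k)))
    simp only [tower, ih, hs k (Nat.lt_succ_self k), ht k (Nat.lt_succ_self k)]
    rw [NCat.toPi_comp hk, NCat.toPi_comp hk]

end PiZero

section PiKernel

variable {n : ℕ} {B C : PtGpd.{u} (n + 1)} {G : PtFunctor B C} {K : NCat.{u} (n + 1)}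
  {k : NFunctor K B.toNCat} {κ : LaxTrans (zero K C) (k.comp G.toNFunctor)}

theorem zero_piZero_eq (K : NCat.{u} (n + 1)) (C : PtGpd.{u} (n + 1)) :
    (zero K C).piZero = zero K.piZero C.piZero := by
  refine NFunctor.ext (funext fun X => ?_)
  obtain ⟨x, -, rfl⟩ := NCat.exists_toPi X
  exact NFunctor.piZero_toPi _ x

/-- `π₀` of a functor to a pointed groupoid, as a functor to the pointed groupoid `π₀ B`. -/
def NFunctor.piZeroTo (k : NFunctor K B.toNCat) : NFunctor K.piZero B.piZero.toNCat := k.piZero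

theorem NFunctor.piZeroTo_toPi (k : NFunctor K B.toNCat) (x : K.Cell) :
    k.piZeroTo.map (K.toPi x) = B.toNCat.toPi (k.map x) := k.piZero_toPi x

/-- `π₀` of a lax transformation from `0` to a composite. -/
def LaxTrans.piCone (κ : LaxTrans (zero K C) (k.comp G.toNFunctor)) :
    LaxTrans (zero K.piZero C.piZero) (k.piZeroTo.comp G.piZero.toNFunctor) :=
  (κ.piZero C.isGroupoid).cast (zero_piZero_eq K C) (NFunctor.piZero_comp k G.toNFunctor)

theorem LaxTrans.piCone_toPi (κ : LaxTrans (zero K C) (k.comp G.toNFunctor)) {x : K.Cell}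
    (hx : K.src n x = x) : κ.piCone.app (K.toPi x) = C.toNCat.toPi (κ.app x) :=
  κ.piZeroApp_toPi C.isGroupoid hx

theorem src_of_src_dim {z : K.Cell} (hz : K.src n z = z) (j : ℕ) :
    K.src n (K.src j z) = K.src j z := by
  rcases le_or_gt j n with hj | hj
  · exact K.src_src_of_le z hj
  · rw [K.src_eq_of_le hz hj.le, hz]

theorem src_tgt_of_src_dim {z : K.Cell} (hz : K.src n z = z) (j : ℕ) :
    K.src n (K.tgt j z) = K.tgt j z := by
  rcases le_or_gt j n with hj | hj
  · exact K.src_tgt_of_le z hj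
  · rw [K.tgt_eq_of_le hz hj.le, hz]

theorem tgt_toPi {z : K.Cell} (hz : K.src n z = z) (i : ℕ) :
    K.piZero.tgt i (K.toPi z) = K.toPi (K.tgt i z) := by
  rcases lt_or_ge i n with hi | hi
  · exact NCat.toPi_tgt hi z
  · rw [K.tgt_eq_of_le hz hi, NCat.tgt_of_le _ hi]

theorem coneData_toPi_iff {X : NCat.{u} n} {S : NFunctor X B.piZero.toNCat}
    {lam : LaxTrans (zero X C.piZero) (S.comp G.piZero.toNFunctor)} {x : X.Cell} {z : K.Cell}
    (hz : K.src n z = z) : coneData lam x = coneData κ.piCone (K.toPi z) ↔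
    S.map x = B.toNCat.toPi (k.map z) ∧
      (∀ j, lam.app (X.src j x) = C.toNCat.toPi (κ.app (K.src j z))) ∧
      ∀ j, lam.app (X.tgt j x) = C.toNCat.toPi (κ.app (K.tgt j z)) := by
  rw [coneData_eq_iff]
  refine and_congr ?_ (and_congr (forall_congr' fun j => ?_) (forall_congr' fun j => ?_))
  · rw [k.piZeroTo_toPi]
  · rw [src_toPi, κ.piCone_toPi (src_of_src_dim hz j)]
  · rw [tgt_toPi hz, κ.piCone_toPi (src_tgt_of_src_dim hz j)]

theorem coneData_toPi_eq_iff {K' : NCat.{u} (n + 1)} {k' : NFunctor K' B.toNCat}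
    {κ' : LaxTrans (zero K' C) (k'.comp G.toNFunctor)} {y : K'.Cell} {z : K.Cell}
    (hy : K'.src n y = y) (hz : K.src n z = z) :
    coneData κ'.piCone (K'.toPi y) = coneData κ.piCone (K.toPi z) ↔
    B.toNCat.toPi (k'.map y) = B.toNCat.toPi (k.map z) ∧
      (∀ j, C.toNCat.toPi (κ'.app (K'.src j y)) = C.toNCat.toPi (κ.app (K.src j z))) ∧
      ∀ j, C.toNCat.toPi (κ'.app (K'.tgt j y)) = C.toNCat.toPi (κ.app (K.tgt j z)) := by
  rw [coneData_toPi_iff hz, k'.piZeroTo_toPi]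
  refine and_congr Iff.rfl (and_congr (forall_congr' fun j => ?_) (forall_congr' fun j => ?_))
  · rw [src_toPi, κ'.piCone_toPi (src_of_src_dim hy j)]; exact Iff.rfl
  · rw [tgt_toPi hy, κ'.piCone_toPi (src_tgt_of_src_dim hy j)]; exact Iff.rfl

/-- Below dimension `n - 1`, a cell of the kernel is determined by its data in `π₀`, since `π₀`
does not change cells of dimension less than `n`. -/
theorem IsHKernel.eq_of_coneData (hK : IsHKernel G K k κ) {j : ℕ} (hj : j + 1 < n) {z z' : K.Cell}
    (hz : K.src j z = z) (hz' : K.src j z' = z')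
    (h : coneData κ.piCone (K.toPi z) = coneData κ.piCone (K.toPi z')) : z = z' := by
  have hjn : j ≤ n := by omega
  obtain ⟨h1, h2, h3⟩ := (coneData_toPi_eq_iff (K.src_eq_of_le hz hjn) (K.src_eq_of_le hz' hjn)).1 h
  have dim : ∀ {c : K.Cell}, K.src j c = c → C.src (j + 1) (κ.app c) = κ.app c :=
    fun hc => κ.isBdry.dim hc (Nat.lt_succ_self j)
  have d1 : ∀ {c : K.Cell}, K.src j c = c → ∀ i, K.src j (K.src i c) = K.src i c := by
    intro c hc i
    rcases le_or_gt i j with hi | hi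
    · exact K.src_src_of_le _ hi
    · rw [K.src_eq_of_le hc hi.le, hc]
  have d2 : ∀ {c : K.Cell}, K.src j c = c → ∀ i, K.src j (K.tgt i c) = K.tgt i c := by
    intro c hc i
    rcases le_or_gt i j with hi | hi
    · exact K.src_tgt_of_le _ hi
    · rw [K.tgt_eq_of_le hc hi.le, hc]
  refine hK.cell_ext ?_ (fun i => ?_) (fun i => ?_)
  · exact NCat.eq_of_toPi_eq (Nat.lt_of_succ_lt hj) h1 (by rw [← k.map_src, hz])
      (by rw [← k.map_src, hz'])
  · exact NCat.eq_of_toPi_eq hj (h2 i) (dim (d1 hz i)) (dim (d1 hz' i))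
  · exact NCat.eq_of_toPi_eq hj (h3 i) (dim (d2 hz i)) (dim (d2 hz' i))

section Lift

variable {X : NCat.{u} n} {S : NFunctor X B.piZero.toNCat}
  (lam : LaxTrans (zero X C.piZero) (S.comp G.piZero.toNFunctor))

/-- A cell of a cone over `π₀ G` lifts to the kernel of `G`, with prescribed boundary. -/
theorem IsHKernel.exists_lift (hK : IsHKernel G K k κ) {j : ℕ} (hj : j < n) {x : X.Cell}
    (hx : X.src (j + 1) x = x) {a a' : K.Cell} (ha : K.src j a = a) (ha' : K.src j a' = a')
    (has : coneData lam (X.src j x) = coneData κ.piCone (K.toPi a))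
    (hat : coneData lam (X.tgt j x) = coneData κ.piCone (K.toPi a')) :
    ∃ z, K.src (j + 1) z = z ∧ K.src j z = a ∧ K.tgt j z = a' ∧
      coneData lam x = coneData κ.piCone (K.toPi z) := by
  have han := K.src_eq_of_le ha hj.le
  have han' := K.src_eq_of_le ha' hj.le
  obtain ⟨s1, s2, s3⟩ := (coneData_toPi_iff han).1 has
  obtain ⟨t1, t2, t3⟩ := (coneData_toPi_iff han').1 hat
  have ps : ∀ i < j, K.src i a' = K.src i a := by
    intro i hi
    refine hK.eq_of_coneData (j := i) (by omega) (K.src_src_of_le _ le_rfl)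
      (K.src_src_of_le _ le_rfl) ?_
    rw [← src_toPi, ← src_toPi, ← coneData_src hat i, ← coneData_src has i, X.src_src _ hi,
      X.src_tgt _ hi]
  have pt : ∀ i < j, K.tgt i a' = K.tgt i a := by
    intro i hi
    refine hK.eq_of_coneData (j := i) (by omega) (K.src_tgt_of_le _ le_rfl)
      (K.src_tgt_of_le _ le_rfl) ?_
    rw [← tgt_toPi han', ← tgt_toPi han, ← coneData_tgt hat i, ← coneData_tgt has i,
      X.tgt_src _ hi, X.tgt_tgt _ hi]
  obtain ⟨b, hb, hb1, hbs, hbt⟩ := exists_lift_toPi (C := B.toNCat) (j := j) hj.le (a := k.map a)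
    (a' := k.map a') (by rw [← k.map_src, ha]) (by rw [← k.map_src, ha']) (W := S.map x)
    ((S.map_src _ _).symm.trans (by rw [hx])) ((S.map_src _ _).symm.trans s1)
    ((S.map_tgt _ _).symm.trans t1)
  have hfr := κ.frame_ker (G := G) hbs hbt pt
  have low1 : ∀ i < j, lam.app (X.src i x) = C.toNCat.toPi (κ.app (K.src i a)) := by
    intro i hi
    rw [← s2 i, X.src_src _ hi]
  have low2 : ∀ i < j, lam.app (X.tgt i x) = C.toNCat.toPi (κ.app (K.tgt i a)) := by
    intro i hi
    rw [← s3 i, X.tgt_src _ hi]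
  have htow : towerAt (D := C.piZero.toNCat) lam.app (zero X C.piZero).map
      (S.comp G.piZero.toNFunctor).map x j =
      (C.toNCat.toPi (ker G (fun i => κ.app (K.src i a)) (fun i => κ.app (K.tgt i a)) b j).1,
        C.toNCat.toPi (ker G (fun i => κ.app (K.src i a)) (fun i => κ.app (K.tgt i a)) b j).2) := by
    refine Eq.trans ?_ (toPi_tower (C := C.toNCat) j hj.le low1 low2)
    change tower _ _ _ (C.toNCat.toPi C.pt) (G.toNFunctor.piZero.map (S.map x)) j = _
    rw [← hb, G.toNFunctor.piZero_toPi]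
  have gb : C.src (j + 1) (G.map b) = G.map b := by rw [← G.map_src, hb1]
  have dtow := tower_src hfr (Nat.le_succ j)
  rw [gb, C.src_eq_of_le C.src_pt (Nat.zero_le _)] at dtow
  have es := s2 j
  have et := t2 j
  rw [X.src_src_of_le _ le_rfl, ha] at es
  rw [X.src_tgt_of_le _ le_rfl, ha'] at et
  obtain ⟨ψ, hψ, hψ1, hψs, hψt⟩ := exists_lift_toPi (C := C.toNCat) (j := j + 1) hj
    (a := C.comp j (κ.app a)
      (ker G (fun i => κ.app (K.src i a)) (fun i => κ.app (K.tgt i a)) b j).2)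
    (a' := C.comp j
      (ker G (fun i => κ.app (K.src i a)) (fun i => κ.app (K.tgt i a)) b j).1 (κ.app a'))
    (by
      rw [C.src_comp' (Nat.lt_succ_self j), κ.isBdry.dim ha (Nat.lt_succ_self j)]
      exact congrArg (C.comp j _) (congrArg Prod.snd dtow).symm)
    (by
      rw [C.src_comp' (Nat.lt_succ_self j), κ.isBdry.dim ha' (Nat.lt_succ_self j)]
      exact congrArg (fun t => C.comp j t _) (congrArg Prod.fst dtow).symm)
    (W := lam.app x) (lam.isBdry.dim hx (Nat.lt_succ_self _))
    (by
      refine (lam.isBdry.src (j + 1) x).trans ?_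
      rw [hx]
      change C.piZero.comp j (lam.app (X.src j x)) (towerAt (D := C.piZero.toNCat) lam.app
        (zero X C.piZero).map (S.comp G.piZero.toNFunctor).map x j).2 = _
      rw [htow, es]
      exact NCat.toPi_comp hj _ _)
    (by
      refine (lam.isBdry.tgt (j + 1) x).trans ?_
      rw [X.tgt_eq_of_le hx le_rfl]
      change C.piZero.comp j (towerAt (D := C.piZero.toNCat) lam.app
        (zero X C.piZero).map (S.comp G.piZero.toNFunctor).map x j).1 (lam.app (X.tgt j x)) = _
      rw [htow, et]
      exact NCat.toPi_comp hj _ _)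
  obtain ⟨z, hz, hzs, hzt, hkz, hκz⟩ := hK.exists_cell ha ha' ps pt hb1 hbs hbt hψ1 hψs hψt
  refine ⟨z, hz, hzs, hzt, (coneData_toPi_iff (K.src_eq_of_le hz hj)).2 ⟨?_, fun i => ?_,
    fun i => ?_⟩⟩
  · rw [hkz, hb]
  · rcases lt_trichotomy i j with hi | rfl | hi
    · rw [low1 i hi, ← hzs, K.src_src _ hi]
    · rw [hzs, es]
    · rw [X.src_eq_of_le hx hi, K.src_eq_of_le hz hi, hκz, hψ]
  · rcases lt_trichotomy i j with hi | rfl | hi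
    · rw [low2 i hi, ← hzs, K.tgt_src _ hi]
    · rw [hzt, et]
    · rw [X.tgt_eq_of_le hx hi, K.tgt_eq_of_le hz hi, hκz, hψ]

theorem IsHKernel.exists_lift_obj (hK : IsHKernel G K k κ) {x : X.Cell} (hx : X.src 0 x = x) :
    ∃ z, K.src 0 z = z ∧ coneData lam x = coneData κ.piCone (K.toPi z) := by
  obtain ⟨b0, hb0, hSb⟩ := NCat.exists_toPi (C := B.toNCat) (S.map x)
  have hb : B.toNCat.toPi (B.src 0 b0) = S.map x := by
    rw [← src_toPi, ← hSb]
    exact (S.map_src 0 x).symm.trans (by rw [hx])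
  have hb1 : B.src 0 (B.src 0 b0) = B.src 0 b0 := B.src_src_of_le _ le_rfl
  obtain ⟨ψ, hψ, hψ1, hψs, hψt⟩ := exists_lift_toPi (C := C.toNCat) (j := 0) (Nat.zero_le n)
    (a := C.pt) (a' := G.map (B.src 0 b0)) C.src_pt (by rw [← G.map_src, hb1]) (W := lam.app x)
    (lam.isBdry.dim hx Nat.one_pos) (lam.isBdry.src 0 x)
    ((lam.isBdry.tgt 0 x).trans (by
      rw [X.tgt_eq_of_le hx le_rfl]
      change G.toNFunctor.piZero.map (S.map x) = _
      rw [← hb, G.toNFunctor.piZero_toPi]))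
  obtain ⟨z, hz, hkz, hκz⟩ := hK.exists_obj hb1 hψ1 hψs hψt
  refine ⟨z, hz, (coneData_toPi_iff (K.src_eq_of_le hz (Nat.zero_le n))).2 ⟨?_, fun i => ?_,
    fun i => ?_⟩⟩
  · rw [hkz, hb]
  · rw [X.src_eq_of_le hx (Nat.zero_le i), K.src_eq_of_le hz (Nat.zero_le i), hκz, hψ]
  · rw [X.tgt_eq_of_le hx (Nat.zero_le i), K.tgt_eq_of_le hz (Nat.zero_le i), hκz, hψ]

theorem IsHKernel.exists_lift_of_dim (hK : IsHKernel G K k κ) : ∀ j ≤ n, ∀ x : X.Cell,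
    X.src j x = x → ∃ z, K.src j z = z ∧ coneData lam x = coneData κ.piCone (K.toPi z)
  | 0, _, _, hx => hK.exists_lift_obj lam hx
  | j + 1, hj, x, hx => by
    obtain ⟨a, ha, hda⟩ := hK.exists_lift_of_dim j (Nat.le_of_succ_le hj) (X.src j x)
      (X.src_src_of_le _ le_rfl)
    obtain ⟨a', ha', hda'⟩ := hK.exists_lift_of_dim j (Nat.le_of_succ_le hj) (X.tgt j x)
      (X.src_tgt_of_le _ le_rfl)
    obtain ⟨z, hz, -, -, h⟩ := hK.exists_lift lam hj hx ha ha' hda hda'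
    exact ⟨z, hz, h⟩

end Lift

/-- The functor `π₀ G` has an `h`-kernel if `G` has one: it is a quotient of `π₀` of the kernel of
`G`. -/
theorem IsHKernel.exists_piZero (hK : IsHKernel G K k κ) :
    ∃ (H : NCat.{u} n) (q : NFunctor H B.piZero.toNCat)
      (χ : LaxTrans (zero H C.piZero) (q.comp G.piZero.toNFunctor)),
      IsHKernel G.piZero H q χ := by
  have hlow : ∀ {j : ℕ} {x y : K.piZero.Cell}, j + 1 < n →
      coneData κ.piCone (K.piZero.tgt j x) = coneData κ.piCone (K.piZero.src j y) →
      K.piZero.tgt j x = K.piZero.src j y := by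
    intro j x y hj h
    obtain ⟨x, hx, rfl⟩ := NCat.exists_toPi x
    obtain ⟨y, hy, rfl⟩ := NCat.exists_toPi y
    rw [tgt_toPi hx, src_toPi] at h ⊢
    rw [hK.eq_of_coneData hj (K.src_tgt_of_le _ le_rfl) (K.src_src_of_le _ le_rfl) h]
  refine exists_isHKernel (lam := κ.piCone) (fun {j x y} h => ?_) hlow (fun lam' y => ?_)
  · rcases lt_trichotomy (j + 1) n with hj | rfl | hj
    · exact ⟨y, rfl, hlow hj h⟩
    · obtain ⟨x, hx, rfl⟩ := NCat.exists_toPi x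
      obtain ⟨y, hy, rfl⟩ := NCat.exists_toPi y
      rw [tgt_toPi hx] at h ⊢
      obtain ⟨z, hz, hzs, -, hd⟩ := hK.exists_lift κ.piCone (Nat.lt_succ_self j)
        (x := K.toPi y) (K.piZero.src_dim _) (a := K.tgt j x) (a' := K.tgt j y)
        (K.src_tgt_of_le _ le_rfl) (K.src_tgt_of_le _ le_rfl) h.symm (by rw [tgt_toPi hy])
      exact ⟨K.toPi z, hd.symm, by rw [src_toPi, hzs]⟩
    · have hj' : n ≤ j := Nat.le_of_lt_succ hj
      rw [NCat.tgt_of_le _ hj', NCat.src_of_le _ hj'] at h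
      exact ⟨x, h, by rw [NCat.tgt_of_le _ hj', NCat.src_of_le _ hj']⟩
  · obtain ⟨z, -, hz⟩ := hK.exists_lift_of_dim lam' n le_rfl y (NCat.src_dim _ y)
    exact ⟨K.toPi z, hz.symm⟩

end PiKernel

/-! ### Groupoids and inverses up to a cell of higher dimension -/

namespace NCat

/-- Some cell of `C` has `k`-source `a` and `k`-target `b`; in dimensions `k ≥ n` this says that
`a = b`. -/
def Path {n : ℕ} (C : NCat.{u} n) (k : ℕ) (a b : C.Cell) : Prop :=
  ∃ r, C.src k r = a ∧ C.tgt k r = b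

/-- Every `(k+1)`-cell has a right inverse up to a `(k+2)`-cell. -/
def HasInverses {n : ℕ} (C : NCat.{u} n) : Prop :=
  ∀ (k : ℕ) (f : C.Cell), C.src (k + 1) f = f → ∃ g, C.src (k + 1) g = g ∧
    C.src k g = C.tgt k f ∧ C.tgt k g = C.src k f ∧ C.Path (k + 1) (C.comp k f g) (C.src k f)

variable {n : ℕ} {C : NCat.{u} n}

theorem Path.trans {k : ℕ} {a b c : C.Cell} (h : C.Path k a b) (h' : C.Path k b c) :
    C.Path k a c := by
  obtain ⟨r, h1, h2⟩ := h
  obtain ⟨s, h3, h4⟩ := h'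
  exact ⟨C.comp k r s, by rw [C.src_self_comp, h1], by rw [C.tgt_comp_self (h2.trans h3.symm), h4]⟩

theorem Path.comp_left {j k : ℕ} (hj : j < k) {p a b : C.Cell} (hp : C.src k p = p)
    (h : C.Path k a b) : C.Path k (C.comp j p a) (C.comp j p b) := by
  obtain ⟨r, h1, h2⟩ := h
  exact ⟨C.comp j p r, by rw [C.src_comp' hj, hp, h1],
    by rw [C.tgt_comp' hj, C.tgt_eq_of_le hp le_rfl, h2]⟩

theorem Path.comp_right {j k : ℕ} (hj : j < k) {p a b : C.Cell} (hp : C.src k p = p)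
    (h : C.Path k a b) : C.Path k (C.comp j a p) (C.comp j b p) := by
  obtain ⟨r, h1, h2⟩ := h
  exact ⟨C.comp j r p, by rw [C.src_comp' hj, hp, h1],
    by rw [C.tgt_comp' hj, C.tgt_eq_of_le hp le_rfl, h2]⟩

theorem Path.symm (hC : C.HasInverses) {k : ℕ} {a b : C.Cell} (h : C.Path k a b) :
    C.Path k b a := by
  obtain ⟨r, h1, h2⟩ := h
  obtain ⟨g, -, h3, h4, -⟩ := hC k (C.src (k + 1) r) (C.src_src_of_le _ le_rfl)
  exact ⟨g, by rw [h3, C.tgt_src _ (Nat.lt_succ_self k), h2],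
    by rw [h4, C.src_src _ (Nat.lt_succ_self k), h1]⟩

theorem HasInverses.exists_left (hC : C.HasInverses) {k : ℕ} {f : C.Cell}
    (hf : C.src (k + 1) f = f) : ∃ g, C.src (k + 1) g = g ∧ C.src k g = C.tgt k f ∧
      C.tgt k g = C.src k f ∧ C.Path (k + 1) (C.comp k g f) (C.tgt k f) := by
  obtain ⟨g, hg, hgs, hgt, h⟩ := hC k f hf
  obtain ⟨f', hf', hfs, hft, h'⟩ := hC k g hg
  refine ⟨g, hg, hgs, hgt, ?_⟩
  have lt := Nat.lt_succ_self k
  -- a right inverse `f'` of the right inverse `g` of `f` is connected to `f`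
  have h1 : C.Path (k + 1) f f' := by
    have e1 := (h'.comp_left lt hf).symm hC
    have e2 := h.comp_right lt hf'
    rw [C.assoc hgs.symm hfs.symm] at e2
    rw [hgs, C.comp_id] at e1
    have e3 := e1.trans e2
    rwa [← hgt, ← hfs, C.id_comp] at e3
  exact (h1.comp_left lt hg).trans (by rwa [hgs] at h')

theorem HasInverses.hom {C : NCat.{u} (n + 1)} (hC : C.HasInverses) (x y : C.Cell) :
    (C.Hom x y).HasInverses := by
  intro k f hf
  obtain ⟨g, hg, hgs, hgt, r, hr, hrt⟩ := hC (k + 1) f.1 (congrArg Subtype.val hf)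
  have p := Nat.succ_pos k
  have p' := Nat.succ_pos (k + 1)
  exact ⟨⟨g, by rw [← C.src_src g p, hgs, C.src_tgt _ p, f.2.1],
    by rw [← C.tgt_src g p, hgs, C.tgt_tgt _ p, f.2.2]⟩, Subtype.ext hg, Subtype.ext hgs,
    Subtype.ext hgt, ⟨r, by rw [← C.src_tgt r p', hrt, C.src_src _ p, f.2.1],
      by rw [← C.tgt_tgt r p', hrt, C.tgt_src _ p, f.2.2]⟩, Subtype.ext hr, Subtype.ext hrt⟩

theorem src_zero_of_isArrow {f x y : C.Cell} (hf : C.IsArrow f x y) : C.src 0 x = x := by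
  rw [← hf.src_zero, C.src_src_of_le _ le_rfl]

theorem IsArrow.comp {f g x y z : C.Cell} (hf : C.IsArrow f x y) (hg : C.IsArrow g y z) :
    C.IsArrow (C.comp 0 f g) x z :=
  ⟨by rw [C.src_comp' Nat.one_pos, hf.src_one, hg.src_one],
    by rw [C.src_self_comp, hf.src_zero],
    by rw [C.tgt_comp_self (by rw [hf.tgt_zero, hg.src_zero]), hg.tgt_zero]⟩

end NCat

/-- The identity functor. -/
def NFunctor.id {n : ℕ} (C : NCat.{u} n) : NFunctor C C where
  map x := x
  map_src _ _ := rfl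
  map_tgt _ _ := rfl
  map_comp _ _ _ _ := rfl

/-- Equivalences without the requirement that the `1`-cells `F c ⟶ d` be weakly invertible. For
functors to a groupoid this is the same notion. -/
def IsWeakEquiv : (n : ℕ) → {C D : NCat.{u} n} → NFunctor C D → Prop
  | 0, _, _, F => Function.Bijective F.map
  | n + 1, C, D, F =>
    (∀ d : D.Cell, D.src 0 d = d → ∃ c : C.Cell, C.src 0 c = c ∧ ∃ f, D.IsArrow f (F.map c) d) ∧
    ∀ x y : C.Cell, C.src 0 x = x → C.src 0 y = y → IsWeakEquiv n (F.hom x y)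

theorem isWeakEquiv_of_isEquivalence : ∀ (n : ℕ) {C D : NCat.{u} n} {F : NFunctor C D},
    IsEquivalence n F → IsWeakEquiv n F
  | 0, _, _, _, h => h
  | n + 1, _, _, _, h => by
    refine ⟨fun d hd => ?_, fun x y hx hy => isWeakEquiv_of_isEquivalence n (h.2 x y hx hy)⟩
    obtain ⟨c, hc, f, hf, -⟩ := h.1 d hd
    exact ⟨c, hc, f, hf⟩

theorem isEquivalence_of_isWeakEquiv : ∀ (n : ℕ) {C D : NCat.{u} n} {F : NFunctor C D},
    IsGroupoid n D → IsWeakEquiv n F → IsEquivalence n F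
  | 0, _, _, _, _, h => h
  | n + 1, C, D, F, hD, h => by
    refine ⟨fun d hd => ?_, fun x y hx hy => isEquivalence_of_isWeakEquiv n
      (hD.2 _ _ (by rw [← F.map_src, hx]) (by rw [← F.map_src, hy])) (h.2 x y hx hy)⟩
    obtain ⟨c, hc, f, hf⟩ := h.1 d hd
    exact ⟨c, hc, f, hf, hD.1 _ _ _ hf⟩

namespace IsWeakEquiv

theorem exists_obj : ∀ {n : ℕ} {C D : NCat.{u} n} {F : NFunctor C D}, IsWeakEquiv n F →
    ∀ d, D.src 0 d = d → ∃ c, C.src 0 c = c ∧ ∃ f, D.src 0 f = F.map c ∧ D.tgt 0 f = d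
  | 0, C, D, F, h, d, hd => by
    obtain ⟨c, rfl⟩ := h.2 d
    exact ⟨c, C.src_dim c, F.map c, D.src_dim _, D.tgt_dim _⟩
  | n + 1, C, D, F, h, d, hd => by
    obtain ⟨c, hc, f, hf⟩ := h.1 d hd
    exact ⟨c, hc, f, hf.src_zero, hf.tgt_zero⟩

theorem comp : ∀ {n : ℕ} {C D E : NCat.{u} n} {L : NFunctor C D} {M : NFunctor D E},
    IsWeakEquiv n L → IsWeakEquiv n M → IsWeakEquiv n (L.comp M)
  | 0, _, _, _, L, M, hL, hM => by
    have hL' : Function.Bijective L.map := hL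
    have hM' : Function.Bijective M.map := hM
    exact hM'.comp hL'
  | n + 1, C, D, E, L, M, hL, hM => by
    refine ⟨fun d hd => ?_, fun x y hx hy => comp (hL.2 x y hx hy)
      (hM.2 _ _ (by rw [← L.map_src, hx]) (by rw [← L.map_src, hy]))⟩
    obtain ⟨c', hc', f', hf'⟩ := hM.1 d hd
    obtain ⟨c, hc, f, hf⟩ := hL.1 c' hc'
    exact ⟨c, hc, _, (M.map_isArrow hf).comp hf'⟩

end IsWeakEquiv

/-- The two-out-of-six property of weak equivalences between `n`-categories with inverses. -/
def TwoOfSix (n : ℕ) : Prop :=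
  ∀ {C D E E' : NCat.{u} n} (L : NFunctor C D) (M : NFunctor D E) (N : NFunctor E E'),
    C.HasInverses → D.HasInverses → E.HasInverses → E'.HasInverses →
    IsWeakEquiv n (L.comp M) → IsWeakEquiv n (M.comp N) →
    IsWeakEquiv n L ∧ IsWeakEquiv n M ∧ IsWeakEquiv n N

/-- In an `(n+1)`-category with inverses, composition with `1`-cells gives weak equivalences. -/
def WhiskerEquiv (n : ℕ) : Prop :=
  ∀ {C : NCat.{u} (n + 1)}, C.HasInverses → ∀ {f x y : C.Cell} (hf : C.IsArrow f x y) (z : C.Cell),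
    C.src 0 z = z → IsWeakEquiv n (C.precomp hf z) ∧ IsWeakEquiv n (C.postcomp hf z)

namespace TwoOfSix

variable {n : ℕ} {C D E : NCat.{u} n} {L : NFunctor C D} {M : NFunctor D E}

theorem left (h : TwoOfSix.{u} n) (hC : C.HasInverses) (hD : D.HasInverses) (hE : E.HasInverses)
    (hM : IsWeakEquiv n M) (hLM : IsWeakEquiv n (L.comp M)) : IsWeakEquiv n L :=
  (h L M (NFunctor.id E) hC hD hE hE hLM hM).1

theorem right (h : TwoOfSix.{u} n) (hC : C.HasInverses) (hD : D.HasInverses) (hE : E.HasInverses)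
    (hL : IsWeakEquiv n L) (hLM : IsWeakEquiv n (L.comp M)) : IsWeakEquiv n M :=
  (h (NFunctor.id C) L M hC hC hD hE hL hLM).2.2

end TwoOfSix

/-- A functor that is a weak equivalence on the homs between enough objects is one on all homs. -/
theorem isWeakEquiv_hom_of_transport {n : ℕ} (h6 : TwoOfSix.{u} n) (hW : WhiskerEquiv.{u} n)
    {D E : NCat.{u} (n + 1)} (hD : D.HasInverses) (hE : E.HasInverses) (M : NFunctor D E)
    (P : D.Cell → Prop)
    (hP : ∀ d, D.src 0 d = d → ∃ c, D.src 0 c = c ∧ P c ∧ ∃ e, D.IsArrow e c d)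
    (hM : ∀ c c', D.src 0 c = c → D.src 0 c' = c' → P c → P c' → IsWeakEquiv n (M.hom c c'))
    (d d' : D.Cell) (hd : D.src 0 d = d) (hd' : D.src 0 d' = d') : IsWeakEquiv n (M.hom d d') := by
  obtain ⟨c, hc, pc, e, he⟩ := hP d hd
  obtain ⟨c', hc', pc', e', he'⟩ := hP d' hd'
  have obj : ∀ {c}, D.src 0 c = c → E.src 0 (M.map c) = M.map c := fun h => by rw [← M.map_src, h]
  have e1 : (D.postcomp he' c).comp (M.hom c d') =
      (M.hom c c').comp (E.postcomp (M.map_isArrow he') (M.map c)) :=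
    NFunctor.ext (funext fun u => Subtype.ext
      (M.map_comp 0 u.1 e' (by rw [u.2.2, he'.src_zero])))
  have w1 : IsWeakEquiv n (M.hom c d') := by
    refine h6.right (hD.hom _ _) (hD.hom _ _) (hE.hom _ _) (hW hD he' c hc).2 ?_
    rw [e1]
    exact (hM c c' hc hc' pc pc').comp (hW hE _ _ (obj hc)).2
  have e2 : (M.hom d d').comp (E.precomp (M.map_isArrow he) (M.map d')) =
      (D.precomp he d').comp (M.hom c d') :=
    NFunctor.ext (funext fun u => Subtype.ext
      (M.map_comp 0 e u.1 (by rw [u.2.1, he.tgt_zero])).symm)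
  refine h6.left (hD.hom _ _) (hE.hom _ _) (hE.hom _ _)
    (hW hE (M.map_isArrow he) _ (obj hd')).1 ?_
  rw [e2]
  exact (hW hD he d' hd').1.comp w1

theorem twoOfSix_zero : TwoOfSix.{u} 0 := by
  intro C D E E' L M N _ _ _ _ h1 h2
  have s : Function.Surjective M.map := Function.Surjective.of_comp h1.2
  have i : Function.Injective M.map := Function.Injective.of_comp h2.1
  have b : Function.Bijective M.map := ⟨i, s⟩
  exact ⟨(Function.Bijective.of_comp_iff' b L.map).1 h1, b,
    (Function.Bijective.of_comp_iff N.map b).1 h2⟩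

theorem twoOfSix_succ {n : ℕ} (h6 : TwoOfSix.{u} n) (hW : WhiskerEquiv.{u} n) :
    TwoOfSix.{u} (n + 1) := by
  intro C D E E' L M N hC hD hE hE' h1 h2
  have obj : ∀ {c}, C.src 0 c = c → D.src 0 (L.map c) = L.map c := fun h => by rw [← L.map_src, h]
  have obj' : ∀ {c}, D.src 0 c = c → E.src 0 (M.map c) = M.map c := fun h => by
    rw [← M.map_src, h]
  have loc : ∀ c c', C.src 0 c = c → C.src 0 c' = c' → IsWeakEquiv n (L.hom c c') ∧
      IsWeakEquiv n (M.hom (L.map c) (L.map c')) ∧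
      IsWeakEquiv n (N.hom (M.map (L.map c)) (M.map (L.map c'))) := fun c c' hc hc' =>
    h6 (L.hom c c') (M.hom _ _) (N.hom _ _) (hC.hom _ _) (hD.hom _ _) (hE.hom _ _) (hE'.hom _ _)
      (h1.2 c c' hc hc') (h2.2 _ _ (obj hc) (obj hc'))
  have essL : ∀ d, D.src 0 d = d → ∃ c, C.src 0 c = c ∧ ∃ f, D.IsArrow f (L.map c) d := by
    intro d hd
    obtain ⟨c, hc, p, hp⟩ := h1.1 (M.map d) (obj' hd)
    have hp' := N.map_isArrow hp
    obtain ⟨q, hq, -⟩ := (h2.2 (L.map c) d (obj hc) hd).exists_obj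
      ⟨N.map p, hp'.src_zero, hp'.tgt_zero⟩ (Subtype.ext hp'.src_one)
    exact ⟨c, hc, q.1, congrArg Subtype.val hq, q.2.1, q.2.2⟩
  refine ⟨⟨essL, fun c c' hc hc' => (loc c c' hc hc').1⟩, ⟨fun d hd => ?_, ?_⟩,
    ⟨fun d hd => ?_, ?_⟩⟩
  · obtain ⟨c, hc, f, hf⟩ := h1.1 d hd
    exact ⟨L.map c, obj hc, f, hf⟩
  · refine isWeakEquiv_hom_of_transport h6 hW hD hE M
      (fun d => ∃ c, C.src 0 c = c ∧ L.map c = d) (fun d hd => ?_) ?_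
    · obtain ⟨c, hc, f, hf⟩ := essL d hd
      exact ⟨L.map c, obj hc, ⟨c, hc, rfl⟩, f, hf⟩
    · rintro _ _ - - ⟨c, hc, rfl⟩ ⟨c', hc', rfl⟩
      exact (loc c c' hc hc').2.1
  · obtain ⟨c, hc, f, hf⟩ := h2.1 d hd
    exact ⟨M.map c, obj' hc, f, hf⟩
  · refine isWeakEquiv_hom_of_transport h6 hW hE hE' N
      (fun d => ∃ c, C.src 0 c = c ∧ M.map (L.map c) = d) (fun d hd => ?_) ?_
    · obtain ⟨c, hc, f, hf⟩ := h1.1 d hd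
      exact ⟨M.map (L.map c), obj' (obj hc), ⟨c, hc, rfl⟩, f, hf⟩
    · rintro _ _ - - ⟨c, hc, rfl⟩ ⟨c', hc', rfl⟩
      exact (loc c c' hc hc').2.2

/-- Composition with an endomorphism `e` of `x` that is connected to the identity by a `2`-cell `r`
is a weak equivalence: whiskering with `r` is natural. -/
theorem isWeakEquiv_precomp_of_path : ∀ {n : ℕ}, (∀ m, m + 1 = n → TwoOfSix.{u} m ∧
    WhiskerEquiv.{u} m) → ∀ {C : NCat.{u} (n + 1)}, C.HasInverses → ∀ {e x : C.Cell}
    (he : C.IsArrow e x x), C.Path 1 e x → ∀ z, IsWeakEquiv n (C.precomp he z)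
  | 0, _, C, _, e, x, he, h, z => by
    obtain ⟨r, h1, h2⟩ := h
    rw [C.src_dim] at h1
    rw [C.tgt_dim] at h2
    obtain rfl : e = x := h1.symm.trans h2
    have : (C.precomp he z).map = fun c => c := funext fun c => Subtype.ext (by
      change C.comp 0 e c.1 = c.1
      have := C.id_comp 0 c.1
      rwa [c.2.1] at this)
    change Function.Bijective _
    rw [this]
    exact Function.bijective_id
  | m + 1, H, C, hC, e, x, he, h, z => by
    obtain ⟨h6, hW⟩ := H m rfl
    obtain ⟨r0, h1, h2⟩ := h
    obtain ⟨r, hr, hr1, hr2⟩ : ∃ r, C.src 2 r = r ∧ C.src 1 r = e ∧ C.tgt 1 r = x :=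
      ⟨C.src 2 r0, C.src_src_of_le _ le_rfl, by rw [C.src_src _ Nat.one_lt_two, h1],
        by rw [C.tgt_src _ Nat.one_lt_two, h2]⟩
    have hx := C.src_zero_of_isArrow he
    have hx1 := C.src_eq_of_le hx (Nat.zero_le 1)
    have rs : C.src 0 r = x := by rw [← C.src_src r Nat.one_pos, hr1, he.src_zero]
    have rt : C.tgt 0 r = x := by rw [← C.tgt_src r Nat.one_pos, hr1, he.tgt_zero]
    let E := C.Hom x z
    -- the component at `d` of the transformation from `e ∘ -` to the identity
    have ρ : ∀ d : E.Cell, E.src 0 d = d →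
        ∃ w : E.Cell, E.IsArrow w ((C.precomp he z).map d) d ∧ w.1 = C.comp 0 r d.1 := by
      intro d hd
      have hd1 : C.src 1 d.1 = d.1 := congrArg Subtype.val hd
      refine ⟨⟨C.comp 0 r d.1, by rw [C.src_self_comp, rs],
        by rw [C.tgt_comp_self (by rw [rt, d.2.1]), d.2.2]⟩, ⟨Subtype.ext ?_, Subtype.ext ?_,
          Subtype.ext ?_⟩, rfl⟩
      · change C.src 2 (C.comp 0 r d.1) = _
        rw [C.src_comp' Nat.two_pos, hr, C.src_eq_of_le hd1 one_le_two]
      · change C.src 1 (C.comp 0 r d.1) = C.comp 0 e d.1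
        rw [C.src_comp' Nat.one_pos, hr1, hd1]
      · change C.tgt 1 (C.comp 0 r d.1) = d.1
        rw [C.tgt_comp' Nat.one_pos, hr2, C.tgt_eq_of_le hd1 le_rfl]
        have := C.id_comp 0 d.1
        rwa [d.2.1] at this
    refine ⟨fun d hd => ?_, fun d d' hd hd' => ?_⟩
    · obtain ⟨w, hw, -⟩ := ρ d hd
      exact ⟨d, hd, w, hw⟩
    · obtain ⟨w, hw, ew⟩ := ρ d hd
      obtain ⟨w', hw', ew'⟩ := ρ d' hd'
      have hE := hC.hom x z
      have o : E.src 0 ((C.precomp he z).map d) = (C.precomp he z).map d := by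
        rw [← (C.precomp he z).map_src, hd]
      have e1 : ((C.precomp he z).hom d d').comp (E.postcomp hw' ((C.precomp he z).map d)) =
          E.precomp hw d' := by
        refine NFunctor.ext (funext fun u => Subtype.ext (Subtype.ext ?_))
        change C.comp 1 (C.comp 0 e u.1.1) w'.1 = C.comp 1 w.1 u.1.1
        have us : C.src 1 u.1.1 = d.1 := congrArg Subtype.val u.2.1
        have ut : C.tgt 1 u.1.1 = d'.1 := congrArg Subtype.val u.2.2
        have hd1 : C.tgt 1 d.1 = d.1 := C.tgt_eq_of_le (congrArg Subtype.val hd) le_rfl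
        have hd1' : C.src 1 d'.1 = d'.1 := congrArg Subtype.val hd'
        have l : C.comp 1 (C.comp 0 e u.1.1) (C.comp 0 r d'.1) = C.comp 0 r u.1.1 := by
          rw [← C.interchange Nat.one_pos (by rw [C.tgt_eq_of_le he.src_one le_rfl, hr1])
            (by rw [ut, hd1']) (by rw [he.tgt_zero, u.1.2.1]), ← hr1, C.id_comp, ← ut, C.comp_id]
        have rr : C.comp 1 (C.comp 0 r d.1) u.1.1 = C.comp 0 r u.1.1 := by
          have hu : u.1.1 = C.comp 0 x u.1.1 := by
            have := C.id_comp 0 u.1.1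
            rw [u.1.2.1] at this
            exact this.symm
          have cx : C.comp 1 r x = r := by
            have := C.comp_id 1 r
            rwa [hr2] at this
          nth_rewrite 1 [hu]
          rw [← C.interchange Nat.one_pos (by rw [hr2, hx1]) (by rw [us, hd1])
            (by rw [rt, d.2.1]), cx, ← us, C.id_comp]
        rw [ew, ew', l, rr]
      refine h6.left (hE.hom _ _) (hE.hom _ _) (hE.hom _ _) (hW hE hw' _ o).2 ?_
      rw [e1]
      exact (hW hE hw _ hd').1

/-- The mirror image of `isWeakEquiv_precomp_of_path`. -/
theorem isWeakEquiv_postcomp_of_path : ∀ {n : ℕ}, (∀ m, m + 1 = n → TwoOfSix.{u} m ∧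
    WhiskerEquiv.{u} m) → ∀ {C : NCat.{u} (n + 1)}, C.HasInverses → ∀ {e x : C.Cell}
    (he : C.IsArrow e x x), C.Path 1 e x → ∀ z, IsWeakEquiv n (C.postcomp he z)
  | 0, _, C, _, e, x, he, h, z => by
    obtain ⟨r, h1, h2⟩ := h
    rw [C.src_dim] at h1
    rw [C.tgt_dim] at h2
    obtain rfl : e = x := h1.symm.trans h2
    have : (C.postcomp he z).map = fun c => c := funext fun c => Subtype.ext (by
      change C.comp 0 c.1 e = c.1
      have := C.comp_id 0 c.1
      rwa [c.2.2] at this)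
    change Function.Bijective _
    rw [this]
    exact Function.bijective_id
  | m + 1, H, C, hC, e, x, he, h, z => by
    obtain ⟨h6, hW⟩ := H m rfl
    obtain ⟨r0, h1, h2⟩ := h
    obtain ⟨r, hr, hr1, hr2⟩ : ∃ r, C.src 2 r = r ∧ C.src 1 r = e ∧ C.tgt 1 r = x :=
      ⟨C.src 2 r0, C.src_src_of_le _ le_rfl, by rw [C.src_src _ Nat.one_lt_two, h1],
        by rw [C.tgt_src _ Nat.one_lt_two, h2]⟩
    have hx := C.src_zero_of_isArrow he
    have hx1 := C.src_eq_of_le hx (Nat.zero_le 1)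
    have rs : C.src 0 r = x := by rw [← C.src_src r Nat.one_pos, hr1, he.src_zero]
    have rt : C.tgt 0 r = x := by rw [← C.tgt_src r Nat.one_pos, hr1, he.tgt_zero]
    let E := C.Hom z x
    have ρ : ∀ d : E.Cell, E.src 0 d = d →
        ∃ w : E.Cell, E.IsArrow w ((C.postcomp he z).map d) d ∧ w.1 = C.comp 0 d.1 r := by
      intro d hd
      have hd1 : C.src 1 d.1 = d.1 := congrArg Subtype.val hd
      refine ⟨⟨C.comp 0 d.1 r, by rw [C.src_self_comp, d.2.1],
        by rw [C.tgt_comp_self (by rw [rs, d.2.2]), rt]⟩, ⟨Subtype.ext ?_, Subtype.ext ?_,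
          Subtype.ext ?_⟩, rfl⟩
      · change C.src 2 (C.comp 0 d.1 r) = _
        rw [C.src_comp' Nat.two_pos, hr, C.src_eq_of_le hd1 one_le_two]
      · change C.src 1 (C.comp 0 d.1 r) = C.comp 0 d.1 e
        rw [C.src_comp' Nat.one_pos, hr1, hd1]
      · change C.tgt 1 (C.comp 0 d.1 r) = d.1
        rw [C.tgt_comp' Nat.one_pos, hr2, C.tgt_eq_of_le hd1 le_rfl]
        have := C.comp_id 0 d.1
        rwa [d.2.2] at this
    refine ⟨fun d hd => ?_, fun d d' hd hd' => ?_⟩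
    · obtain ⟨w, hw, -⟩ := ρ d hd
      exact ⟨d, hd, w, hw⟩
    · obtain ⟨w, hw, ew⟩ := ρ d hd
      obtain ⟨w', hw', ew'⟩ := ρ d' hd'
      have hE := hC.hom z x
      have o : E.src 0 ((C.postcomp he z).map d) = (C.postcomp he z).map d := by
        rw [← (C.postcomp he z).map_src, hd]
      have e1 : ((C.postcomp he z).hom d d').comp (E.postcomp hw' ((C.postcomp he z).map d)) =
          E.precomp hw d' := by
        refine NFunctor.ext (funext fun u => Subtype.ext (Subtype.ext ?_))
        change C.comp 1 (C.comp 0 u.1.1 e) w'.1 = C.comp 1 w.1 u.1.1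
        have us : C.src 1 u.1.1 = d.1 := congrArg Subtype.val u.2.1
        have ut : C.tgt 1 u.1.1 = d'.1 := congrArg Subtype.val u.2.2
        have hd1 : C.tgt 1 d.1 = d.1 := C.tgt_eq_of_le (congrArg Subtype.val hd) le_rfl
        have hd1' : C.src 1 d'.1 = d'.1 := congrArg Subtype.val hd'
        have l : C.comp 1 (C.comp 0 u.1.1 e) (C.comp 0 d'.1 r) = C.comp 0 u.1.1 r := by
          rw [← C.interchange Nat.one_pos (by rw [ut, hd1'])
            (by rw [C.tgt_eq_of_le he.src_one le_rfl, hr1]) (by rw [he.src_zero, u.1.2.2]), ← hr1,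
            C.id_comp, ← ut, C.comp_id]
        have rr : C.comp 1 (C.comp 0 d.1 r) u.1.1 = C.comp 0 u.1.1 r := by
          have hu : u.1.1 = C.comp 0 u.1.1 x := by
            have := C.comp_id 0 u.1.1
            rw [u.1.2.2] at this
            exact this.symm
          have cx : C.comp 1 r x = r := by
            have := C.comp_id 1 r
            rwa [hr2] at this
          nth_rewrite 1 [hu]
          rw [← C.interchange Nat.one_pos (by rw [us, hd1]) (by rw [hr2, hx1])
            (by rw [rs, d.2.2]), cx, ← us, C.id_comp]
        rw [ew, ew', l, rr]
      refine h6.left (hE.hom _ _) (hE.hom _ _) (hE.hom _ _) (hW hE hw' _ o).2 ?_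
      rw [e1]
      exact (hW hE hw _ hd').1

/-- If `g` is a right and `g'` a left inverse of `f`, then two out of six applies to composition
with `g`, `f` and `g'`. -/
theorem whiskerEquiv_of_twoOfSix {n : ℕ} (h6 : TwoOfSix.{u} n)
    (H : ∀ m, m + 1 = n → TwoOfSix.{u} m ∧ WhiskerEquiv.{u} m) : WhiskerEquiv.{u} n := by
  intro C hC f x y hf z hz
  obtain ⟨g, hg, hgs, hgt, hp⟩ := hC 0 f hf.src_one
  obtain ⟨g', hg', hgs', hgt', hp'⟩ := hC.exists_left (k := 0) hf.src_one
  rw [hf.tgt_zero] at hgs hgs' hp'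
  rw [hf.src_zero] at hgt hgt' hp
  have ag : C.IsArrow g y x := ⟨hg, hgs, hgt⟩
  have ag' : C.IsArrow g' y x := ⟨hg', hgs', hgt'⟩
  have afg := hf.comp ag
  have agf := ag'.comp hf
  constructor
  · have e1 : (C.precomp ag z).comp (C.precomp hf z) = C.precomp afg z :=
      NFunctor.ext (funext fun u => Subtype.ext
        (C.assoc (by rw [hf.tgt_zero, hgs]) (by rw [hgt, u.2.1])).symm)
    have e2 : (C.precomp hf z).comp (C.precomp ag' z) = C.precomp agf z :=
      NFunctor.ext (funext fun u => Subtype.ext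
        (C.assoc (by rw [hf.src_zero, hgt']) (by rw [hf.tgt_zero, u.2.1])).symm)
    refine (h6 (C.precomp ag z) (C.precomp hf z) (C.precomp ag' z) (hC.hom _ _) (hC.hom _ _)
      (hC.hom _ _) (hC.hom _ _) ?_ ?_).2.1
    · rw [e1]
      exact isWeakEquiv_precomp_of_path H hC afg hp z
    · rw [e2]
      exact isWeakEquiv_precomp_of_path H hC agf hp' z
  · have e1 : (C.postcomp ag' z).comp (C.postcomp hf z) = C.postcomp agf z :=
      NFunctor.ext (funext fun u => Subtype.ext
        (C.assoc (by rw [hgs', u.2.2]) (by rw [hgt', hf.src_zero])))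
    have e2 : (C.postcomp hf z).comp (C.postcomp ag z) = C.postcomp afg z :=
      NFunctor.ext (funext fun u => Subtype.ext
        (C.assoc (by rw [hf.src_zero, u.2.2]) (by rw [hf.tgt_zero, hgs])))
    refine (h6 (C.postcomp ag' z) (C.postcomp hf z) (C.postcomp ag z) (hC.hom _ _) (hC.hom _ _)
      (hC.hom _ _) (hC.hom _ _) ?_ ?_).2.1
    · rw [e1]
      exact isWeakEquiv_postcomp_of_path H hC agf hp' z
    · rw [e2]
      exact isWeakEquiv_postcomp_of_path H hC afg hp z

theorem twoOfSix_and_whiskerEquiv : ∀ n : ℕ, TwoOfSix.{u} n ∧ WhiskerEquiv.{u} n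
  | 0 => ⟨twoOfSix_zero, whiskerEquiv_of_twoOfSix twoOfSix_zero fun m hm => by omega⟩
  | n + 1 => by
    obtain ⟨h6, hW⟩ := twoOfSix_and_whiskerEquiv n
    have h6' : TwoOfSix.{u} (n + 1) := twoOfSix_succ h6 hW
    refine ⟨h6', whiskerEquiv_of_twoOfSix h6' fun m hm => ?_⟩
    obtain rfl : m = n := by omega
    exact ⟨h6, hW⟩

theorem whiskerEquiv (n : ℕ) : WhiskerEquiv.{u} n := (twoOfSix_and_whiskerEquiv n).2

theorem NCat.HasInverses.isGroupoid : ∀ {n : ℕ} {C : NCat.{u} n}, C.HasInverses → IsGroupoid n C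
  | 0, _, _ => trivial
  | n + 1, C, hC => by
    refine ⟨fun f x y hf z hz => ?_, fun x y _ _ => (hC.hom x y).isGroupoid⟩
    obtain ⟨h1, h2⟩ := whiskerEquiv n hC hf z hz
    exact ⟨isEquivalence_of_isWeakEquiv n (hC.hom _ _).isGroupoid h1,
      isEquivalence_of_isWeakEquiv n (hC.hom _ _).isGroupoid h2⟩

theorem hasInverses_of_isGroupoid : ∀ {n : ℕ} {C : NCat.{u} n}, IsGroupoid n C → C.HasInverses
  | 0, C, _ => fun k f _ => ⟨f, C.src_of_le (Nat.zero_le _) f,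
      by rw [C.src_of_le (Nat.zero_le _), C.tgt_of_le (Nat.zero_le _)],
      by rw [C.src_of_le (Nat.zero_le _), C.tgt_of_le (Nat.zero_le _)],
      f, by rw [C.src_of_le (Nat.zero_le _), C.comp_of_le (Nat.zero_le _)],
      by rw [C.src_of_le (Nat.zero_le _), C.tgt_of_le (Nat.zero_le _)]⟩
  | n + 1, C, hC => by
    rintro (_ | k) f hf
    · have ha : C.IsArrow f (C.src 0 f) (C.tgt 0 f) := ⟨hf, rfl, rfl⟩
      have hx : C.src 0 (C.src 0 f) = C.src 0 f := C.src_src_of_le _ le_rfl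
      obtain ⟨g, hg, r, hr, hrt⟩ := (isWeakEquiv_of_isEquivalence n
        (hC.1 f _ _ ha _ hx).1).exists_obj ⟨C.src 0 f, hx, C.tgt_src_of_le _ le_rfl⟩
        (Subtype.ext (C.src_src_of_le _ (Nat.zero_le 1)))
      exact ⟨g.1, congrArg Subtype.val hg, g.2.1, g.2.2, r.1, congrArg Subtype.val hr,
        congrArg Subtype.val hrt⟩
    · obtain ⟨g, hg, hgs, hgt, r, hr, hrt⟩ := hasInverses_of_isGroupoid
        (hC.2 (C.src 0 f) (C.tgt 0 f) (C.src_src_of_le _ le_rfl) (C.src_tgt_of_le _ le_rfl)) k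
        ⟨f, rfl, rfl⟩ (Subtype.ext hf)
      exact ⟨g.1, congrArg Subtype.val hg, congrArg Subtype.val hgs, congrArg Subtype.val hgt,
        r.1, congrArg Subtype.val hr, congrArg Subtype.val hrt⟩

namespace NCat.HasInverses

variable {n : ℕ} {C : NCat.{u} n}

/-- Division on the left. -/
theorem exists_comp_left (hC : C.HasInverses) {k : ℕ} {p h : C.Cell} (hp : C.src (k + 1) p = p)
    (hh : C.src (k + 1) h = h) (hs : C.src k h = C.src k p) :
    ∃ q, C.src (k + 1) q = q ∧ C.src k q = C.tgt k p ∧ C.tgt k q = C.tgt k h ∧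
      C.Path (k + 1) (C.comp k p q) h := by
  obtain ⟨g, hg, hgs, hgt, hr⟩ := hC k p hp
  have e : C.tgt k g = C.src k h := by rw [hgt, hs]
  refine ⟨C.comp k g h, by rw [C.src_comp' (Nat.lt_succ_self k), hg, hh],
    by rw [C.src_self_comp, hgs], by rw [C.tgt_comp_self e], ?_⟩
  have := hr.comp_right (Nat.lt_succ_self k) hh
  rwa [C.assoc hgs.symm e, ← hs, C.id_comp] at this

/-- Division on the right. -/
theorem exists_comp_right (hC : C.HasInverses) {k : ℕ} {p h : C.Cell} (hp : C.src (k + 1) p = p)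
    (hh : C.src (k + 1) h = h) (ht : C.tgt k h = C.tgt k p) :
    ∃ q, C.src (k + 1) q = q ∧ C.src k q = C.src k h ∧ C.tgt k q = C.src k p ∧
      C.Path (k + 1) (C.comp k q p) h := by
  obtain ⟨g, hg, hgs, hgt, hr⟩ := hC.exists_left hp
  have e : C.tgt k h = C.src k g := by rw [hgs, ht]
  refine ⟨C.comp k h g, by rw [C.src_comp' (Nat.lt_succ_self k), hg, hh],
    by rw [C.src_self_comp], by rw [C.tgt_comp_self e, hgt], ?_⟩
  have := hr.comp_left (Nat.lt_succ_self k) hh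
  rwa [← C.assoc e hgt, ← ht, C.comp_id] at this

/-- Composition with a `(k+1)`-cell `p` is full up to a higher cell on cells between
`(k+1)`-cells. -/
theorem exists_whisker : ∀ {n : ℕ} {C : NCat.{u} n}, C.HasInverses → ∀ (k : ℕ) {p a a' d : C.Cell},
    C.src (k + 1) p = p → C.src (k + 1) a = a → C.src (k + 1) a' = a' → C.src k a = C.tgt k p →
    C.src k a' = C.tgt k p → C.tgt k a = C.tgt k a' → C.src (k + 2) d = d →
    C.src (k + 1) d = C.comp k p a → C.tgt (k + 1) d = C.comp k p a' →
    ∃ c, C.src (k + 2) c = c ∧ C.src (k + 1) c = a ∧ C.tgt (k + 1) c = a' ∧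
      C.Path (k + 2) (C.comp k p c) d
  | 0, C, _, k, p, a, a', d, hp, ha, ha', hs, hs', ht, hd, hds, hdt => by
    rw [C.src_of_le (Nat.zero_le _), C.tgt_of_le (Nat.zero_le _)] at hs hs'
    rw [C.src_of_le (Nat.zero_le _), C.comp_of_le (Nat.zero_le _)] at hds
    refine ⟨d, hd, by rw [C.src_of_le (Nat.zero_le _), hs, hds],
      by rw [C.tgt_of_le (Nat.zero_le _), hs', hds], d, ?_, C.tgt_of_le (Nat.zero_le _) _⟩
    rw [C.src_of_le (Nat.zero_le _), C.comp_of_le (Nat.zero_le _), hds]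
  | n + 1, C, hC, 0, p, a, a', d, hp, ha, ha', hs, hs', ht, hd, hds, hdt => by
    have hf : C.IsArrow p (C.src 0 p) (C.tgt 0 p) := ⟨hp, rfl, rfl⟩
    have hw := (whiskerEquiv n hC hf (C.tgt 0 a') (C.src_tgt_of_le _ le_rfl)).1
    cases n with
    | zero =>
      rw [C.src_dim] at hds
      rw [C.tgt_dim] at hdt
      have := @hw.1 ⟨a, hs, ht⟩ ⟨a', hs', rfl⟩ (Subtype.ext (hds.symm.trans hdt))
      obtain rfl : a = a' := congrArg Subtype.val this
      exact ⟨a, C.src_of_le one_le_two _, ha, C.tgt_eq_of_le ha le_rfl, d,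
        hd.trans hds, C.tgt_of_le one_le_two _⟩
    | succ m =>
      have q0 : C.src 0 d = C.src 0 p := by rw [← C.src_src d Nat.one_pos, hds, C.src_self_comp]
      have q1 : C.tgt 0 d = C.tgt 0 a' := by
        rw [← C.tgt_tgt d Nat.one_pos, hdt, C.tgt_comp_self hs'.symm]
      obtain ⟨c, hc, r, hr, hrt⟩ := (hw.2 ⟨a, hs, ht⟩ ⟨a', hs', rfl⟩ (Subtype.ext ha)
        (Subtype.ext ha')).exists_obj ⟨⟨d, q0, q1⟩, Subtype.ext hds, Subtype.ext hdt⟩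
        (Subtype.ext (Subtype.ext hd))
      exact ⟨c.1.1, congrArg (fun t => t.1.1) hc, congrArg Subtype.val c.2.1,
        congrArg Subtype.val c.2.2, r.1.1, congrArg (fun t => t.1.1) hr,
        congrArg (fun t => t.1.1) hrt⟩
  | n + 1, C, hC, k + 1, p, a, a', d, hp, ha, ha', hs, hs', ht, hd, hds, hdt => by
    have pos := Nat.succ_pos k
    have a0 : C.src 0 a = C.src 0 p := by rw [← C.src_src a pos, hs, C.src_tgt _ pos]
    have a1 : C.tgt 0 a = C.tgt 0 p := by rw [← C.tgt_src a pos, hs, C.tgt_tgt _ pos]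
    have b0 : C.src 0 a' = C.src 0 p := by rw [← C.src_src a' pos, hs', C.src_tgt _ pos]
    have b1 : C.tgt 0 a' = C.tgt 0 p := by rw [← C.tgt_src a' pos, hs', C.tgt_tgt _ pos]
    have d0 : C.src 0 d = C.src 0 p := by
      rw [← C.src_src d (Nat.succ_pos (k + 1)), hds, ← C.src_src _ pos, C.src_self_comp,
        C.src_src _ pos]
    have d1 : C.tgt 0 d = C.tgt 0 p := by
      rw [← C.tgt_src d (Nat.succ_pos (k + 1)), hds, ← C.tgt_src _ pos, C.src_self_comp,
        C.tgt_src _ pos]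
    obtain ⟨c, hc, hcs, hct, r, hr, hrt⟩ := exists_whisker (hC.hom (C.src 0 p) (C.tgt 0 p)) k
      (p := ⟨p, rfl, rfl⟩) (a := ⟨a, a0, a1⟩) (a' := ⟨a', b0, b1⟩) (d := ⟨d, d0, d1⟩)
      (Subtype.ext hp) (Subtype.ext ha) (Subtype.ext ha') (Subtype.ext hs) (Subtype.ext hs')
      (Subtype.ext ht) (Subtype.ext hd) (Subtype.ext hds) (Subtype.ext hdt)
    exact ⟨c.1, congrArg Subtype.val hc, congrArg Subtype.val hcs, congrArg Subtype.val hct,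
      r.1, congrArg Subtype.val hr, congrArg Subtype.val hrt⟩

end NCat.HasInverses

/-! ### The `h`-kernel of a functor between groupoids is a groupoid -/

/-- Components for an inverse: if `φ : Px G₀ ⟶ F₀ Py`, and `U : F₀ F₁ ⟶ 1` and `V : G₀ G₁ ⟶ 1` are
inverse data on either side, then there is `ψ : Py G₁ ⟶ F₁ Px` whose pasting with `φ` and `U` is
`V`, up to a higher cell. -/
theorem NCat.HasInverses.exists_inverse_component {n : ℕ} {C : NCat.{u} n} (hC : C.HasInverses)
    {j : ℕ} {Px Py F₀ F₁ G₀ G₁ U V φ : C.Cell} (hPx : C.src (j + 1) Px = Px)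
    (hPy : C.src (j + 1) Py = Py) (hF₀ : C.src (j + 1) F₀ = F₀) (hF₁ : C.src (j + 1) F₁ = F₁)
    (hG₁ : C.src (j + 1) G₁ = G₁) (hU : C.src (j + 2) U = U)
    (hV : C.src (j + 2) V = V) (hφ : C.src (j + 2) φ = φ)
    (e₁ : C.tgt j Px = C.src j G₀) (e₂ : C.tgt j G₀ = C.src j G₁) (e₃ : C.tgt j Py = C.src j G₁)
    (e₄ : C.tgt j F₀ = C.src j Py) (e₅ : C.tgt j F₀ = C.src j F₁) (e₆ : C.tgt j F₁ = C.src j Px)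
    (e₇ : C.tgt j G₁ = C.tgt j Px) (hUs : C.src (j + 1) U = C.comp j F₀ F₁)
    (hUt : C.tgt (j + 1) U = C.src j Px) (hVs : C.src (j + 1) V = C.comp j G₀ G₁)
    (hVt : C.tgt (j + 1) V = C.tgt j Px) (hφs : C.src (j + 1) φ = C.comp j Px G₀)
    (hφt : C.tgt (j + 1) φ = C.comp j F₀ Py) :
    ∃ ψ, C.src (j + 2) ψ = ψ ∧ C.src (j + 1) ψ = C.comp j Py G₁ ∧
      C.tgt (j + 1) ψ = C.comp j F₁ Px ∧
      C.Path (j + 2) (C.comp (j + 1) (C.comp (j + 1) (C.comp j φ G₁) (C.comp j F₀ ψ))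
        (C.comp j U Px)) (C.comp j Px V) := by
  have lt := Nat.lt_succ_self j
  have lt' : j < j + 2 := by omega
  have up : ∀ {z}, C.src (j + 1) z = z → C.src (j + 2) z = z := fun h =>
    C.src_eq_of_le h (Nat.le_succ _)
  have tg : ∀ {z}, C.src (j + 1) z = z → C.tgt (j + 1) z = z := fun h => C.tgt_eq_of_le h le_rfl
  have hA : C.src (j + 2) (C.comp j φ G₁) = C.comp j φ G₁ := by
    rw [C.src_comp' lt', hφ, up hG₁]
  have hE : C.src (j + 2) (C.comp j U Px) = C.comp j U Px := by
    rw [C.src_comp' lt', hU, up hPx]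
  have hT : C.src (j + 2) (C.comp j Px V) = C.comp j Px V := by
    rw [C.src_comp' lt', hV, up hPx]
  have hAt : C.tgt (j + 1) (C.comp j φ G₁) = C.comp j F₀ (C.comp j Py G₁) := by
    rw [C.tgt_comp' lt, hφt, tg hG₁, C.assoc e₄ e₃]
  have hTt : C.tgt (j + 1) (C.comp j Px V) = Px := by
    rw [C.tgt_comp' lt, hVt, tg hPx, C.comp_id]
  have hEs : C.src (j + 1) (C.comp j U Px) = C.comp j F₀ (C.comp j F₁ Px) := by
    rw [C.src_comp' lt, hUs, hPx, C.assoc e₅ e₆]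
  have hEt : C.tgt (j + 1) (C.comp j U Px) = Px := by
    rw [C.tgt_comp' lt, hUt, tg hPx, C.id_comp]
  obtain ⟨q₁, hq₁, q₁s, q₁t, r₁⟩ := hC.exists_comp_left hA hT (by
    rw [C.src_comp' lt, C.src_comp' lt, hVs, hφs, hPx, hG₁, C.assoc e₁ e₂])
  obtain ⟨q₂, hq₂, q₂s, q₂t, r₂⟩ := hC.exists_comp_right hE hq₁ (by rw [q₁t, hTt, hEt])
  obtain ⟨ψ, hψ, ψs, ψt, r₃⟩ := hC.exists_whisker j hF₀ (a := C.comp j Py G₁)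
    (a' := C.comp j F₁ Px) (d := q₂) (by rw [C.src_comp' lt, hPy, hG₁])
    (by rw [C.src_comp' lt, hF₁, hPx]) (by rw [C.src_self_comp, e₄])
    (by rw [C.src_self_comp, e₅]) (by rw [C.tgt_comp_self e₃, C.tgt_comp_self e₆, e₇]) hq₂
    (by rw [q₂s, q₁s, hAt]) (by rw [q₂t, hEs])
  have lt1 := Nat.lt_succ_self (j + 1)
  have m₁ : C.tgt (j + 1) (C.comp j φ G₁) = C.src (j + 1) (C.comp j F₀ ψ) := by
    rw [hAt, C.src_comp' lt, hF₀, ψs]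
  have m₂ : C.tgt (j + 1) (C.comp j F₀ ψ) = C.src (j + 1) (C.comp j U Px) := by
    rw [hEs, C.tgt_comp' lt, tg hF₀, ψt]
  refine ⟨ψ, hψ, ψs, ψt, ?_⟩
  rw [C.assoc m₁ m₂]
  exact (((r₃.comp_right lt1 hE).trans r₂).comp_left lt1 hA).trans r₁

section

variable {n : ℕ} {B C : PtGpd.{u} n} {G : PtFunctor B C} {K : NCat.{u} n} {k : NFunctor K B.toNCat}
  {κ : LaxTrans (zero K C) (k.comp G.toNFunctor)}

/-- The component at a composite of two `(j+1)`-cells is a pasting of the components. -/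
theorem LaxTrans.app_comp (κ : LaxTrans (zero K C) (k.comp G.toNFunctor)) {j : ℕ} (hj : j < n)
    {f g : K.Cell} (hf : K.src (j + 1) f = f) (hg : K.src (j + 1) g = g)
    (hfg : K.tgt j f = K.src j g) :
    κ.app (K.comp j f g) = C.comp (j + 1)
      (C.comp j (κ.app f)
        (ker G (fun i => κ.app (K.src i g)) (fun i => κ.app (K.tgt i g)) (k.map g) j).2)
      (C.comp j (ker G (fun i => κ.app (K.src i f)) (fun i => κ.app (K.tgt i f)) (k.map f) j).1
        (κ.app g)) := by
  obtain ⟨m, rfl⟩ := Nat.exists_eq_add_of_lt hj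
  have h := ((isLaxTrans_iff _ _ _).1 κ.isLaxTrans).2 j m (by omega) f g hfg
  refine h.trans (vcomp_obj m (j + 1) (by omega) (fun l hl => ?_) (fun l hl => ?_) ?_ ?_)
  · rw [K.src_eq_of_le hf hl, K.src_eq_of_le hg hl]
  · rw [K.tgt_eq_of_le hf hl, K.tgt_eq_of_le hg hl]
  · have e := tower_src (κ.isBdry.frame g j) (i := j + 2) (by omega)
    rw [← NFunctor.map_src, ← NFunctor.map_src, K.src_eq_of_le hg (by omega)] at e
    have e2 := (congrArg Prod.snd e).symm
    dsimp only at e2 ⊢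
    rw [C.src_comp' (by omega), κ.isBdry.dim hf (Nat.lt_succ_self _), e2]
  · have e := tower_src (κ.isBdry.frame f j) (i := j + 2) (by omega)
    rw [← NFunctor.map_src, ← NFunctor.map_src, K.src_eq_of_le hf (by omega)] at e
    have e1 := (congrArg Prod.fst e).symm
    dsimp only at e1 ⊢
    rw [C.src_comp' (by omega), κ.isBdry.dim hg (Nat.lt_succ_self _), e1]

/-- The `h`-kernel inherits inverses: an inverse in `B` lifts, because the component that it needs
can be solved for in `C`. -/
theorem IsHKernel.hasInverses (hK : IsHKernel G K k κ) : K.HasInverses := by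
  intro j f hf
  rcases le_or_gt n j with hj | hj
  · refine ⟨f, hf, ?_, ?_, f, ?_, ?_⟩
    · rw [K.src_of_le hj, K.tgt_of_le hj]
    · rw [K.src_of_le hj, K.tgt_of_le hj]
    · rw [K.src_of_le (hj.trans (Nat.le_succ j)), K.comp_of_le hj]
    · rw [K.tgt_of_le (hj.trans (Nat.le_succ j)), K.src_of_le hj]
  have lt := Nat.lt_succ_self j
  obtain ⟨x, hxf⟩ : ∃ x, K.src j f = x := ⟨_, rfl⟩
  obtain ⟨y, hyf⟩ : ∃ y, K.tgt j f = y := ⟨_, rfl⟩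
  have hx : K.src j x = x := by rw [← hxf, K.src_src_of_le _ le_rfl]
  have hy : K.src j y = y := by rw [← hyf, K.src_tgt_of_le _ le_rfl]
  have hs : ∀ i < j, K.src i y = K.src i x := fun i hi => by
    rw [← hxf, ← hyf, K.src_tgt _ hi, K.src_src _ hi]
  have ht : ∀ i < j, K.tgt i y = K.tgt i x := fun i hi => by
    rw [← hxf, ← hyf, K.tgt_tgt _ hi, K.tgt_src _ hi]
  obtain ⟨g₀, hg₀, g₀s, g₀t, u₀, u₀s, u₀t⟩ := hasInverses_of_isGroupoid B.isGroupoid j (k.map f)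
    (by rw [← k.map_src, hf])
  have bs : B.src j (k.map f) = k.map x := by rw [← k.map_src, hxf]
  have bt : B.tgt j (k.map f) = k.map y := by rw [← k.map_tgt, hyf]
  rw [bt] at g₀s
  rw [bs] at g₀t u₀t
  obtain ⟨u, hu, us, ut⟩ : ∃ u, B.src (j + 2) u = u ∧ B.src (j + 1) u = B.comp j (k.map f) g₀ ∧
      B.tgt (j + 1) u = k.map x :=
    ⟨B.src (j + 2) u₀, B.src_src_of_le _ le_rfl, by rw [B.src_src _ (Nat.lt_succ_self _), u₀s],
      by rw [B.tgt_src _ (Nat.lt_succ_self _), u₀t]⟩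
  have kx : B.src j (k.map x) = k.map x := by rw [← k.map_src, hx]
  have ky : B.src j (k.map y) = k.map y := by rw [← k.map_src, hy]
  have usj : B.src j u = k.map x := by rw [← B.src_src u lt, us, B.src_self_comp, bs]
  have utj : B.tgt j u = k.map x := by rw [← B.tgt_tgt u lt, ut, B.tgt_eq_of_le kx le_rfl]
  -- the pair of functors between which the components at cells between `x` and `y` go
  obtain ⟨W, hW⟩ : ∃ W, W = ker G (fun i => κ.app (K.src i x))
      (fun i => κ.app (K.tgt i x)) := ⟨_, rfl⟩
  have Wf : ker G (fun i => κ.app (K.src i f)) (fun i => κ.app (K.tgt i f)) (k.map f) j =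
      W (k.map f) j := by
    rw [hW]
    exact tower_congr j (fun i hi => by rw [← hxf, K.src_src _ hi])
      (fun i hi => by rw [← hxf, K.tgt_src _ hi])
  have Wy : ∀ b, ker G (fun i => κ.app (K.src i y)) (fun i => κ.app (K.tgt i y)) b j = W b j := by
    intro b
    rw [hW]
    exact tower_congr j (fun i hi => by rw [hs i hi]) (fun i hi => by rw [ht i hi])
  -- `W` is functorial on the cells between `x` and `y`
  have pts : ∀ i, C.src i C.pt = C.pt := fun i => C.src_eq_of_le C.src_pt (Nat.zero_le i)
  have ptt : ∀ i, C.tgt i C.pt = C.pt := fun i => C.tgt_eq_of_le C.src_pt (Nat.zero_le i)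
  have frf := κ.frame_ker (G := G) bs bt ht
  have fru := κ.frame_ker (G := G) usj utj (fun _ _ => rfl)
  have frg : Frame C.toNCat (fun i => κ.app (K.src i x)) (fun i => κ.app (K.tgt i x)) C.pt
      (G.map g₀) j := by
    refine frame_congr frf (fun _ _ => rfl) (fun i hi => ?_) (fun _ _ => rfl) (fun i hi => ?_)
    · rw [← G.map_src, ← G.map_src, ← B.src_src (k.map f) hi, bs, ← g₀t, B.src_tgt _ hi]
    · rw [← G.map_tgt, ← G.map_tgt, ← B.tgt_src (k.map f) hi, bs, ← g₀t, B.tgt_tgt _ hi]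
  have wsrc : ∀ {b}, Frame C.toNCat (fun i => κ.app (K.src i x)) (fun i => κ.app (K.tgt i x)) C.pt
      (G.map b) j → ∀ {i}, j ≤ i → W (B.src i b) j = (C.src i (W b j).1, C.src i (W b j).2) := by
    intro b h i hi
    have := tower_src h hi
    rw [pts, ← G.map_src] at this
    rw [hW]
    exact this
  have wtgt : ∀ {b}, Frame C.toNCat (fun i => κ.app (K.src i x)) (fun i => κ.app (K.tgt i x)) C.pt
      (G.map b) j → ∀ {i}, j ≤ i → W (B.tgt i b) j = (C.tgt i (W b j).1, C.tgt i (W b j).2) := by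
    intro b h i hi
    have := tower_tgt h hi
    rw [ptt, ← G.map_tgt] at this
    rw [hW]
    exact this
  have wcomp : W (B.comp j (k.map f) g₀) j =
      (C.comp j (W (k.map f) j).1 (W g₀ j).1, C.comp j (W (k.map f) j).2 (W g₀ j).2) := by
    have := tower_comp frf frg le_rfl (by rw [pts, ptt])
      (by rw [← G.map_tgt, ← G.map_src, bt, g₀s])
    rw [C.comp_self_of_le C.src_pt (Nat.zero_le j), ← G.map_comp _ _ _ (by rw [bt, g₀s])] at this
    rw [hW]
    exact this
  have xs : C.src j (κ.app x) = (W (k.map x) j).1 := by rw [hW]; exact κ.ker_src hx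
  have xt : C.tgt j (κ.app x) = (W (k.map x) j).2 := by rw [hW]; exact κ.ker_tgt hx
  have ys : C.src j (κ.app y) = (W (k.map y) j).1 := by rw [← Wy]; exact κ.ker_src hy
  have yt : C.tgt j (κ.app y) = (W (k.map y) j).2 := by rw [← Wy]; exact κ.ker_tgt hy
  have fs := wsrc frf le_rfl
  have ft := wtgt frf le_rfl
  have gs := wsrc frg le_rfl
  have gt := wtgt frg le_rfl
  have f1 := wsrc frf (Nat.le_succ j)
  have g1 := wsrc frg (Nat.le_succ j)
  have u2 := wsrc fru (i := j + 2) (by omega)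
  have u1 := wsrc fru (Nat.le_succ j)
  have u1t := wtgt fru (Nat.le_succ j)
  rw [bs] at fs
  rw [bt] at ft
  rw [g₀s] at gs
  rw [g₀t] at gt
  rw [← k.map_src, hf] at f1
  rw [hg₀] at g1
  rw [hu] at u2
  rw [us, wcomp] at u1
  rw [ut] at u1t
  have φs : C.src (j + 1) (κ.app f) = C.comp j (κ.app x) (W (k.map f) j).2 := by
    have := κ.ker_src hf
    rw [ker, tower] at this
    rw [this, ← Wf, hxf]
  have φt : C.tgt (j + 1) (κ.app f) = C.comp j (W (k.map f) j).1 (κ.app y) := by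
    have := κ.ker_tgt hf
    rw [ker, tower] at this
    rw [this, ← Wf, hyf]
  simp only [Prod.ext_iff] at fs ft gs gt f1 g1 u2 u1 u1t
  obtain ⟨ψ, hψ, ψs, ψt, ρ₀, ρ₀s, ρ₀t⟩ :=
    (hasInverses_of_isGroupoid C.isGroupoid).exists_inverse_component
      (j := j) (Px := κ.app x) (Py := κ.app y) (F₀ := (W (k.map f) j).1) (F₁ := (W g₀ j).1)
      (G₀ := (W (k.map f) j).2) (G₁ := (W g₀ j).2) (U := (W u j).1) (V := (W u j).2)
      (φ := κ.app f) (κ.isBdry.dim hx lt) (κ.isBdry.dim hy lt) f1.1.symm g1.1.symm g1.2.symm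
      u2.1.symm u2.2.symm (κ.isBdry.dim hf (Nat.lt_succ_self _))
      (by rw [xt, fs.2]) (by rw [← ft.2, gs.2]) (by rw [yt, gs.2]) (by rw [ys, ft.1])
      (by rw [← ft.1, gs.1]) (by rw [xs, gt.1]) (by rw [xt, gt.2]) u1.1.symm
      (by rw [xs, u1t.1]) u1.2.symm (by rw [xt, u1t.2]) φs φt
  obtain ⟨g, hg, hgs, hgt, kg, κg⟩ := hK.exists_cell hy hx (fun i hi => (hs i hi).symm)
    (fun i hi => (ht i hi).symm) hg₀ g₀s g₀t hψ (by rw [Wy]; exact ψs) (by rw [Wy]; exact ψt)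
  have hfg : K.tgt j f = K.src j g := by rw [hyf, hgs]
  refine ⟨g, hg, by rw [hgs, hyf], by rw [hgt, hxf], ?_⟩
  have Wg : ker G (fun i => κ.app (K.src i g)) (fun i => κ.app (K.tgt i g)) g₀ j = W g₀ j := by
    rw [← Wy]
    exact tower_congr j (fun i hi => by rw [← hgs, K.src_src _ hi])
      (fun i hi => by rw [← hgs, K.tgt_src _ hi])
  have hc : κ.app (K.comp j f g) = C.comp (j + 1) (C.comp j (κ.app f) (W g₀ j).2)
      (C.comp j (W (k.map f) j).1 ψ) := by
    rw [κ.app_comp hj hf hg hfg, Wf, kg, Wg, κg]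
  have cs : K.src j (K.comp j f g) = x := by rw [K.src_self_comp, hxf]
  have ct : K.tgt j (K.comp j f g) = x := by rw [K.tgt_comp_self hfg, hgt]
  have csi : ∀ i < j, K.src i (K.comp j f g) = K.src i x := fun i hi => by
    rw [← K.src_src _ hi, cs]
  have cti : ∀ i < j, K.tgt i (K.comp j f g) = K.tgt i x := fun i hi => by
    rw [← K.tgt_src _ hi, cs]
  have Wc : ker G (fun i => κ.app (K.src i (K.comp j f g)))
      (fun i => κ.app (K.tgt i (K.comp j f g))) u j = W u j := by
    rw [hW]
    exact tower_congr j (fun i hi => by rw [csi i hi]) (fun i hi => by rw [cti i hi])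
  rw [ker] at Wc
  -- `u` and the pasting cell `ρ₀` form a cell of `K` from the composite of `f` and `g` to `x`
  obtain ⟨θ, -, θs, θt, -⟩ := hK.exists_cell (j := j + 1) (x := K.comp j f g) (y := x)
    (by rw [K.src_comp' lt, hf, hg]) (K.src_eq_of_le hx (Nat.le_succ j))
    (fun i hi => by
      rcases Nat.lt_succ_iff_lt_or_eq.1 hi with hi | rfl
      · rw [csi i hi]
      · rw [cs, hx])
    (fun i hi => by
      rcases Nat.lt_succ_iff_lt_or_eq.1 hi with hi | rfl
      · rw [cti i hi]
      · rw [ct, K.tgt_eq_of_le hx le_rfl])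
    (b := u) hu (by rw [us, k.map_comp _ _ _ hfg, kg]) ut (ψ := C.src (j + 3) ρ₀)
    (C.src_src_of_le _ le_rfl)
    (by
      rw [C.src_src _ (Nat.lt_succ_self _), ρ₀s, hc, ker, tower]
      dsimp only
      rw [Wc, ct])
    (by
      rw [C.tgt_src _ (Nat.lt_succ_self _), ρ₀t, ker, tower]
      dsimp only
      rw [Wc, cs]
      have : C.tgt (j + 1) (C.comp j (κ.app x) (W u j).2) = κ.app x := by
        rw [C.tgt_comp' lt, ← u1t.2, ← xt, C.tgt_eq_of_le (κ.isBdry.dim hx lt) le_rfl, C.comp_id]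
      have e := C.comp_id (j + 1) (C.comp j (κ.app x) (W u j).2)
      rw [this] at e
      exact e.symm)
  exact ⟨θ, θs, by rw [θt, hxf]⟩

end

/-! ### Surjectivity, one dimension at a time -/

namespace NFunctor

variable {n : ℕ} {C D : NCat.{u} n}

/-- Every object of the target is connected by a cell to an object in the image. -/
def EssSurj (L : NFunctor C D) : Prop :=
  ∀ d, D.src 0 d = d → ∃ c, C.src 0 c = c ∧ ∃ f, D.src 0 f = L.map c ∧ D.tgt 0 f = d

/-- Every `(j+1)`-cell between the images of two parallel `j`-cells is connected by a cell to the
image of a `(j+1)`-cell between them. -/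
def FullAt (L : NFunctor C D) (j : ℕ) : Prop :=
  ∀ x y d, C.src j x = x → C.src j y = y → (∀ i < j, C.src i x = C.src i y) →
    (∀ i < j, C.tgt i x = C.tgt i y) → D.src (j + 1) d = d → D.src j d = L.map x →
    D.tgt j d = L.map y → ∃ c, C.src (j + 1) c = c ∧ C.src j c = x ∧ C.tgt j c = y ∧
      ∃ f, D.src (j + 1) f = L.map c ∧ D.tgt (j + 1) f = d

end NFunctor

theorem IsHSurjective.essSurj_and_fullAt : ∀ {n : ℕ} {C D : NCat.{u} n} {L : NFunctor C D},
    IsHSurjective n L → L.EssSurj ∧ ∀ j < n, L.FullAt j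
  | 0, C, D, L, h => by
    refine ⟨fun d hd => ?_, fun j hj => absurd hj (Nat.not_lt_zero j)⟩
    obtain ⟨c, rfl⟩ := h d
    exact ⟨c, C.src_dim c, L.map c, D.src_dim _, D.tgt_dim _⟩
  | n + 1, C, D, L, h => by
    refine ⟨fun d hd => ?_, ?_⟩
    · obtain ⟨c, hc, f, hf, -⟩ := h.1 d hd
      exact ⟨c, hc, f, hf.src_zero, hf.tgt_zero⟩
    · rintro (_ | j) hj x y d hx hy hs ht hd hds hdt
      · obtain ⟨c, hc, f, hf, hft⟩ := (h.2 x y hx hy).essSurj_and_fullAt.1 ⟨d, hds, hdt⟩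
          (Subtype.ext hd)
        exact ⟨c.1, congrArg Subtype.val hc, c.2.1, c.2.2, f.1, congrArg Subtype.val hf,
          congrArg Subtype.val hft⟩
      · have p := Nat.succ_pos j
        obtain ⟨c, hc, hcs, hct, f, hf, hft⟩ := (h.2 (C.src 0 x) (C.tgt 0 x)
          (C.src_src_of_le _ le_rfl) (C.src_tgt_of_le _ le_rfl)).essSurj_and_fullAt.2 j
          (Nat.lt_of_succ_lt_succ hj) ⟨x, rfl, rfl⟩ ⟨y, (hs 0 p).symm, (ht 0 p).symm⟩
          ⟨d, by rw [← D.src_src d p, hds, ← L.map_src], by rw [← D.tgt_src d p, hds, ← L.map_tgt]⟩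
          (Subtype.ext hx) (Subtype.ext hy)
          (fun i hi => Subtype.ext (hs (i + 1) (Nat.succ_lt_succ hi)))
          (fun i hi => Subtype.ext (ht (i + 1) (Nat.succ_lt_succ hi)))
          (Subtype.ext hd) (Subtype.ext hds) (Subtype.ext hdt)
        exact ⟨c.1, congrArg Subtype.val hc, congrArg Subtype.val hcs, congrArg Subtype.val hct,
          f.1, congrArg Subtype.val hf, congrArg Subtype.val hft⟩

theorem isHSurjective_of_fullAt : ∀ {n : ℕ} {C D : NCat.{u} n} {L : NFunctor C D},
    IsGroupoid n D → L.EssSurj → (∀ j < n, L.FullAt j) → IsHSurjective n L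
  | 0, C, D, L, _, h, _ => by
    intro d
    obtain ⟨c, -, f, hf, hft⟩ := h d (D.src_dim d)
    rw [D.src_dim] at hf
    rw [D.tgt_dim] at hft
    exact ⟨c, hf.symm.trans hft⟩
  | n + 1, C, D, L, hD, h, hL => by
    refine ⟨fun d hd => ?_, fun x y hx hy => isHSurjective_of_fullAt
      (hD.2 _ _ (by rw [← L.map_src, hx]) (by rw [← L.map_src, hy])) ?_ ?_⟩
    · obtain ⟨c, hc, f, hf, hft⟩ := h d hd
      have ha : D.IsArrow (D.src 1 f) (L.map c) d := ⟨D.src_src_of_le _ le_rfl,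
        by rw [D.src_src _ Nat.one_pos, hf], by rw [D.tgt_src _ Nat.one_pos, hft]⟩
      exact ⟨c, hc, _, ha, hD.1 _ _ _ ha⟩
    · intro d hd
      obtain ⟨c, hc, hcs, hct, f, hf, hft⟩ := hL 0 (Nat.succ_pos n) x y d.1 hx hy
        (fun i hi => absurd hi (Nat.not_lt_zero i)) (fun i hi => absurd hi (Nat.not_lt_zero i))
        (congrArg Subtype.val hd) d.2.1 d.2.2
      exact ⟨⟨c, hcs, hct⟩, Subtype.ext hc,
        ⟨f, by rw [← D.src_src f Nat.one_pos, hf, ← L.map_src, hcs],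
          by rw [← D.tgt_src f Nat.one_pos, hf, ← L.map_tgt, hct]⟩,
        Subtype.ext hf, Subtype.ext hft⟩
    · intro j hj a b d ha hb hs ht hd hds hdt
      obtain ⟨c, hc, hcs, hct, f, hf, hft⟩ := hL (j + 1) (Nat.succ_lt_succ hj) a.1 b.1 d.1
        (congrArg Subtype.val ha) (congrArg Subtype.val hb)
        (fun i hi => by
          rcases i with _ | i
          · rw [a.2.1, b.2.1]
          · exact congrArg Subtype.val (hs i (Nat.lt_of_succ_lt_succ hi)))
        (fun i hi => by
          rcases i with _ | i
          · rw [a.2.2, b.2.2]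
          · exact congrArg Subtype.val (ht i (Nat.lt_of_succ_lt_succ hi)))
        (congrArg Subtype.val hd) (congrArg Subtype.val hds) (congrArg Subtype.val hdt)
      have p := Nat.succ_pos j
      have p' := Nat.succ_pos (j + 1)
      have c0 : C.src 0 c = x := by rw [← C.src_src c p, hcs, a.2.1]
      have c1 : C.tgt 0 c = y := by rw [← C.tgt_src c p, hcs, a.2.2]
      exact ⟨⟨c, c0, c1⟩, Subtype.ext hc, Subtype.ext hcs, Subtype.ext hct,
        ⟨f, by rw [← D.src_src f p', hf, ← L.map_src, c0],
          by rw [← D.tgt_src f p', hf, ← L.map_tgt, c1]⟩, Subtype.ext hf, Subtype.ext hft⟩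

/-! ### Exactness of `π₀` -/

theorem IsGroupoid.tgt_toPi {n : ℕ} {K : NCat.{u} (n + 1)} (hK : IsGroupoid (n + 1) K) (i : ℕ)
    (z : K.Cell) : K.piZero.tgt i (K.toPi z) = K.toPi (K.tgt i z) := by
  rcases lt_trichotomy i n with hi | rfl | hi
  · exact NCat.toPi_tgt hi z
  · rw [NCat.tgt_dim, toPi_src_eq_toPi_tgt hK]
  · rw [NCat.tgt_of_le _ hi.le, K.tgt_of_le hi]

theorem IsHKernel.eq_of_coneData_eq {n : ℕ} {B C : PtGpd.{u} n} {G : PtFunctor B C} {K : NCat.{u} n}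
    {k : NFunctor K B.toNCat} {κ : LaxTrans (zero K C) (k.comp G.toNFunctor)}
    (hK : IsHKernel G K k κ) {z z' : K.Cell} (h : coneData κ z = coneData κ z') : z = z' :=
  hK.cell_ext (coneData_eq_iff.1 h).1 (coneData_eq_iff.1 h).2.1 (coneData_eq_iff.1 h).2.2

/-- The comparison functor to an `h`-kernel. -/
theorem IsHKernel.exists_comparison {n : ℕ} {B C : PtGpd.{u} n} {G : PtFunctor B C}
    {K X : NCat.{u} n}
    {k : NFunctor K B.toNCat} {κ : LaxTrans (zero K C) (k.comp G.toNFunctor)}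
    (hK : IsHKernel G K k κ) {S : NFunctor X B.toNCat}
    (lam : LaxTrans (zero X C) (S.comp G.toNFunctor)) :
    ∃ L : NFunctor X K, (L.comp k = S ∧ ∀ x, κ.app (L.map x) = lam.app x) ∧
      ∀ x, coneData κ (L.map x) = coneData lam x := by
  obtain ⟨L, ⟨-, h1, h2⟩, -⟩ := hK X (NFunctor.toTerminal X) S lam
  refine ⟨L, ⟨h1, h2⟩, fun x => coneData_eq_iff.2 ⟨?_, fun j => ?_, fun j => ?_⟩⟩
  · rw [← h1]; rfl
  · rw [← L.map_src, h2]
  · rw [← L.map_tgt, h2]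

/-- If the comparison of a cone `ε` with the kernel of `G` is `h`-surjective, then so is the
comparison of `π₀ ε` with the kernel of `π₀ G`. -/
theorem IsHSurjective.comparison_piZero {n : ℕ} {B C : PtGpd.{u} (n + 1)} {G : PtFunctor B C}
    {A K : NCat.{u} (n + 1)} {k : NFunctor K B.toNCat}
    {κ : LaxTrans (zero K C) (k.comp G.toNFunctor)} {F : NFunctor A B.toNCat}
    {ε : LaxTrans (zero A C) (F.comp G.toNFunctor)} {H : NCat.{u} n}
    {q : NFunctor H B.piZero.toNCat}
    {χ : LaxTrans (zero H C.piZero) (q.comp G.piZero.toNFunctor)} (hA : IsGroupoid (n + 1) A)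
    (hK : IsHKernel G K k κ) (hH : IsHKernel G.piZero H q χ) {L : NFunctor A K}
    (hLk : L.comp k = F) (hLκ : ∀ a, κ.app (L.map a) = ε.app a) (hL : IsHSurjective (n + 1) L)
    {M : NFunctor A.piZero H} (hM : ∀ x, coneData χ (M.map x) = coneData ε.piCone x) :
    IsHSurjective n M := by
  have gK : IsGroupoid (n + 1) K := hK.hasInverses.isGroupoid
  obtain ⟨hL0, hL1⟩ := hL.essSurj_and_fullAt
  obtain ⟨J, -, hJ⟩ := hH.exists_comparison κ.piCone
  have ML' : ∀ a, A.src n a = a → M.map (A.toPi a) = J.map (K.toPi (L.map a)) := by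
    intro a ha
    refine hH.eq_of_coneData_eq ?_
    rw [hM, hJ]
    refine (coneData_toPi_eq_iff ha (by rw [← L.map_src, ha])).2 ⟨?_, fun j => ?_, fun j => ?_⟩
    · rw [← hLk]; rfl
    · rw [← L.map_src, hLκ]
    · rw [← L.map_tgt, hLκ]
  have ML : ∀ a, M.map (A.toPi a) = J.map (K.toPi (L.map a)) := by
    intro a
    rw [← NCat.toPi_src_dim, ML' _ (A.src_src_of_le a le_rfl), L.map_src, NCat.toPi_src_dim]
  have lift : ∀ {d z}, coneData χ d = coneData κ.piCone (K.toPi z) → d = J.map (K.toPi z) :=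
    fun h => hH.eq_of_coneData_eq (by rw [h, hJ])
  -- a cell of `K` that connects `L c` to `z` gives a cell of `H` that connects `M c` to `J z`
  have proj : ∀ {j c f z}, K.src j f = L.map c → K.tgt j f = z →
      H.src j (J.map (K.toPi f)) = M.map (A.toPi c) ∧
      H.tgt j (J.map (K.toPi f)) = J.map (K.toPi z) := by
    rintro j c f z hs rfl
    exact ⟨by rw [← J.map_src, src_toPi, hs, ML], by rw [← J.map_tgt, gK.tgt_toPi]⟩
  have rep : ∀ {j x}, A.piZero.src j x = x → ∃ a, A.src j a = a ∧ A.toPi a = x := by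
    intro j x hx
    obtain ⟨a, -, rfl⟩ := NCat.exists_toPi x
    exact ⟨A.src j a, A.src_src_of_le _ le_rfl, by rw [← src_toPi, hx]⟩
  refine isHSurjective_of_fullAt hH.hasInverses.isGroupoid ?_ ?_
  · intro d hd
    obtain ⟨z, hz, hdz⟩ := hK.exists_lift_obj χ hd
    obtain ⟨c, hc, f, hf, hft⟩ := hL0 z hz
    refine ⟨A.toPi c, by rw [src_toPi, hc], J.map (K.toPi f), ?_⟩
    rw [lift hdz]
    exact proj hf hft
  · intro j hj x y d hx hy hs ht hd hds hdt
    obtain ⟨a, ha, rfl⟩ := rep hx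
    obtain ⟨b, hb, rfl⟩ := rep hy
    obtain ⟨z, hz, hzs, hzt, hdz⟩ := hK.exists_lift χ hj hd (a := L.map a) (a' := L.map b)
      (by rw [← L.map_src, ha]) (by rw [← L.map_src, hb]) (by rw [hds, ML, hJ])
      (by rw [hdt, ML, hJ])
    -- below dimension `n` the classes are singletons, so `a` and `b` are parallel
    obtain ⟨c, hc, hcs, hct, f, hf, hft⟩ := hL1 j (Nat.lt_succ_of_lt hj) a b z ha hb
      (fun i hi => NCat.eq_of_toPi_eq (hi.trans hj) (by rw [← src_toPi, hs i hi, src_toPi])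
        (A.src_src_of_le _ le_rfl) (A.src_src_of_le _ le_rfl))
      (fun i hi => NCat.eq_of_toPi_eq (hi.trans hj)
        (by rw [← hA.tgt_toPi, ht i hi, hA.tgt_toPi])
        (A.src_tgt_of_le _ le_rfl) (A.src_tgt_of_le _ le_rfl)) hz hzs hzt
    refine ⟨A.toPi c, by rw [src_toPi, hc], by rw [src_toPi, hcs], by rw [hA.tgt_toPi, hct],
      J.map (K.toPi f), ?_⟩
    rw [lift hdz]
    exact proj hf hft

end HigherGpd

/-- `π₀` preserves exact triples of pointed groupoids. -/
theorem mainTheorem1 (n : ℕ) {A B C : HigherGpd.PtGpd.{u} (n + 1)} (T : HigherGpd.Triple A B C)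
    (hT : T.IsExact) : T.piZero.IsExact := by
  obtain ⟨K, k, κ, hK, L, hLk, hLκ, hL⟩ := hT
  obtain ⟨H, q, χ, hH⟩ := hK.exists_piZero
  obtain ⟨M, ⟨hMq, hMχ⟩, hM⟩ := hH.exists_comparison
    (HigherGpd.LaxTrans.piCone (K := A.toNCat) T.ε)
  exact ⟨H, q, χ, hH, M, hMq, hMχ, hL.comparison_piZero A.isGroupoid hK hH hLk hLκ hM⟩
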